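/- Let $\mathcal M\subset\mathbb R^3$ be a compact embedded $C^3$ surface without boundary, with the induced metric $g$, area measure $\mathrm{vol}$ and area $\mathcal A(\mathcal M)$. For $u\in W^{3,\infty}(\mathcal M)$ (identified with its continuous representative) let $\|u\|_{3,\infty,\mathcal M}=\max_{0\le m\le 3}\operatorname{ess\,sup}_{\mathcal M}|\nabla^m u|_g$, with weak covariant derivatives, and let $\nabla_g u$ be the tangential gradient. **Mesh.** Let $\mathcal M_h$ be a finite conforming mesh of plane triangles in $\mathbb R^3$ with all its vertices $x_i$ on $\mathcal M$, let $h$ be the largest diameter of a triangle and $h_i$ the length of the longest edge at $x_i$. Let $P_h:\mathcal M_h\to\mathcal M$ be a continuous bijection with $P_h(x_i)=x_i$ for all $i$, and put $T_h^{-1}v=v\circ P_h^{-1}$. The linear interpolant $v_I$ of nodal values is the function on $\mathcal M_h$ that is affine on each triangle and has these values at the vertices. **Recovery operator (PPPR).** For each vertex $x_i$ choose an orthonormal basis $(\phi_i^1,\phi_i^2,\phi_i^3)$ of $\mathbb R^3$ and an integer $k_i$. Let $B(x_i)=\{x_j:|x_j-x_i|\le k_ih_i\}$ and, for $x_j\in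 B(x_i)$, let $\zeta_{ij}=(\langle x_j-x_i,\phi_i^1\rangle,\langle x_j-x_i,\phi_i^2\rangle)\in\mathbb R^2$. Let $s_i$ and $p_i$ be the polynomials of degree at most $2$ in two variables that minimize $\sum_j|s(\zeta_{ij})-\langle x_j,\phi_i^3\rangle|^2$ and $\sum_j|p(\zeta_{ij})-v(x_j)|^2$, sums over $x_j\in B(x_i)$; the competitors are either all such polynomials, or, in the value-preserving variant, those whose value at $0$ equals the datum at $x_i$. Put $$G_hv(x_i)=(\partial_1p_i(0),\partial_2p_i(0))\,(J_i^\top J_i)^{-1}J_i^\top\,(\phi_i^1\ \phi_i^2\ \phi_i^3)^\top,\qquad J_i^\top=\begin{pmatrix}1&0&\partial_1s_i(0)\\0&1&\partial_2s_i(0)\end{pmatrix},$$ and let $G_hv$ on $\mathcal M_h$ be the linear interpolant of these nodal values. **Regularity with constant $\kappa$.** Assume that (i) $|P_h(x)-x|\le\kappa h^2$ for all $x\in\mathcal M_h$; (ii) $k_i\le\kappa$ for all $i$; (iii) for all $i$ and all tangent vectors $w\in T_{x_i}\mathcal M$, $|w|\le\kappa\,|(\langle w,\phi_i^1\rangle,\langle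 w,\phi_i^2\rangle)|$, that is, the parametrization of $\mathcal M$ near $x_i$ as a graph over the parameter plane has differential of norm at most $\kappa$ at $x_i$; (iv) the rank condition holds uniformly: for all $i$, every polynomial $q$ of degree at most $2$ (with $q(0)=0$ in the value-preserving variant) satisfies $$\max_{|y|\le h_i}|q(y)|\le\kappa\Big(\frac1{|B(x_i)|}\sum_{x_j\in B(x_i)}|q(\zeta_{ij})|^2\Big)^{1/2}.$$ **Claim.** There is a constant $D=D(\mathcal M,g,\kappa)>0$, depending on $(\mathcal M,g)$ and $\kappa$ only, such that for all such meshes, maps $P_h$, frames and stencils that are regular with constant $\kappa$, and all $u\in W^{3,\infty}(\mathcal M)$ with linear interpolant $u_I$, the gradient $\nabla_gu$ exists at every point of $\mathcal M$ and $$\|\nabla_gu-T_h^{-1}G_hu_I\|_{0,\mathcal M}\le h^2\sqrt{\mathcal A(\mathcal M)}\;D\;\|u\|_{3,\infty,\mathcal M}.$$ -/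

import Mathlib

open MeasureTheory
open scoped InnerProductSpace ContDiff

noncomputable section

namespace PPPR

/-- The parameter plane. -/
abbrev E2 := EuclideanSpace ℝ (Fin 2)

/-- The ambient space. -/
abbrev E3 := EuclideanSpace ℝ (Fin 3)

/-! ### Surfaces and their parametrizations -/

/-- `r : U → M` is a regular `C³` parametrization of a relatively open patch of `M`: an injective
immersion of class `C³` that is open onto its image, the image being relatively open in `M`. -/
structure IsLocalParam (M : Set E3) (U : Set E2) (r : E2 → E3) : Prop where
  isOpen : IsOpen U
  contDiffOn : ContDiffOn ℝ 3 r U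
  injOn : Set.InjOn r U
  immersion : ∀ ζ ∈ U, Function.Injective (fderiv ℝ r ζ)
  isOpenMap : ∀ O ⊆ U, IsOpen O → ∃ V : Set E3, IsOpen V ∧ r '' O = M ∩ V

/-- A compact embedded `C³` surface without boundary in three-space. It carries the metric induced
by the Euclidean inner product. -/
structure IsClosedSurface (M : Set E3) : Prop where
  isCompact : IsCompact M
  exists_param : ∀ x ∈ M, ∃ (U : Set E2) (r : E2 → E3), IsLocalParam M U r ∧ x ∈ r '' U

/-- `v` is the gradient of `u : M → ℝ` at `x`: `u` is differentiable at `x` in every local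
parametrization, `v` is tangent to `M`, and its inner product with each tangent vector `w` is the
derivative of `u` in the direction `w`. -/
def HasSurfaceGradientAt (M : Set E3) (u : E3 → ℝ) (x v : E3) : Prop :=
  ∀ (U : Set E2) (r : E2 → E3), IsLocalParam M U r → ∀ ζ ∈ U, r ζ = x →
    DifferentiableAt ℝ (u ∘ r) ζ ∧ v ∈ (fderiv ℝ r ζ).range ∧
      ∀ w : E2, ⟪v, fderiv ℝ r ζ w⟫_ℝ = fderiv ℝ (u ∘ r) ζ w

/-! ### The space `W^{3,∞}(M)` -/

/-- Classical partial derivative. -/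
def pd {F : Type*} [NormedAddCommGroup F] [NormedSpace ℝ F] (i : Fin 2) (f : E2 → F) : E2 → F :=
  fun ζ => fderiv ℝ f ζ (EuclideanSpace.single i 1)

/-- `f'` is the weak `i`-th partial derivative of `f` on the open set `U`. -/
structure HasWeakPartial (U : Set E2) (i : Fin 2) (f f' : E2 → ℝ) : Prop where
  locallyIntegrable : LocallyIntegrableOn f U
  locallyIntegrable_deriv : LocallyIntegrableOn f' U
  integral_eq : ∀ θ : E2 → ℝ, ContDiff ℝ ∞ θ → HasCompactSupport θ → tsupport θ ⊆ U →
    ∫ ζ, f ζ * pd i θ ζ = -∫ ζ, f' ζ * θ ζ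

/-- The metric tensor `g_{ij}` in the parametrization `r`. -/
def metric (r : E2 → E3) (ζ : E2) : Matrix (Fin 2) (Fin 2) ℝ :=
  Matrix.of fun i j => ⟪pd i r ζ, pd j r ζ⟫_ℝ

/-- The Christoffel symbol `Γ^k_{ij}`. -/
def christoffel (r : E2 → E3) (k i j : Fin 2) (ζ : E2) : ℝ :=
  (1 / 2) * ∑ l, (metric r ζ)⁻¹ k l *
    (pd i (fun ξ => metric r ξ j l) ζ + pd j (fun ξ => metric r ξ i l) ζ
      - pd l (fun ξ => metric r ξ i j) ζ)

/-- The norm of a covariant tensor `T` of order `m` with respect to the metric `g`. -/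
def tensorNorm (g : Matrix (Fin 2) (Fin 2) ℝ) {m : ℕ} (T : (Fin m → Fin 2) → ℝ) : ℝ :=
  √(∑ I, ∑ J, (∏ s, g⁻¹ (I s) (J s)) * T I * T J)

/-- Second covariant derivative, from the partial derivatives `a i` and `b i j` of orders one and
two. -/
def cov2 (r : E2 → E3) (a : Fin 2 → E2 → ℝ) (b : Fin 2 → Fin 2 → E2 → ℝ)
    (i j : Fin 2) (ζ : E2) : ℝ :=
  b i j ζ - ∑ l, christoffel r l i j ζ * a l ζ

/-- Third covariant derivative `∇_k (∇² u)_{ij}`, from the partial derivatives `a i`, `b i j` and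
`c i j k` of orders one to three. -/
def cov3 (r : E2 → E3) (a : Fin 2 → E2 → ℝ) (b : Fin 2 → Fin 2 → E2 → ℝ)
    (c : Fin 2 → Fin 2 → Fin 2 → E2 → ℝ) (i j k : Fin 2) (ζ : E2) : ℝ :=
  c i j k ζ - ∑ l, (pd k (christoffel r l i j) ζ * a l ζ + christoffel r l i j ζ * b l k ζ)
    - ∑ l, christoffel r l k i ζ * cov2 r a b l j ζ
    - ∑ l, christoffel r l k j ζ * cov2 r a b i l ζ

/-- In every local parametrization, `u` is three times weakly differentiable and its covariant
derivatives of orders `0` to `3` are bounded by `B` almost everywhere. -/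
def SobolevBound (M : Set E3) (u : E3 → ℝ) (B : ℝ) : Prop :=
  ∀ (U : Set E2) (r : E2 → E3), IsLocalParam M U r →
    ∃ (a : Fin 2 → E2 → ℝ) (b : Fin 2 → Fin 2 → E2 → ℝ) (c : Fin 2 → Fin 2 → Fin 2 → E2 → ℝ),
      (∀ i, HasWeakPartial U i (u ∘ r) (a i)) ∧
      (∀ i j, HasWeakPartial U j (a i) (b i j)) ∧
      (∀ i j k, HasWeakPartial U k (b i j) (c i j k)) ∧
      ∀ᵐ ζ ∂(volume.restrict U),
        |u (r ζ)| ≤ B ∧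
        tensorNorm (metric r ζ) (fun I : Fin 1 → Fin 2 => a (I 0) ζ) ≤ B ∧
        tensorNorm (metric r ζ) (fun I : Fin 2 → Fin 2 => cov2 r a b (I 0) (I 1) ζ) ≤ B ∧
        tensorNorm (metric r ζ) (fun I : Fin 3 → Fin 2 => cov3 r a b c (I 0) (I 1) (I 2) ζ) ≤ B

/-- `u ∈ W^{3,∞}(M)`, where `u` is the continuous representative. -/
def MemSobolev (M : Set E3) (u : E3 → ℝ) : Prop :=
  ContinuousOn u M ∧ ∃ B, SobolevBound M u B

/-- `‖u‖_{3,∞,M}`, the largest of the essential suprema of the covariant derivatives of orders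
`0` to `3`. -/
def sobolevNorm (M : Set E3) (u : E3 → ℝ) : ℝ :=
  sInf {B | 0 ≤ B ∧ SobolevBound M u B}

/-! ### Triangulated surfaces -/

/-- A finite conforming mesh of plane triangles in three-space, as a geometric simplicial complex
each face of which lies in a triangle. -/
structure TriMesh extends Geometry.SimplicialComplex ℝ E3 where
  finite_faces : faces.Finite
  exists_triangle : ∀ s ∈ faces, ∃ t ∈ faces, s ⊆ t ∧ t.card = 3

namespace TriMesh

variable (T : TriMesh)

/-- The polyhedral surface `M_h`. -/
def carrier : Set E3 := T.toSimplicialComplex.space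

theorem finite_vertices : T.toSimplicialComplex.vertices.Finite :=
  Set.Finite.preimage (f := fun x : E3 => ({x} : Finset E3))
    (fun _ _ _ _ h => Finset.singleton_injective h) T.finite_faces

/-- The vertices of the mesh. -/
def nodes : Finset E3 := T.finite_vertices.toFinset

/-- The mesh size `h`: the largest diameter of a triangle. -/
def meshSize : ℝ :=
  sSup ((fun s : Finset E3 => Metric.diam (convexHull ℝ (s : Set E3))) ''
    {s | s ∈ T.faces ∧ s.card = 3})

/-- The length of the longest edge attached to the node `x`. -/
def localSize (x : E3) : ℝ :=
  sSup (dist x '' {y | ∃ s ∈ T.faces, x ∈ s ∧ y ∈ s})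

/-- The nodes at distance at most `k` times the local mesh size from `x`. -/
def stencil (k : ℕ) (x : E3) : Finset E3 :=
  open Classical in T.nodes.filter fun y => dist y x ≤ k * T.localSize x

/-- The continuous function on `M_h` that is affine on each triangle and has the values `V` at the
nodes (its values off `M_h` are irrelevant). -/
def interp {F : Type*} [NormedAddCommGroup F] [NormedSpace ℝ F] (V : E3 → F) (x : E3) : F :=
  Classical.epsilon fun y => ∃ s ∈ T.faces, ∃ w : E3 → ℝ,
    (∀ v ∈ s, 0 ≤ w v) ∧ ∑ v ∈ s, w v = 1 ∧ ∑ v ∈ s, w v • v = x ∧ y = ∑ v ∈ s, w v • V v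

end TriMesh

/-! ### The recovery operator -/

/-- The quadratic polynomial with coefficients `a`. -/
def quad (a : Fin 6 → ℝ) (y : E2) : ℝ :=
  a 0 + a 1 * y 0 + a 2 * y 1 + a 3 * y 0 ^ 2 + a 4 * (y 0 * y 1) + a 5 * y 1 ^ 2

/-- Coordinates, in the first two vectors of `φ`, of the orthogonal projection of `w` to the plane
spanned by them. -/
def planeCoord (φ : OrthonormalBasis (Fin 3) ℝ E3) (w : E3) : E2 :=
  !₂[⟪φ 0, w⟫_ℝ, ⟪φ 1, w⟫_ℝ]

/-- `a` is a least squares fit of the data `f` on `S` by quadratic polynomials in the plane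
coordinates centred at `x`. If `pin` is true, only polynomials that take the value `f x` at the
origin compete; if `pin` is false, all do. -/
def IsLeastSquares (pin : Bool) (φ : OrthonormalBasis (Fin 3) ℝ E3) (x : E3) (S : Finset E3)
    (f : E3 → ℝ) (a : Fin 6 → ℝ) : Prop :=
  (pin = true → a 0 = f x) ∧
    ∀ b : Fin 6 → ℝ, (pin = true → b 0 = f x) →
      ∑ y ∈ S, (quad a (planeCoord φ (y - x)) - f y) ^ 2 ≤
        ∑ y ∈ S, (quad b (planeCoord φ (y - x)) - f y) ^ 2

/-- The least squares fit (unique under the rank condition). -/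
def leastSquares (pin : Bool) (φ : OrthonormalBasis (Fin 3) ℝ E3) (x : E3) (S : Finset E3)
    (f : E3 → ℝ) : Fin 6 → ℝ :=
  Classical.epsilon (IsLeastSquares pin φ x S f)

/-- `J(s)ᵀ` for a graph whose height has first partial derivatives `s 1`, `s 2` at the origin. -/
def jacT (s : Fin 6 → ℝ) : Matrix (Fin 2) (Fin 3) ℝ :=
  !![1, 0, s 1; 0, 1, s 2]

/-- The recovered gradient at the node `x`: fit the surface (as a graph over the plane of the first
two vectors of `φ`) and the data `v` by quadratic polynomials, with coefficients `s` and `p`, and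
form `(∂₁p(0), ∂₂p(0)) (JᵀJ)⁻¹Jᵀ (φ¹ φ² φ³)ᵀ`. -/
def nodalGradient (pin : Bool) (φ : OrthonormalBasis (Fin 3) ℝ E3) (x : E3) (S : Finset E3)
    (v : E3 → ℝ) : E3 :=
  let s := leastSquares pin φ x S fun y => ⟪y, φ 2⟫_ℝ
  let p := leastSquares pin φ x S v
  ∑ m, (Matrix.vecMul ![p 1, p 2] ((jacT s * (jacT s).transpose)⁻¹ * jacT s)) m • φ m

/-- The recovery operator `G_h`, acting on a function `v` on `M_h`: at each node `x` the gradient is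
recovered with the frame `φ x` and the stencil of index `k x`, and the nodal values are
interpolated linearly. -/
def recovery (T : TriMesh) (pin : Bool) (φ : E3 → OrthonormalBasis (Fin 3) ℝ E3) (k : E3 → ℕ)
    (v : E3 → ℝ) : E3 → E3 :=
  T.interp fun x => nodalGradient pin (φ x) x (T.stencil (k x) x) v

/-- The operator `T_h⁻¹`, composition with `P⁻¹ : M → M_h`. -/
def pullBack {F : Type*} (T : TriMesh) (P : E3 → E3) (v : E3 → F) : E3 → F :=
  fun y => v (Function.invFunOn P T.carrier y)

/-- The mesh `T` approximates `M` with constant `κ`: its nodes lie on `M`, and `P` is a continuous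
bijection from `M_h` onto `M` that fixes the nodes and moves no point by more than `κ h²`. -/
structure IsApproximation (M : Set E3) (T : TriMesh) (P : E3 → E3) (κ : ℝ) : Prop where
  nodes_mem : ∀ x ∈ T.nodes, x ∈ M
  continuousOn : ContinuousOn P T.carrier
  bijOn : Set.BijOn P T.carrier M
  fixes : ∀ x ∈ T.nodes, P x = x
  near : ∀ x ∈ T.carrier, ‖P x - x‖ ≤ κ * T.meshSize ^ 2

/-- The frames and stencils are admissible with constant `κ`: the stencil radii are at most `κ`
local mesh sizes; at each node the parametrization of `M` as a graph over the parameter plane has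
differential of norm at most `κ`; and the rank condition holds uniformly, that is, a competing
quadratic polynomial is bounded, at the scale of the local mesh size, by `κ` times the root mean
square of its values at the projected stencil. -/
structure IsAdmissible (M : Set E3) (T : TriMesh) (pin : Bool)
    (φ : E3 → OrthonormalBasis (Fin 3) ℝ E3) (k : E3 → ℕ) (κ : ℝ) : Prop where
  index_le : ∀ x ∈ T.nodes, (k x : ℝ) ≤ κ
  graph : ∀ x ∈ T.nodes, ∀ (U : Set E2) (r : E2 → E3), IsLocalParam M U r → ∀ ζ ∈ U, r ζ = x →
    ∀ w : E2, ‖fderiv ℝ r ζ w‖ ≤ κ * ‖planeCoord (φ x) (fderiv ℝ r ζ w)‖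
  rank : ∀ x ∈ T.nodes, ∀ a : Fin 6 → ℝ, (pin = true → a 0 = 0) →
    ∀ y : E2, ‖y‖ ≤ T.localSize x →
      |quad a y| ≤ κ * √((∑ z ∈ T.stencil (k x) x, quad a (planeCoord (φ x) (z - x)) ^ 2) /
        (T.stencil (k x) x).card)

end PPPR

end

set_option maxSynthPendingDepth 3

namespace PPPR

open scoped Topology

/-! ### Taylor estimates -/

section Taylor

variable {E F : Type*} [NormedAddCommGroup E] [NormedSpace ℝ E] [NormedAddCommGroup F]
  [NormedSpace ℝ F]

/-! Near a node `x` the surface is a graph over the parameter plane. Its height and `u` both agree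
there, up to third order, with quadratic polynomials in the plane coordinates
(`HasTaylorBound.exists_quad`). These Taylor polynomials take the exact value at the node, so they
compete in both variants of the least squares problem, and they fit the data up to `O(h³)`, `h`
being the local mesh size. By minimality the computed fits differ from them by `O(h³)` in root mean
square over the stencil. The rank condition makes this a bound on the disc of radius `h`, hence an
`O(h²)` bound for the linear coefficients (`IsLeastSquares.abs_coeff_sub_le`). The recovery formula
solves a linear system whose matrix is the identity plus a skew matrix, so it is stable whatever the
recovered slopes are (`IsGraphGradient.abs_sub_le`). This gives second order accuracy at the nodes
(`norm_sub_nodalGradient_le_of_small`).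

Away from the nodes, the gradient of `u` has a first order expansion with quadratic remainder in a
chart, so its linear interpolation errs by `O(h²)`, `h` now being the global mesh size. A
displacement of order `h²` between the polyhedron and the surface costs no more
(`exists_interpolation_error_bound`).

The analytic input is that a function in `W^{3,∞}` has second order Taylor expansions with constants
proportional to its norm. Bounds on covariant derivatives give bounds on weak coordinate derivatives
(`exists_coordinate_bound`). Mollifications inherit these bounds, and the resulting Taylor
inequalities survive the limit (`exists_hasTaylorBound_of_sobolevBound`). Compactness makes chart
sizes and constants uniform (`exists_uniform_chartBound`). On meshes too coarse for the charts the
mesh size is bounded below and crude bounds suffice. The pointwise estimate is finally integrated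
over the surface, whose area is finite. -/

theorem norm_first_order_remainder_le {s : Set E} (hs : Convex ℝ s) {f : E → F}
    {f' : E → E →L[ℝ] F} (hf : ∀ x ∈ s, HasFDerivAt f (f' x) x) {K : ℝ} (hK0 : 0 ≤ K)
    (hK : ∀ x ∈ s, ∀ y ∈ s, ‖f' y - f' x‖ ≤ K * ‖y - x‖) {x y : E} (hx : x ∈ s) (hy : y ∈ s) :
    ‖f y - f x - f' x (y - x)‖ ≤ K * ‖y - x‖ ^ 2 := by
  have hseg : segment ℝ x y ⊆ s := hs.segment_subset hx hy
  have := (convex_segment (𝕜 := ℝ) x y).norm_image_sub_le_of_norm_hasFDerivWithin_le'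
    (f := f) (f' := f') (φ := f' x) (C := K * ‖y - x‖)
    (fun z hz => (hf z (hseg hz)).hasFDerivWithinAt) (fun z hz => by
      refine (hK x hx z (hseg hz)).trans ?_
      gcongr
      rw [← dist_eq_norm, ← dist_eq_norm, dist_comm z, dist_comm y]
      rw [segment_eq_image_lineMap] at hz
      obtain ⟨t, ht, rfl⟩ := hz
      rw [dist_left_lineMap, Real.norm_of_nonneg ht.1]
      exact mul_le_of_le_one_left dist_nonneg ht.2)
    (left_mem_segment ℝ x y) (right_mem_segment ℝ x y)
  calc _ ≤ K * ‖y - x‖ * ‖y - x‖ := this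
    _ = _ := by ring

/-- The mean value inequality is applied along the segment to `f` minus its Taylor polynomial; the
derivative of that difference is the first order remainder of `f'`. The constant is not optimal. -/
theorem norm_second_order_remainder_le {s : Set E} (hs : Convex ℝ s) {f : E → F}
    {f' : E → E →L[ℝ] F} {f'' : E → E →L[ℝ] E →L[ℝ] F} (hf : ∀ x ∈ s, HasFDerivAt f (f' x) x)
    (hf' : ∀ x ∈ s, HasFDerivAt f' (f'' x) x) {K : ℝ} (hK0 : 0 ≤ K)
    (hK : ∀ x ∈ s, ∀ y ∈ s, ‖f'' y - f'' x‖ ≤ K * ‖y - x‖) {x y : E} (hx : x ∈ s) (hy : y ∈ s) :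
    ‖f y - f x - f' x (y - x) - (1 / 2 : ℝ) • f'' x (y - x) (y - x)‖ ≤ K * ‖y - x‖ ^ 3 := by
  set d := y - x with hd
  have hmem : ∀ t ∈ Set.Icc (0 : ℝ) 1, x + t • d ∈ s := fun t ht => by
    have := hs.add_smul_sub_mem hx hy ht
    simpa [hd] using this
  have hder : ∀ t ∈ Set.Icc (0 : ℝ) 1, HasDerivWithinAt
      (fun t : ℝ => f (x + t • d) - t • f' x d - (t ^ 2 / 2) • f'' x d d)
      ((f' (x + t • d)) d - f' x d - t • f'' x d d) (Set.Icc 0 1) t := by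
    intro t ht
    have h1 : HasDerivAt (fun t : ℝ => x + t • d) d t := by
      simpa using ((hasDerivAt_id t).smul_const d).const_add x
    have h2 := (hf _ (hmem t ht)).comp_hasDerivAt t h1
    have h3 : HasDerivAt (fun t : ℝ => t • f' x d) (f' x d) t := by
      simpa using (hasDerivAt_id t).smul_const (f' x d)
    have h4 : HasDerivAt (fun t : ℝ => (t ^ 2 / 2) • f'' x d d) (t • f'' x d d) t := by
      have : HasDerivAt (fun t : ℝ => t ^ 2 / 2) t t := by
        have := ((hasDerivAt_id t).pow 2).div_const 2
        simpa using this
      exact this.smul_const _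
    exact ((h2.sub h3).sub h4).hasDerivWithinAt
  have := norm_image_sub_le_of_norm_deriv_le_segment_01' hder (C := K * ‖d‖ ^ 3) (by
    intro t ht
    have ht' : t ∈ Set.Icc (0 : ℝ) 1 := ⟨ht.1, ht.2.le⟩
    have h5 := norm_first_order_remainder_le hs hf' hK0 hK hx (hmem t ht')
    have h6 : f' (x + t • d) d - f' x d - t • f'' x d d
        = (f' (x + t • d) - f' x - f'' x (x + t • d - x)) d := by
      simp
    rw [h6]
    refine (ContinuousLinearMap.le_opNorm _ _).trans ?_
    calc _ ≤ K * ‖x + t • d - x‖ ^ 2 * ‖d‖ := by gcongr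
      _ ≤ K * ‖d‖ ^ 2 * ‖d‖ := by
        gcongr
        rw [add_sub_cancel_left, norm_smul, Real.norm_of_nonneg ht.1]
        exact mul_le_of_le_one_left (norm_nonneg _) ht.2.le
      _ = _ := by ring)
  have e : f y = f (x + (1 : ℝ) • d) := by simp [hd]
  rw [e]
  convert this using 2
  simp
  abel

end Taylor

theorem eq_sum_smul_single (w : E2) : w = ∑ i, w i • EuclideanSpace.single i (1 : ℝ) := by
  ext j
  fin_cases j <;> simp

/-- Turns bounds on partial derivatives into bounds on operator norms of total derivatives. -/
theorem norm_le_sum_norm_apply_single {F : Type*} [NormedAddCommGroup F] [NormedSpace ℝ F]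
    (A : E2 →L[ℝ] F) : ‖A‖ ≤ ∑ i, ‖A (EuclideanSpace.single i 1)‖ := by
  refine A.opNorm_le_bound (Finset.sum_nonneg fun _ _ => norm_nonneg _) fun w => ?_
  calc ‖A w‖ = ‖∑ i, w i • A (EuclideanSpace.single i 1)‖ := by
        conv_lhs => rw [eq_sum_smul_single w]
        simp only [map_sum, map_smul]
    _ ≤ ∑ i, ‖w i • A (EuclideanSpace.single i 1)‖ := norm_sum_le _ _
    _ ≤ ∑ i, ‖A (EuclideanSpace.single i 1)‖ * ‖w‖ := by
        refine Finset.sum_le_sum fun i _ => ?_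
        rw [norm_smul, mul_comm]
        gcongr
        exact PiLp.norm_apply_le w i
    _ = _ := by rw [Finset.sum_mul]

/-! ### Coefficients of covariant derivatives -/

section TensorNorm

variable {ι κ : Type*} [Fintype ι] [Fintype κ] {m : ℕ}

/-- The `m`-th tensor power of `AᵀA` is the Gram matrix of the `m`-th tensor power of `A`, so its
quadratic form is a sum of squares. -/
theorem sum_sum_prod_gram_eq_sum_sq {A : Matrix κ ι ℝ} {G : Matrix ι ι ℝ}
    (hG : A.transpose * A = G) (T : (Fin m → ι) → ℝ) :
    ∑ I, ∑ J, (∏ s, G (I s) (J s)) * T I * T J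
      = ∑ K : Fin m → κ, (∑ I, (∏ s, A (K s) (I s)) * T I) ^ 2 := by
  classical
  have h : ∀ I J : Fin m → ι, ∏ s, G (I s) (J s)
      = ∑ K : Fin m → κ, (∏ s, A (K s) (I s)) * ∏ s, A (K s) (J s) := by
    intro I J
    simp_rw [← hG, Matrix.mul_apply, Matrix.transpose_apply, Finset.prod_univ_sum,
      Fintype.piFinset_univ, Finset.prod_mul_distrib]
  simp_rw [h, pow_two, Finset.sum_mul_sum, Finset.sum_mul]
  rw [Finset.sum_comm' (t' := Finset.univ) (s' := fun _ => Finset.univ) (by simp)]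
  rw [Finset.sum_comm' (t' := Finset.univ) (s' := fun _ => Finset.univ) (by simp)]
  refine Finset.sum_comm.trans ?_ |>.trans Finset.sum_comm
  rw [Finset.sum_comm]
  refine Finset.sum_congr rfl fun I _ => ?_
  rw [Finset.sum_comm]
  refine Finset.sum_congr rfl fun J _ => Finset.sum_congr rfl fun K _ => ?_
  ring

/-- Tensor powers are multiplicative, so the tensor power of `L` is a left inverse of that of `A`.
-/
theorem eq_sum_prod_mul_of_mul_eq_one [DecidableEq ι] {A : Matrix κ ι ℝ} {L : Matrix ι κ ℝ}
    (hL : L * A = 1)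
    (T : (Fin m → ι) → ℝ) (I : Fin m → ι) :
    T I = ∑ K : Fin m → κ, (∏ s, L (I s) (K s)) * ∑ J, (∏ s, A (K s) (J s)) * T J := by
  classical
  have h : ∀ J : Fin m → ι, ∑ K : Fin m → κ, (∏ s, L (I s) (K s)) * ∏ s, A (K s) (J s)
      = if I = J then 1 else 0 := by
    intro J
    have : ∏ s, (L * A) (I s) (J s) = ∑ K : Fin m → κ, (∏ s, L (I s) (K s)) *
        ∏ s, A (K s) (J s) := by
      simp_rw [Matrix.mul_apply, Finset.prod_univ_sum, Fintype.piFinset_univ,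
        Finset.prod_mul_distrib]
    rw [← this, hL]
    simp_rw [Matrix.one_apply]
    rw [Fintype.prod_ite_zero]
    simp [funext_iff]
  simp_rw [Finset.mul_sum, ← mul_assoc]
  rw [Finset.sum_comm]
  simp_rw [← Finset.sum_mul, h]
  simp

end TensorNorm

/-- With `J` the Jacobian matrix, `A = J g⁻¹` satisfies `AᵀA = g⁻¹` and `JᵀA = 1`. The tensor norm
is thus the Euclidean norm of the components of `T` transformed by `A`, and `Jᵀ`, with entries at
most `C`, recovers `T` from these `3 ^ m` components. No eigenvalue bound for `g` is needed. -/
theorem abs_le_of_tensorNorm_le {J : Matrix (Fin 3) (Fin 2) ℝ} {g : Matrix (Fin 2) (Fin 2) ℝ}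
    (hg : J.transpose * J = g) (hdet : IsUnit g.det) {C B : ℝ} (hJ : ∀ k i, |J k i| ≤ C)
    {m : ℕ} {T : (Fin m → Fin 2) → ℝ} (hT : tensorNorm g T ≤ B) (I : Fin m → Fin 2) :
    |T I| ≤ (3 * C) ^ m * B := by
  have hsymm : g.transpose = g := by rw [← hg]; simp
  have h1 : (J * g⁻¹).transpose * (J * g⁻¹) = g⁻¹ := by
    rw [Matrix.transpose_mul, Matrix.transpose_nonsing_inv, hsymm, Matrix.mul_assoc,
      ← Matrix.mul_assoc J.transpose, hg, Matrix.mul_nonsing_inv _ hdet, Matrix.mul_one]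
  have h2 : J.transpose * (J * g⁻¹) = 1 := by
    rw [← Matrix.mul_assoc, hg, Matrix.mul_nonsing_inv _ hdet]
  have hC : 0 ≤ C := (abs_nonneg _).trans (hJ 0 0)
  rw [eq_sum_prod_mul_of_mul_eq_one h2 T I]
  unfold tensorNorm at hT
  rw [sum_sum_prod_gram_eq_sum_sq h1] at hT
  refine (Finset.abs_sum_le_sum_abs _ _).trans ?_
  calc _ ≤ ∑ K : Fin m → Fin 3, C ^ m * B := by
        refine Finset.sum_le_sum fun K _ => ?_
        rw [abs_mul, Finset.abs_prod]
        refine mul_le_mul ?_ ?_ (abs_nonneg _) (by positivity)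
        · calc _ ≤ ∏ _s : Fin m, C := Finset.prod_le_prod (fun _ _ => abs_nonneg _)
                fun s _ => hJ (K s) (I s)
            _ = _ := by simp
        · refine le_trans ?_ hT
          rw [← Real.sqrt_sq_eq_abs]
          exact Real.sqrt_le_sqrt (Finset.single_le_sum
            (f := fun K : Fin m → Fin 3 => (∑ I, (∏ s, (J * g⁻¹) (K s) (I s)) * T I) ^ 2)
            (fun _ _ => sq_nonneg _) (Finset.mem_univ K))
    _ = _ := by simp [mul_pow, mul_assoc]

theorem contDiffOn_pd {F : Type*} [NormedAddCommGroup F] [NormedSpace ℝ F] {U : Set E2}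
    (hU : IsOpen U) {f : E2 → F} {m n : ℕ∞ω} (hf : ContDiffOn ℝ n f U) (hmn : m + 1 ≤ n)
    (i : Fin 2) : ContDiffOn ℝ m (pd i f) U :=
  (hf.fderiv_of_isOpen hU hmn).clm_apply contDiffOn_const

/-- The metric is the Gram matrix of the partial derivatives: a kernel vector would give a direction
whose image under the differential has length zero. -/
theorem metric_det_ne_zero {r : E2 → E3} {ζ : E2} (h : Function.Injective (fderiv ℝ r ζ)) :
    (metric r ζ).det ≠ 0 := by
  intro h0
  obtain ⟨v, hv, hv0⟩ := Matrix.exists_mulVec_eq_zero_iff.mpr h0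
  apply hv
  have h1 : fderiv ℝ r ζ (∑ i, v i • EuclideanSpace.single i (1 : ℝ)) = 0 := by
    rw [← inner_self_eq_zero (𝕜 := ℝ), map_sum]
    have h2 : ∀ i, ∑ j, metric r ζ i j * v j = 0 := fun i => congrFun hv0 i
    simp only [metric, Matrix.of_apply, pd] at h2
    simp_rw [sum_inner, inner_sum, map_smul, real_inner_smul_left, real_inner_smul_right,
      ← Finset.mul_sum]
    refine Finset.sum_eq_zero fun i _ => ?_
    rw [show ∑ j, v j * ⟪fderiv ℝ r ζ (EuclideanSpace.single i 1),
      fderiv ℝ r ζ (EuclideanSpace.single j 1)⟫_ℝ = 0 from ?_, mul_zero]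
    rw [← h2 i]
    exact Finset.sum_congr rfl fun j _ => mul_comm _ _
  have h3 := h (h1.trans (map_zero (fderiv ℝ r ζ)).symm)
  funext j
  have := congrArg (fun w : E2 => w j) h3
  fin_cases j <;> simpa using this

theorem contDiffOn_metric {M : Set E3} {U : Set E2} {r : E2 → E3} (hr : IsLocalParam M U r)
    (i j : Fin 2) : ContDiffOn ℝ 2 (fun ζ => metric r ζ i j) U := by
  have h : ∀ i, ContDiffOn ℝ 2 (pd i r) U := fun i =>
    contDiffOn_pd hr.isOpen hr.contDiffOn (by norm_num) i
  simpa only [metric, Matrix.of_apply] using (h i).inner ℝ (h j)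

theorem contDiffOn_metric_inv {M : Set E3} {U : Set E2} {r : E2 → E3} (hr : IsLocalParam M U r)
    (k l : Fin 2) : ContDiffOn ℝ 2 (fun ζ => (metric r ζ)⁻¹ k l) U := by
  have hm := contDiffOn_metric hr
  have hdet : ContDiffOn ℝ 2 (fun ζ => (metric r ζ).det⁻¹) U := by
    refine ContDiffOn.inv ?_ fun ζ hζ => metric_det_ne_zero (hr.immersion ζ hζ)
    simp only [Matrix.det_fin_two]
    exact ((hm 0 0).mul (hm 1 1)).sub ((hm 0 1).mul (hm 1 0))
  simp only [Matrix.inv_def, Ring.inverse_eq_inv', Matrix.smul_apply, smul_eq_mul,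
    Matrix.adjugate_fin_two]
  refine hdet.mul ?_
  fin_cases k <;> fin_cases l
  · simpa using hm 1 1
  · simpa using (hm 0 1).neg
  · simpa using (hm 1 0).neg
  · simpa using hm 0 0

theorem contDiffOn_christoffel {M : Set E3} {U : Set E2} {r : E2 → E3} (hr : IsLocalParam M U r)
    (k i j : Fin 2) : ContDiffOn ℝ 1 (christoffel r k i j) U := by
  have hp : ∀ l i j, ContDiffOn ℝ 1 (pd l fun ξ => metric r ξ i j) U := fun l i j =>
    contDiffOn_pd hr.isOpen (contDiffOn_metric hr i j) (by norm_num) l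
  unfold christoffel
  refine contDiffOn_const.mul (ContDiffOn.sum fun l _ => ?_)
  exact ((contDiffOn_metric_inv hr k l).of_le (by norm_num)).mul
    (((hp i j l).add (hp j i l)).sub (hp l i j))

/-- On a compact set inside the domain of a parametrization, bounds for the covariant derivatives
give bounds for the coordinate derivatives. -/
theorem exists_coordinate_bound {M : Set E3} {U : Set E2} {r : E2 → E3} (hr : IsLocalParam M U r)
    {K : Set E2} (hK : IsCompact K) (hKU : K ⊆ U) :
    ∃ C, 0 ≤ C ∧ ∀ (a : Fin 2 → E2 → ℝ) (b : Fin 2 → Fin 2 → E2 → ℝ)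
      (c : Fin 2 → Fin 2 → Fin 2 → E2 → ℝ) (B : ℝ), ∀ ζ ∈ K, 0 ≤ B →
        tensorNorm (metric r ζ) (fun I : Fin 1 → Fin 2 => a (I 0) ζ) ≤ B →
        tensorNorm (metric r ζ) (fun I : Fin 2 → Fin 2 => cov2 r a b (I 0) (I 1) ζ) ≤ B →
        tensorNorm (metric r ζ)
          (fun I : Fin 3 → Fin 2 => cov3 r a b c (I 0) (I 1) (I 2) ζ) ≤ B →
        (∀ i, |a i ζ| ≤ C * B) ∧ (∀ i j, |b i j ζ| ≤ C * B) ∧ ∀ i j k, |c i j k ζ| ≤ C * B := by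
  have hbdd : ∀ f : E2 → ℝ, ContinuousOn f U → ∃ C, 0 ≤ C ∧ ∀ ζ ∈ K, |f ζ| ≤ C := fun f hf => by
    obtain ⟨C, hC⟩ := hK.exists_bound_of_continuousOn (hf.mono hKU)
    exact ⟨max C 0, le_max_right _ _, fun ζ hζ => (hC ζ hζ).trans (le_max_left _ _)⟩
  have hJ : ∀ p : Fin 3 × Fin 2, ∃ C, 0 ≤ C ∧ ∀ ζ ∈ K, |pd p.2 r ζ p.1| ≤ C := fun p => by
    refine hbdd _ ?_
    have h := (contDiffOn_pd hr.isOpen hr.contDiffOn (m := 2) (by norm_num) p.2).continuousOn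
    exact (EuclideanSpace.proj p.1 : E3 →L[ℝ] ℝ).continuous.comp_continuousOn h
  have hΓ : ∀ p : Fin 2 × Fin 2 × Fin 2, ∃ C, 0 ≤ C ∧ ∀ ζ ∈ K,
      |christoffel r p.1 p.2.1 p.2.2 ζ| ≤ C := fun p =>
    hbdd _ (contDiffOn_christoffel hr _ _ _).continuousOn
  have hdΓ : ∀ p : Fin 2 × Fin 2 × Fin 2 × Fin 2, ∃ C, 0 ≤ C ∧ ∀ ζ ∈ K,
      |pd p.1 (christoffel r p.2.1 p.2.2.1 p.2.2.2) ζ| ≤ C := fun p =>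
    hbdd _ (contDiffOn_pd hr.isOpen (contDiffOn_christoffel hr _ _ _) (m := 0) (by norm_num)
      _).continuousOn
  choose CJ hCJ0 hCJ using hJ
  choose CG hCG0 hCG using hΓ
  choose CD hCD0 hCD using hdΓ
  -- A sum of nonnegative bounds dominates each of them and serves for all index combinations.
  set X := ∑ p, CJ p with hX
  set Y := ∑ p, CG p with hY
  set Z := ∑ p, CD p with hZ
  have hX0 : 0 ≤ X := Finset.sum_nonneg fun p _ => hCJ0 p
  have hY0 : 0 ≤ Y := Finset.sum_nonneg fun p _ => hCG0 p
  have hZ0 : 0 ≤ Z := Finset.sum_nonneg fun p _ => hCD0 p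
  have hleX : ∀ p, CJ p ≤ X := fun p =>
    Finset.single_le_sum (f := CJ) (fun p _ => hCJ0 p) (Finset.mem_univ p)
  have hleY : ∀ p, CG p ≤ Y := fun p =>
    Finset.single_le_sum (f := CG) (fun p _ => hCG0 p) (Finset.mem_univ p)
  have hleZ : ∀ p, CD p ≤ Z := fun p =>
    Finset.single_le_sum (f := CD) (fun p _ => hCD0 p) (Finset.mem_univ p)
  set c1 := (3 * X) ^ 1 with hc1
  set c2 := (3 * X) ^ 2 with hc2
  set c3 := (3 * X) ^ 3 with hc3
  have hc10 : 0 ≤ c1 := by positivity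
  have hc20 : 0 ≤ c2 := by positivity
  have hc30 : 0 ≤ c3 := by positivity
  -- The constants come from solving the definitions of `cov2` and `cov3` for the pure partial
  -- derivatives of highest order; each factor `2` counts the values of the summation index.
  set d2 := c2 + 2 * (Y * c1) with hd2
  have hd20 : 0 ≤ d2 := by positivity
  set d3 := c3 + 2 * (Z * c1 + Y * d2) + 2 * (Y * c2) + 2 * (Y * c2) with hd3
  have hd30 : 0 ≤ d3 := by positivity
  refine ⟨c1 + d2 + d3, by positivity, fun a b c B ζ hζ hB h1 h2 h3 => ?_⟩
  have hJJ : (Matrix.of fun (k : Fin 3) (i : Fin 2) => pd i r ζ k).transpose *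
      (Matrix.of fun (k : Fin 3) (i : Fin 2) => pd i r ζ k) = metric r ζ := by
    ext i j
    simp [Matrix.mul_apply, metric, PiLp.inner_apply, mul_comm]
  have hdet : IsUnit (metric r ζ).det :=
    isUnit_iff_ne_zero.mpr (metric_det_ne_zero (hr.immersion ζ (hKU hζ)))
  have hJC : ∀ k i, |(Matrix.of fun (k : Fin 3) (i : Fin 2) => pd i r ζ k) k i| ≤ X :=
    fun k i => (hCJ (k, i) ζ hζ).trans (hleX _)
  have hG : ∀ k i j, |christoffel r k i j ζ| ≤ Y := fun k i j =>
    (hCG (k, i, j) ζ hζ).trans (hleY _)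
  have hD : ∀ l k i j, |pd l (christoffel r k i j) ζ| ≤ Z := fun l k i j =>
    (hCD (l, k, i, j) ζ hζ).trans (hleZ _)
  have ha : ∀ i, |a i ζ| ≤ c1 * B := fun i =>
    abs_le_of_tensorNorm_le hJJ hdet hJC h1 (fun _ => i)
  have hb' : ∀ i j, |cov2 r a b i j ζ| ≤ c2 * B := fun i j => by
    simpa using abs_le_of_tensorNorm_le hJJ hdet hJC h2 ![i, j]
  have hc' : ∀ i j k, |cov3 r a b c i j k ζ| ≤ c3 * B := fun i j k => by
    simpa using abs_le_of_tensorNorm_le hJJ hdet hJC h3 ![i, j, k]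
  have hmul : ∀ x y p q : ℝ, |x| ≤ p → |y| ≤ q → |x * y| ≤ p * q := fun x y p q hx hy => by
    rw [abs_mul]
    exact mul_le_mul hx hy (abs_nonneg _) ((abs_nonneg _).trans hx)
  have hb : ∀ i j, |b i j ζ| ≤ d2 * B := fun i j => by
    have e : b i j ζ = cov2 r a b i j ζ + ∑ l, christoffel r l i j ζ * a l ζ := by
      simp [cov2]
    have := hmul _ _ _ _ (hG 0 i j) (ha 0)
    have := hmul _ _ _ _ (hG 1 i j) (ha 1)
    rw [e, Fin.sum_univ_two, hd2]
    have := hb' i j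
    rw [abs_le] at *
    constructor <;> linarith
  refine ⟨fun i => (ha i).trans ?_, fun i j => (hb i j).trans ?_, fun i j k => ?_⟩
  · gcongr; linarith
  · gcongr; linarith
  · have hc : |c i j k ζ| ≤ d3 * B := by
      have e : c i j k ζ = cov3 r a b c i j k ζ
          + ∑ l, (pd k (christoffel r l i j) ζ * a l ζ + christoffel r l i j ζ * b l k ζ)
          + ∑ l, christoffel r l k i ζ * cov2 r a b l j ζ
          + ∑ l, christoffel r l k j ζ * cov2 r a b i l ζ := by
        simp only [cov3]; ring
      have g1 := hmul _ _ _ _ (hD k 0 i j) (ha 0)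
      have g2 := hmul _ _ _ _ (hD k 1 i j) (ha 1)
      have g3 := hmul _ _ _ _ (hG 0 i j) (hb 0 k)
      have g4 := hmul _ _ _ _ (hG 1 i j) (hb 1 k)
      have g5 := hmul _ _ _ _ (hG 0 k i) (hb' 0 j)
      have g6 := hmul _ _ _ _ (hG 1 k i) (hb' 1 j)
      have g7 := hmul _ _ _ _ (hG 0 k j) (hb' i 0)
      have g8 := hmul _ _ _ _ (hG 1 k j) (hb' i 1)
      have g9 := hc' i j k
      rw [e, Fin.sum_univ_two, Fin.sum_univ_two, Fin.sum_univ_two, hd3]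
      clear_value d2 c1 c2 c3
      rw [abs_le] at *
      constructor <;> linarith
    refine hc.trans ?_
    gcongr; linarith

/-! ### Mollification -/

section Mollify

open scoped Convolution

/-- Convolution of the restriction of `f` to `K` with a normalized bump function. -/
noncomputable def mollify (η : ContDiffBump (0 : E2)) (K : Set E2) (f : E2 → ℝ) : E2 → ℝ :=
  K.indicator f ⋆[ContinuousLinearMap.lsmul ℝ ℝ, volume] η.normed volume

variable {η : ContDiffBump (0 : E2)} {K U : Set E2} {f f' : E2 → ℝ}

theorem mollify_apply (ζ : E2) :
    mollify η K f ζ = ∫ ξ, K.indicator f ξ * η.normed volume (ζ - ξ) := by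
  simp [mollify, convolution_def]

theorem locallyIntegrable_indicator (hK : IsCompact K) (hKU : K ⊆ U)
    (hf : LocallyIntegrableOn f U) : LocallyIntegrable (K.indicator f) :=
  ((integrable_indicator_iff hK.measurableSet).mpr
    (hf.integrableOn_compact_subset hKU hK)).locallyIntegrable

theorem contDiff_mollify (hf : LocallyIntegrable (K.indicator f)) :
    ContDiff ℝ ∞ (mollify η K f) :=
  η.hasCompactSupport_normed.contDiff_convolution_right _ hf η.contDiff_normed

/-- The derivative falls on the kernel. Its translate is a test function supported in `K`, so the
definition of the weak derivative moves it onto `f`, and the truncation to `K` is invisible. -/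
theorem pd_mollify (hK : IsCompact K) (hKU : K ⊆ U) {i : Fin 2} (hf : HasWeakPartial U i f f')
    {ζ : E2} (hζ : Metric.closedBall ζ η.rOut ⊆ K) :
    pd i (mollify η K f) ζ = mollify η K f' ζ := by
  set ρ : E2 → ℝ := η.normed volume with hρ
  set e : E2 := EuclideanSpace.single i 1 with he
  have hρs : ContDiff ℝ ∞ ρ := η.contDiff_normed
  have hLI := locallyIntegrable_indicator hK hKU hf.locallyIntegrable
  have h1 : pd i (mollify η K f) ζ = ∫ ξ, K.indicator f ξ * fderiv ℝ ρ (ζ - ξ) e := by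
    have := ((η.hasCompactSupport_normed (μ := volume)).hasFDerivAt_convolution_right
      (ContinuousLinearMap.lsmul ℝ ℝ) hLI (η.contDiff_normed (n := 1)) ζ).fderiv
    simp only [pd, mollify]
    rw [this, convolution_precompR_apply _ hLI (η.hasCompactSupport_normed.fderiv ℝ)
      ((η.contDiff_normed (n := 1)).continuous_fderiv one_ne_zero)]
    simp [convolution_def, hρ, he]
  set θ : E2 → ℝ := fun ξ => ρ (ζ - ξ) with hθ
  have hθs : ContDiff ℝ ∞ θ := hρs.comp (contDiff_const.sub contDiff_id)
  have hsupp : Function.support θ ⊆ Metric.closedBall ζ η.rOut := by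
    intro ξ hξ
    have : ζ - ξ ∈ Function.support ρ := hξ
    rw [hρ, η.support_normed_eq] at this
    rw [Metric.mem_closedBall, dist_comm, dist_eq_norm]
    exact (mem_ball_zero_iff.mp this).le
  have hts : tsupport θ ⊆ Metric.closedBall ζ η.rOut :=
    closure_minimal hsupp Metric.isClosed_closedBall
  have hcs : HasCompactSupport θ :=
    HasCompactSupport.of_support_subset_isCompact (isCompact_closedBall ζ η.rOut) hsupp
  have hpd : ∀ ξ, pd i θ ξ = -(fderiv ℝ ρ (ζ - ξ) e) := by
    intro ξ
    have h2 : HasFDerivAt (fun ξ : E2 => ζ - ξ) (-(ContinuousLinearMap.id ℝ E2)) ξ := by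
      simpa using (hasFDerivAt_id ξ).const_sub ζ
    have h3 := ((hρs.differentiable (by simp)) (ζ - ξ)).hasFDerivAt.comp ξ h2
    have h4 : fderiv ℝ θ ξ = _ := h3.fderiv
    simp [pd, h4, he]
  have hpd0 : ∀ ξ, ξ ∉ K → pd i θ ξ = 0 := fun ξ hξ => by
    have : fderiv ℝ θ ξ = 0 := by
      by_contra h
      exact hξ (hζ (hts (support_fderiv_subset ℝ h)))
    simp [pd, this]
  have hθ0 : ∀ ξ, ξ ∉ K → θ ξ = 0 := fun ξ hξ => by
    by_contra h
    exact hξ (hζ (hsupp h))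
  have h5 := hf.integral_eq θ hθs hcs (hts.trans (hζ.trans hKU))
  rw [h1, mollify_apply]
  have h6 : ∀ ξ, K.indicator f ξ * fderiv ℝ ρ (ζ - ξ) e = -(f ξ * pd i θ ξ) := fun ξ => by
    by_cases hξ : ξ ∈ K
    · simp [hξ, hpd]
    · rw [hpd0 ξ hξ]; simp [hξ]
  have h7 : ∀ ξ, K.indicator f' ξ * ρ (ζ - ξ) = f' ξ * θ ξ := fun ξ => by
    by_cases hξ : ξ ∈ K
    · simp [hξ, hθ]
    · rw [hθ0 ξ hξ]; simp [hξ]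
  refine (integral_congr_ae (ae_of_all _ h6)).trans ?_
  refine Eq.trans ?_ (integral_congr_ae (ae_of_all _ h7)).symm
  rw [integral_neg, h5, neg_neg]

/-- The normalized bump is nonnegative with integral one, so mollification is averaging. -/
theorem abs_mollify_le (hK : MeasurableSet K) {C : ℝ} (hC : 0 ≤ C)
    (hf : ∀ᵐ ξ ∂(volume.restrict K), |f ξ| ≤ C) (ζ : E2) : |mollify η K f ζ| ≤ C := by
  rw [mollify_apply]
  have hint : Integrable (fun ξ : E2 => C * η.normed volume (ζ - ξ)) :=
    ((η.integrable_normed (μ := volume)).comp_sub_left ζ).const_mul C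
  have := norm_integral_le_of_norm_le (f := fun ξ => K.indicator f ξ * η.normed volume (ζ - ξ))
    hint (by
      rw [ae_restrict_iff' hK] at hf
      filter_upwards [hf] with ξ hξ
      rw [norm_mul, Real.norm_of_nonneg (η.nonneg_normed _)]
      refine mul_le_mul_of_nonneg_right ?_ (η.nonneg_normed _)
      by_cases h : ξ ∈ K
      · simpa [h] using hξ h
      · simpa [h] using hC)
  rw [integral_const_mul, integral_sub_left_eq_self (fun ξ => η.normed volume ξ) volume ζ,
    η.integral_normed, mul_one] at this
  exact this

theorem tendsto_mollify {ι : Type*} {l : Filter ι} {η : ι → ContDiffBump (0 : E2)}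
    (hη : Filter.Tendsto (fun n => (η n).rOut) l (𝓝 0)) (hf : LocallyIntegrable (K.indicator f))
    {ζ : E2} (hK : K ∈ 𝓝 ζ) (hc : ContinuousAt f ζ) :
    Filter.Tendsto (fun n => mollify (η n) K f ζ) l (𝓝 (f ζ)) := by
  have hc' : ContinuousAt (K.indicator f) ζ :=
    hc.congr (by filter_upwards [hK] with ξ hξ using (Set.indicator_of_mem hξ f).symm)
  have h := ContDiffBump.convolution_tendsto_right (μ := (volume : Measure E2)) (φ := η)
    (g := fun _ => K.indicator f) (k := fun _ => ζ) (x₀ := ζ) (z₀ := K.indicator f ζ) hη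
    (Filter.Eventually.of_forall fun _ => hf.aestronglyMeasurable)
    (hc'.tendsto.comp Filter.tendsto_snd) tendsto_const_nhds
  rw [Set.indicator_of_mem (mem_of_mem_nhds hK)] at h
  refine h.congr fun n => ?_
  rw [convolution_lsmul_swap, mollify_apply]
  simp [mul_comm]

end Mollify

/-! ### Taylor expansion of functions with bounded weak derivatives of third order -/

theorem pd_eqOn {F : Type*} [NormedAddCommGroup F] [NormedSpace ℝ F] {V : Set E2} (hV : IsOpen V)
    {f g : E2 → F} (h : Set.EqOn f g V) (i : Fin 2) : Set.EqOn (pd i f) (pd i g) V := by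
  intro ζ hζ
  have : f =ᶠ[𝓝 ζ] g := by filter_upwards [hV.mem_nhds hζ] with ξ hξ using h hξ
  simp [pd, this.fderiv_eq]

theorem fderiv_apply_single {F : Type*} [NormedAddCommGroup F] [NormedSpace ℝ F]
    {G : E2 → E2 →L[ℝ] F} {ζ : E2} (hG : DifferentiableAt ℝ G ζ) (w : E2) (j : Fin 2) :
    fderiv ℝ G ζ (EuclideanSpace.single j 1) w = pd j (fun ξ => G ξ w) ζ := by
  have := (hG.hasFDerivAt.clm_apply (hasFDerivAt_const w ζ)).fderiv
  simp [pd, this]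

/-- By iterating `pd_mollify`, each partial derivative of the mollification is an average of the
corresponding weak derivative, hence at most `A`. The factors `2`, `4`, `8` count the partial
derivatives of each order. -/
theorem norm_fderiv_mollify_le {η : ContDiffBump (0 : E2)} {K U V : Set E2} (hK : IsCompact K)
    (hKU : K ⊆ U) (hV : IsOpen V) (hVK : ∀ ζ ∈ V, Metric.closedBall ζ η.rOut ⊆ K)
    {f : E2 → ℝ} {a : Fin 2 → E2 → ℝ} {b : Fin 2 → Fin 2 → E2 → ℝ}
    {c : Fin 2 → Fin 2 → Fin 2 → E2 → ℝ} (ha : ∀ i, HasWeakPartial U i f (a i))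
    (hb : ∀ i j, HasWeakPartial U j (a i) (b i j))
    (hc : ∀ i j k, HasWeakPartial U k (b i j) (c i j k)) {A : ℝ} (hA : 0 ≤ A)
    (hae : ∀ᵐ ξ ∂(volume.restrict K), (∀ i, |a i ξ| ≤ A) ∧ (∀ i j, |b i j ξ| ≤ A) ∧
      ∀ i j k, |c i j k ξ| ≤ A) {ζ : E2} (hζ : ζ ∈ V) :
    ‖fderiv ℝ (mollify η K f) ζ‖ ≤ 2 * A ∧
      ‖fderiv ℝ (fderiv ℝ (mollify η K f)) ζ‖ ≤ 4 * A ∧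
      ‖fderiv ℝ (fderiv ℝ (fderiv ℝ (mollify η K f))) ζ‖ ≤ 8 * A := by
  set g := mollify η K f with hg
  have hgs : ContDiff ℝ ∞ g :=
    contDiff_mollify (locallyIntegrable_indicator hK hKU (ha 0).locallyIntegrable)
  have hg1 : ContDiff ℝ ∞ (fderiv ℝ g) := hgs.fderiv_right (by simp)
  have hg2 : ContDiff ℝ ∞ (fderiv ℝ (fderiv ℝ g)) := hg1.fderiv_right (by simp)
  have e1 : ∀ i, Set.EqOn (pd i g) (mollify η K (a i)) V := fun i ξ hξ =>
    pd_mollify hK hKU (ha i) (hVK ξ hξ)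
  have e2 : ∀ i j, Set.EqOn (pd j (pd i g)) (mollify η K (b i j)) V := fun i j ξ hξ =>
    (pd_eqOn hV (e1 i) j hξ).trans (pd_mollify hK hKU (hb i j) (hVK ξ hξ))
  have e3 : ∀ i j k, Set.EqOn (pd k (pd j (pd i g))) (mollify η K (c i j k)) V :=
    fun i j k ξ hξ => (pd_eqOn hV (e2 i j) k hξ).trans (pd_mollify hK hKU (hc i j k) (hVK ξ hξ))
  have d2 : ∀ i j ξ, fderiv ℝ (fderiv ℝ g) ξ (EuclideanSpace.single j 1)
      (EuclideanSpace.single i 1) = pd j (pd i g) ξ := fun i j ξ =>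
    fderiv_apply_single (hg1.differentiable (by simp) ξ) _ j
  have d3 : ∀ i j k ξ, fderiv ℝ (fderiv ℝ (fderiv ℝ g)) ξ (EuclideanSpace.single k 1)
      (EuclideanSpace.single j 1) (EuclideanSpace.single i 1) = pd k (pd j (pd i g)) ξ := by
    intro i j k ξ
    rw [fderiv_apply_single (hg2.differentiable (by simp) ξ),
      show pd j (pd i g) = fun ξ => fderiv ℝ (fderiv ℝ g) ξ (EuclideanSpace.single j 1)
        (EuclideanSpace.single i 1) from funext fun ξ => (d2 i j ξ).symm,
      ← fderiv_apply_single
        (G := fun ξ => fderiv ℝ (fderiv ℝ g) ξ (EuclideanSpace.single j 1))]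
    · rfl
    · exact ((hg2.differentiable (by simp)) ξ).clm_apply (differentiableAt_const _)
  refine ⟨?_, ?_, ?_⟩
  · refine (norm_le_sum_norm_apply_single _).trans ?_
    have h : ∀ i, ‖fderiv ℝ g ζ (EuclideanSpace.single i 1)‖ ≤ A := fun i => by
      have := e1 i hζ
      rw [pd] at this
      rw [this]
      exact abs_mollify_le hK.measurableSet hA (hae.mono fun ξ hξ => hξ.1 i) ζ
    refine (Finset.sum_le_sum fun i _ => h i).trans (le_of_eq ?_)
    simp
  · have h : ∀ i j, ‖fderiv ℝ (fderiv ℝ g) ζ (EuclideanSpace.single j 1)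
        (EuclideanSpace.single i 1)‖ ≤ A := fun i j => by
      rw [d2, e2 i j hζ]
      exact abs_mollify_le hK.measurableSet hA (hae.mono fun ξ hξ => hξ.2.1 i j) ζ
    refine (norm_le_sum_norm_apply_single _).trans ?_
    refine (Finset.sum_le_sum fun j _ => (norm_le_sum_norm_apply_single _).trans
      (Finset.sum_le_sum fun i _ => h i j)).trans (le_of_eq ?_)
    simp; ring
  · have h : ∀ i j k, ‖fderiv ℝ (fderiv ℝ (fderiv ℝ g)) ζ (EuclideanSpace.single k 1)
        (EuclideanSpace.single j 1) (EuclideanSpace.single i 1)‖ ≤ A := fun i j k => by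
      rw [d3, e3 i j k hζ]
      exact abs_mollify_le hK.measurableSet hA (hae.mono fun ξ hξ => hξ.2.2 i j k) ζ
    refine (norm_le_sum_norm_apply_single _).trans ?_
    refine (Finset.sum_le_sum fun k _ => (norm_le_sum_norm_apply_single _).trans
      (Finset.sum_le_sum fun j _ => (norm_le_sum_norm_apply_single _).trans
      (Finset.sum_le_sum fun i _ => h i j k))).trans (le_of_eq ?_)
    simp; ring

/-- `f` has first and second derivatives `l`, `q` on `V`, with Taylor expansions controlled by
`A`. -/
structure HasTaylorBound {F : Type*} [NormedAddCommGroup F] [NormedSpace ℝ F] (V : Set E2)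
    (f : E2 → F) (l : E2 → E2 →L[ℝ] F) (q : E2 → E2 →L[ℝ] E2 →L[ℝ] F) (A : ℝ) : Prop where
  norm_le : ∀ ζ ∈ V, ‖f ζ‖ ≤ A
  norm_deriv_le : ∀ ζ ∈ V, ‖l ζ‖ ≤ A
  norm_deriv2_le : ∀ ζ ∈ V, ‖q ζ‖ ≤ A
  remainder_deriv_le : ∀ ζ ∈ V, ∀ ξ ∈ V, ‖l ξ - l ζ - q ζ (ξ - ζ)‖ ≤ A * ‖ξ - ζ‖ ^ 2
  remainder_le : ∀ ζ ∈ V, ∀ ξ ∈ V,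
    ‖f ξ - f ζ - l ζ (ξ - ζ) - (1 / 2 : ℝ) • q ζ (ξ - ζ) (ξ - ζ)‖ ≤ A * ‖ξ - ζ‖ ^ 3

/-- The bound on the third derivative makes the second derivative Lipschitz on the convex set `V`,
which is what the two remainder estimates require. -/
theorem hasTaylorBound_of_contDiff {F : Type*} [NormedAddCommGroup F] [NormedSpace ℝ F]
    {V : Set E2} (hV : IsOpen V) (hVc : Convex ℝ V) {f : E2 → F} {A : ℝ} (hA : 0 ≤ A)
    (hf : ContDiffOn ℝ 3 f V) (h0 : ∀ ζ ∈ V, ‖f ζ‖ ≤ A) (h1 : ∀ ζ ∈ V, ‖fderiv ℝ f ζ‖ ≤ A)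
    (h2 : ∀ ζ ∈ V, ‖fderiv ℝ (fderiv ℝ f) ζ‖ ≤ A)
    (h3 : ∀ ζ ∈ V, ‖fderiv ℝ (fderiv ℝ (fderiv ℝ f)) ζ‖ ≤ A) :
    HasTaylorBound V f (fderiv ℝ f) (fderiv ℝ (fderiv ℝ f)) A := by
  have hf1 : ContDiffOn ℝ 2 (fderiv ℝ f) V := hf.fderiv_of_isOpen hV (by norm_num)
  have hf2 : ContDiffOn ℝ 1 (fderiv ℝ (fderiv ℝ f)) V := hf1.fderiv_of_isOpen hV (by norm_num)
  have g0 : ∀ ζ ∈ V, HasFDerivAt f (fderiv ℝ f ζ) ζ := fun ζ hζ =>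
    ((hf.differentiableOn (by norm_num)).differentiableAt (hV.mem_nhds hζ)).hasFDerivAt
  have g1 : ∀ ζ ∈ V, HasFDerivAt (fderiv ℝ f) (fderiv ℝ (fderiv ℝ f) ζ) ζ := fun ζ hζ =>
    ((hf1.differentiableOn (by norm_num)).differentiableAt (hV.mem_nhds hζ)).hasFDerivAt
  have hL : ∀ x ∈ V, ∀ y ∈ V,
      ‖fderiv ℝ (fderiv ℝ f) y - fderiv ℝ (fderiv ℝ f) x‖ ≤ A * ‖y - x‖ := fun x hx y hy =>
    hVc.norm_image_sub_le_of_norm_fderiv_le (fun z hz =>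
      (hf2.differentiableOn (by norm_num)).differentiableAt (hV.mem_nhds hz)) h3 hx hy
  exact ⟨h0, h1, h2, fun ζ hζ ξ hξ => norm_first_order_remainder_le hVc g1 hA hL hζ hξ,
    fun ζ hζ ξ hξ => norm_second_order_remainder_le hVc g0 g1 hA hL hζ hξ⟩

/-- Closed balls in finite dimension are compact, so a bounded family converges along every
ultrafilter. This replaces the extraction of subsequences. -/
theorem exists_tendsto_of_norm_le {F : Type*} [NormedAddCommGroup F] [NormedSpace ℝ F]
    [FiniteDimensional ℝ F] {ι : Type*} (l : Ultrafilter ι) {x : ι → F} {A : ℝ}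
    (hx : ∀ n, ‖x n‖ ≤ A) : ∃ y, Filter.Tendsto x l (𝓝 y) := by
  have := FiniteDimensional.proper ℝ F
  obtain ⟨y, -, hy⟩ := (isCompact_closedBall (0 : F) A).ultrafilter_le_nhds (l.map x) (by
    refine Filter.le_principal_iff.mpr (Filter.mem_map.mpr (Filter.Eventually.of_forall ?_))
    simpa using hx)
  exact ⟨y, hy⟩

theorem tendsto_clm_apply {E F : Type*} [NormedAddCommGroup E] [NormedSpace ℝ E]
    [NormedAddCommGroup F] [NormedSpace ℝ F] {ι : Type*} {l : Filter ι} {x : ι → E →L[ℝ] F}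
    {y : E →L[ℝ] F} (w : E) (hx : Filter.Tendsto x l (𝓝 y)) :
    Filter.Tendsto (fun n => x n w) l (𝓝 (y w)) :=
  ((ContinuousLinearMap.apply ℝ F w).continuous.tendsto y).comp hx

/-- A pointwise limit of functions with uniform Taylor bounds has the same Taylor bounds. -/
theorem exists_hasTaylorBound_of_tendsto {F : Type*} [NormedAddCommGroup F] [NormedSpace ℝ F]
    [FiniteDimensional ℝ F] {V : Set E2} {f : E2 → F} {g : ℕ → E2 → F}
    {l : ℕ → E2 → E2 →L[ℝ] F} {q : ℕ → E2 → E2 →L[ℝ] E2 →L[ℝ] F} {A : ℝ}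
    (h : ∀ n, HasTaylorBound V (g n) (l n) (q n) A)
    (hg : ∀ ζ ∈ V, Filter.Tendsto (fun n => g n ζ) Filter.atTop (𝓝 (f ζ))) :
    ∃ l' q', HasTaylorBound V f l' q' A := by
  classical
  -- One ultrafilter finer than `atTop` yields limits of the derivatives at all points at once; the
  -- Taylor inequalities are closed conditions and pass to the limit.
  set μ := Filter.hyperfilter ℕ
  have hμ : (μ : Filter ℕ) ≤ Filter.atTop := Nat.hyperfilter_le_atTop
  have hl : ∀ ζ, ∃ y, ζ ∈ V → Filter.Tendsto (fun n => l n ζ) μ (𝓝 y) := fun ζ => by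
    by_cases hζ : ζ ∈ V
    · obtain ⟨y, hy⟩ := exists_tendsto_of_norm_le μ fun n => (h n).norm_deriv_le ζ hζ
      exact ⟨y, fun _ => hy⟩
    · exact ⟨0, fun h => absurd h hζ⟩
  have hq : ∀ ζ, ∃ y, ζ ∈ V → Filter.Tendsto (fun n => q n ζ) μ (𝓝 y) := fun ζ => by
    by_cases hζ : ζ ∈ V
    · obtain ⟨y, hy⟩ := exists_tendsto_of_norm_le μ fun n => (h n).norm_deriv2_le ζ hζ
      exact ⟨y, fun _ => hy⟩
    · exact ⟨0, fun h => absurd h hζ⟩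
  choose l' hl' using hl
  choose q' hq' using hq
  have hf : ∀ ζ ∈ V, Filter.Tendsto (fun n => g n ζ) μ (𝓝 (f ζ)) := fun ζ hζ =>
    (hg ζ hζ).mono_left hμ
  refine ⟨l', q', fun ζ hζ => ?_, fun ζ hζ => ?_, fun ζ hζ => ?_, fun ζ hζ ξ hξ => ?_,
    fun ζ hζ ξ hξ => ?_⟩
  · exact le_of_tendsto (hf ζ hζ).norm (Filter.Eventually.of_forall fun n => (h n).norm_le ζ hζ)
  · exact le_of_tendsto (hl' ζ hζ).norm
      (Filter.Eventually.of_forall fun n => (h n).norm_deriv_le ζ hζ)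
  · exact le_of_tendsto (hq' ζ hζ).norm
      (Filter.Eventually.of_forall fun n => (h n).norm_deriv2_le ζ hζ)
  · exact le_of_tendsto (((hl' ξ hξ).sub (hl' ζ hζ)).sub (tendsto_clm_apply _ (hq' ζ hζ))).norm
      (Filter.Eventually.of_forall fun n => (h n).remainder_deriv_le ζ hζ ξ hξ)
  · exact le_of_tendsto ((((hf ξ hξ).sub (hf ζ hζ)).sub (tendsto_clm_apply _ (hl' ζ hζ))).sub
      ((tendsto_clm_apply _ (tendsto_clm_apply _ (hq' ζ hζ))).const_smul _)).norm
      (Filter.Eventually.of_forall fun n => (h n).remainder_le ζ hζ ξ hξ)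

theorem IsLocalParam.mapsTo {M : Set E3} {U : Set E2} {r : E2 → E3} (hr : IsLocalParam M U r) :
    Set.MapsTo r U M := fun ζ hζ => by
  obtain ⟨V, -, hV⟩ := hr.isOpenMap U subset_rfl hr.isOpen
  have := Set.mem_image_of_mem r hζ
  rw [hV] at this
  exact this.1

/-- In a local parametrization, a function in `W^{3,∞}` has Taylor bounds of second order. -/
theorem exists_hasTaylorBound_of_sobolevBound {M : Set E3} {U : Set E2} {r : E2 → E3}
    (hr : IsLocalParam M U r) {ζ₀ : E2} {ρ : ℝ} (hρ : 0 < ρ)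
    (hU : Metric.closedBall ζ₀ (2 * ρ) ⊆ U) :
    ∃ C, 0 ≤ C ∧ ∀ (u : E3 → ℝ) (B : ℝ), ContinuousOn u M → 0 ≤ B → SobolevBound M u B →
      ∃ l q, HasTaylorBound (Metric.ball ζ₀ ρ) (u ∘ r) l q (C * B) := by
  set K := Metric.closedBall ζ₀ (2 * ρ) with hKdef
  have hK : IsCompact K := isCompact_closedBall _ _
  obtain ⟨C, hC, hcoord⟩ := exists_coordinate_bound hr hK hU
  -- `8 * C` covers the derivatives of orders one to three of the mollifications, and `1` their
  -- values.
  refine ⟨8 * C + 1, by positivity, fun u B hu hB hS => ?_⟩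
  obtain ⟨a, b, c, ha, hb, hc, hae⟩ := hS U r hr
  set f : E2 → ℝ := u ∘ r with hf
  have haeK := ae_restrict_of_ae_restrict_of_subset hU hae
  have hbd : ∀ᵐ ξ ∂(volume.restrict K), (∀ i, |a i ξ| ≤ C * B) ∧ (∀ i j, |b i j ξ| ≤ C * B) ∧
      ∀ i j k, |c i j k ξ| ≤ C * B := by
    filter_upwards [haeK, ae_restrict_mem hK.measurableSet] with ξ hξ hξK
    exact hcoord a b c B ξ hξK hB hξ.2.1 hξ.2.2.1 hξ.2.2.2
  have hf0 : ∀ᵐ ξ ∂(volume.restrict K), |f ξ| ≤ B := haeK.mono fun ξ hξ => hξ.1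
  have hCB : 0 ≤ C * B := mul_nonneg hC hB
  -- The radii tend to `0` and stay at most `ρ`, so balls of these radii around points of the ball
  -- of radius `ρ` remain in the closed ball of radius `2 * ρ`.
  let η : ℕ → ContDiffBump (0 : E2) := fun n =>
    { rIn := ρ / (n + 1) / 2
      rOut := ρ / (n + 1)
      rIn_pos := by positivity
      rIn_lt_rOut := by have : 0 < ρ / ((n : ℝ) + 1) := by positivity
                        linarith }
  have hη : ∀ n, (η n).rOut ≤ ρ := fun n =>
    div_le_self hρ.le (by have : (0 : ℝ) ≤ n := n.cast_nonneg
                          linarith)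
  have hηlim : Filter.Tendsto (fun n => (η n).rOut) Filter.atTop (𝓝 0) := by
    have := tendsto_one_div_add_atTop_nhds_zero_nat (𝕜 := ℝ) |>.const_mul ρ
    simpa [η, div_eq_mul_inv] using this
  have hball : ∀ n, ∀ ζ ∈ Metric.ball ζ₀ ρ, Metric.closedBall ζ (η n).rOut ⊆ K := by
    intro n ζ hζ
    refine Metric.closedBall_subset_closedBall' ?_
    have := hη n
    rw [Metric.mem_ball] at hζ
    linarith
  have hLI := locallyIntegrable_indicator hK hU (ha 0).locallyIntegrable
  refine exists_hasTaylorBound_of_tendsto (g := fun n => mollify (η n) K f)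
    (l := fun n => fderiv ℝ (mollify (η n) K f))
    (q := fun n => fderiv ℝ (fderiv ℝ (mollify (η n) K f))) (fun n => ?_) (fun ζ hζ => ?_)
  · have hn := fun ζ hζ => norm_fderiv_mollify_le (η := η n) hK hU Metric.isOpen_ball (hball n)
      ha hb hc hCB hbd (ζ := ζ) hζ
    refine hasTaylorBound_of_contDiff Metric.isOpen_ball (convex_ball _ _) (by positivity)
      ((contDiff_mollify hLI).of_le (by exact WithTop.coe_le_coe.mpr le_top)).contDiffOn (fun ζ hζ => ?_)
      (fun ζ hζ => (hn ζ hζ).1.trans ?_) (fun ζ hζ => (hn ζ hζ).2.1.trans ?_)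
      (fun ζ hζ => (hn ζ hζ).2.2.trans ?_)
    · refine (abs_mollify_le hK.measurableSet hB hf0 ζ).trans ?_
      linarith
    all_goals linarith
  · have hζU : ζ ∈ U := hU (Metric.ball_subset_closedBall (Metric.ball_subset_ball
      (by linarith) hζ))
    refine tendsto_mollify hηlim hLI ?_ ?_
    · exact Filter.mem_of_superset (Metric.isOpen_ball.mem_nhds hζ)
        ((Metric.ball_subset_ball (by linarith)).trans Metric.ball_subset_closedBall)
    · have hcont : ContinuousOn f U := hu.comp hr.contDiffOn.continuousOn hr.mapsTo
      exact hcont.continuousAt (hr.isOpen.mem_nhds hζU)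

/-! ### Surface gradients -/

theorem HasTaylorBound.norm_sub_sub_le {F : Type*} [NormedAddCommGroup F] [NormedSpace ℝ F]
    {V : Set E2} {f : E2 → F} {l : E2 → E2 →L[ℝ] F} {q : E2 → E2 →L[ℝ] E2 →L[ℝ] F} {A : ℝ}
    (h : HasTaylorBound V f l q A) {ζ ξ : E2} (hζ : ζ ∈ V) (hξ : ξ ∈ V) (hd : ‖ξ - ζ‖ ≤ 1) :
    ‖f ξ - f ζ - l ζ (ξ - ζ)‖ ≤ 2 * A * ‖ξ - ζ‖ ^ 2 := by
  have hA : 0 ≤ A := (norm_nonneg _).trans (h.norm_le ζ hζ)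
  have h1 := h.remainder_le ζ hζ ξ hξ
  have h2 : ‖(1 / 2 : ℝ) • q ζ (ξ - ζ) (ξ - ζ)‖ ≤ A * ‖ξ - ζ‖ ^ 2 := by
    rw [norm_smul]
    have : ‖q ζ (ξ - ζ) (ξ - ζ)‖ ≤ A * ‖ξ - ζ‖ * ‖ξ - ζ‖ :=
      (ContinuousLinearMap.le_opNorm₂ _ _ _).trans (by gcongr; exact h.norm_deriv2_le ζ hζ)
    have h3 : ‖(1 / 2 : ℝ)‖ ≤ 1 := by norm_num
    calc _ ≤ 1 * (A * ‖ξ - ζ‖ * ‖ξ - ζ‖) := by gcongr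
      _ = _ := by ring
  have h4 : ‖f ξ - f ζ - l ζ (ξ - ζ)‖ ≤ A * ‖ξ - ζ‖ ^ 3 + A * ‖ξ - ζ‖ ^ 2 := by
    calc _ = ‖(f ξ - f ζ - l ζ (ξ - ζ) - (1 / 2 : ℝ) • q ζ (ξ - ζ) (ξ - ζ))
          + (1 / 2 : ℝ) • q ζ (ξ - ζ) (ξ - ζ)‖ := by congr 1; abel
      _ ≤ _ := (norm_add_le _ _).trans (add_le_add h1 h2)
  have h5 : ‖ξ - ζ‖ ^ 3 ≤ ‖ξ - ζ‖ ^ 2 := pow_le_pow_of_le_one (norm_nonneg _) hd (by norm_num)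
  nlinarith

/-- Identifies `l`, which may stem from an ultrafilter limit, as the true derivative: the first
order remainder is quadratic. -/
theorem HasTaylorBound.hasFDerivAt {F : Type*} [NormedAddCommGroup F] [NormedSpace ℝ F]
    {V : Set E2} (hV : IsOpen V) {f : E2 → F} {l : E2 → E2 →L[ℝ] F}
    {q : E2 → E2 →L[ℝ] E2 →L[ℝ] F} {A : ℝ} (h : HasTaylorBound V f l q A) {ζ : E2}
    (hζ : ζ ∈ V) : HasFDerivAt f (l ζ) ζ := by
  rw [hasFDerivAt_iff_isLittleO]
  refine Asymptotics.IsBigO.trans_isLittleO ?_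
    (Asymptotics.isLittleO_pow_sub_sub ζ (m := 2) (by norm_num))
  refine Asymptotics.IsBigO.of_bound (2 * A) ?_
  filter_upwards [hV.mem_nhds hζ, Metric.ball_mem_nhds ζ one_pos] with ξ hξ hξ1
  rw [norm_pow, norm_norm]
  exact h.norm_sub_sub_le hζ hξ (by rw [← dist_eq_norm]; exact hξ1.le)

theorem IsLocalParam.hasStrictFDerivAt {M : Set E3} {U : Set E2} {r : E2 → E3}
    (hr : IsLocalParam M U r) {ζ : E2} (hζ : ζ ∈ U) :
    HasStrictFDerivAt r (fderiv ℝ r ζ) ζ :=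
  (hr.contDiffOn.contDiffAt (hr.isOpen.mem_nhds hζ)).hasStrictFDerivAt (by norm_num)

/-- A local parametrization has, near each point, a left inverse that is differentiable in the
ambient space. -/
theorem IsLocalParam.exists_local_inverse {M : Set E3} {U : Set E2} {r : E2 → E3}
    (hr : IsLocalParam M U r) {ζ : E2} (hζ : ζ ∈ U) :
    ∃ σ : E3 → E2, DifferentiableAt ℝ σ (r ζ) ∧ σ (r ζ) = ζ ∧
      ∀ᶠ y in 𝓝 (r ζ), y ∈ M → r (σ y) = y := by
  obtain ⟨L, hL⟩ := (fderiv ℝ r ζ).toLinearMap.exists_leftInverse_of_injective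
    (LinearMap.ker_eq_bot.mpr (hr.immersion ζ hζ))
  set L' : E3 →L[ℝ] E2 := LinearMap.toContinuousLinearMap L
  -- Composing `r` with a left inverse of its differential gives a map of the plane with derivative
  -- the identity, to which the inverse function theorem applies.
  have hd : HasStrictFDerivAt (fun ξ => L' (r ξ))
      ((ContinuousLinearEquiv.refl ℝ E2 : E2 ≃L[ℝ] E2) : E2 →L[ℝ] E2) ζ := by
    have e : ((ContinuousLinearEquiv.refl ℝ E2 : E2 ≃L[ℝ] E2) : E2 →L[ℝ] E2)
        = L'.comp (fderiv ℝ r ζ) := by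
      refine ContinuousLinearMap.ext fun w => ?_
      exact (LinearMap.congr_fun hL w).symm
    rw [e]
    exact L'.hasStrictFDerivAt.comp ζ (hr.hasStrictFDerivAt hζ)
  set ψ := hd.localInverse
  have hψ := hd.to_localInverse
  have hleft : ∀ᶠ ξ in 𝓝 ζ, ψ (L' (r ξ)) = ξ := hd.eventually_left_inverse
  obtain ⟨O, hOsub, hO, hζO⟩ := mem_nhds_iff.mp (Filter.inter_mem hleft (hr.isOpen.mem_nhds hζ))
  -- Openness onto the image excludes another sheet of `M` near `r ζ`: all nearby points of `M` have
  -- parameters in `O`.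
  obtain ⟨W, hW, hWO⟩ := hr.isOpenMap O (fun ξ hξ => (hOsub hξ).2) hO
  have hmem : r ζ ∈ M ∩ W := hWO ▸ Set.mem_image_of_mem r hζO
  refine ⟨fun y => ψ (L' y), ?_, (hOsub hζO).1, ?_⟩
  · exact hψ.hasFDerivAt.differentiableAt.comp (r ζ) L'.differentiableAt
  · filter_upwards [hW.mem_nhds hmem.2] with y hy hyM
    have : y ∈ r '' O := hWO ▸ ⟨hyM, hy⟩
    obtain ⟨ξ, hξ, rfl⟩ := this
    exact congrArg r (hOsub hξ).1

/-- Change of parametrization at a point of the surface. -/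
theorem IsLocalParam.exists_transition {M : Set E3} {U₁ U₂ : Set E2} {r₁ r₂ : E2 → E3}
    (h₁ : IsLocalParam M U₁ r₁) (h₂ : IsLocalParam M U₂ r₂) {ζ₁ ζ₂ : E2} (hζ₁ : ζ₁ ∈ U₁)
    (hζ₂ : ζ₂ ∈ U₂) (h : r₁ ζ₁ = r₂ ζ₂) :
    ∃ τ : E2 →L[ℝ] E2, fderiv ℝ r₁ ζ₁ = (fderiv ℝ r₂ ζ₂).comp τ ∧
      ∀ (u : E3 → ℝ) (l : E2 →L[ℝ] ℝ), HasFDerivAt (u ∘ r₂) l ζ₂ →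
        HasFDerivAt (u ∘ r₁) (l.comp τ) ζ₁ := by
  obtain ⟨σ, hσ, hσζ, hev⟩ := h₂.exists_local_inverse hζ₂
  rw [← h] at hσ hσζ hev
  have hr₁ := (h₁.hasStrictFDerivAt hζ₁).hasFDerivAt
  have hr₂ := (h₂.hasStrictFDerivAt hζ₂).hasFDerivAt
  have ht : HasFDerivAt (fun ξ => σ (r₁ ξ)) ((fderiv ℝ σ (r₁ ζ₁)).comp (fderiv ℝ r₁ ζ₁)) ζ₁ :=
    hσ.hasFDerivAt.comp ζ₁ hr₁
  have hloc : ∀ᶠ ξ in 𝓝 ζ₁, r₂ (σ (r₁ ξ)) = r₁ ξ := by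
    filter_upwards [hr₁.continuousAt.eventually hev, h₁.isOpen.mem_nhds hζ₁] with ξ hξ hξU
    exact hξ (h₁.mapsTo hξU)
  refine ⟨(fderiv ℝ σ (r₁ ζ₁)).comp (fderiv ℝ r₁ ζ₁), ?_, fun u l hl => ?_⟩
  · have h3 : HasFDerivAt (r₂ ∘ fun ξ => σ (r₁ ξ))
        ((fderiv ℝ r₂ ζ₂).comp ((fderiv ℝ σ (r₁ ζ₁)).comp (fderiv ℝ r₁ ζ₁))) ζ₁ := by
      refine HasFDerivAt.comp ζ₁ (g := r₂) (g' := fderiv ℝ r₂ ζ₂) ?_ ht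
      rw [hσζ]; exact hr₂
    exact (h3.congr_of_eventuallyEq
      (hloc.mono fun ξ hξ => hξ.symm)).fderiv
  · have h3 : HasFDerivAt ((u ∘ r₂) ∘ fun ξ => σ (r₁ ξ))
        (l.comp ((fderiv ℝ σ (r₁ ζ₁)).comp (fderiv ℝ r₁ ζ₁))) ζ₁ := by
      refine HasFDerivAt.comp ζ₁ (g := u ∘ r₂) (g' := l) ?_ ht
      rw [hσζ]; exact hl
    exact h3.congr_of_eventuallyEq (hloc.mono fun ξ hξ => (congrArg u hξ).symm)

/-- The frame dual to the coordinate frame. -/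
noncomputable def dualFrame (r : E2 → E3) (i : Fin 2) (ζ : E2) : E3 :=
  ∑ j, (metric r ζ)⁻¹ i j • pd j r ζ

theorem contDiffOn_dualFrame {M : Set E3} {U : Set E2} {r : E2 → E3} (hr : IsLocalParam M U r)
    (i : Fin 2) : ContDiffOn ℝ 2 (dualFrame r i) U :=
  ContDiffOn.sum fun j _ => (contDiffOn_metric_inv hr i j).smul
    (contDiffOn_pd hr.isOpen hr.contDiffOn (by norm_num) j)

theorem dualFrame_mem_range (r : E2 → E3) (i : Fin 2) (ζ : E2) :
    dualFrame r i ζ ∈ (fderiv ℝ r ζ).range :=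
  Submodule.sum_mem _ fun j _ => Submodule.smul_mem _ _ ⟨EuclideanSpace.single j 1, rfl⟩

theorem inner_dualFrame {r : E2 → E3} {ζ : E2} (h : Function.Injective (fderiv ℝ r ζ))
    (i k : Fin 2) : ⟪dualFrame r i ζ, pd k r ζ⟫_ℝ = if i = k then 1 else 0 := by
  have hdet : IsUnit (metric r ζ).det := isUnit_iff_ne_zero.mpr (metric_det_ne_zero h)
  have := congrFun (congrFun (Matrix.nonsing_inv_mul _ hdet) i) k
  rw [Matrix.mul_apply, Matrix.one_apply] at this
  rw [← this, dualFrame, sum_inner]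
  refine Finset.sum_congr rfl fun j _ => ?_
  rw [real_inner_smul_left]
  rfl

theorem inner_sum_smul_dualFrame {r : E2 → E3} {ζ : E2}
    (h : Function.Injective (fderiv ℝ r ζ)) (l : E2 →L[ℝ] ℝ) (w : E2) :
    ⟪∑ i, l (EuclideanSpace.single i 1) • dualFrame r i ζ, fderiv ℝ r ζ w⟫_ℝ = l w := by
  have hw : ∀ {F : Type} [NormedAddCommGroup F] [NormedSpace ℝ F] (A : E2 →L[ℝ] F),
      A w = ∑ k, w k • A (EuclideanSpace.single k 1) := fun A => by
    conv_lhs => rw [eq_sum_smul_single w]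
    simp only [map_sum, map_smul]
  have hd : ∀ i k, ⟪dualFrame r i ζ, fderiv ℝ r ζ (EuclideanSpace.single k 1)⟫_ℝ
      = if i = k then 1 else 0 := fun i k => inner_dualFrame h i k
  rw [hw (fderiv ℝ r ζ), hw l]
  simp only [Fin.sum_univ_two, inner_add_left, inner_add_right, real_inner_smul_left,
    real_inner_smul_right, hd]
  simp

theorem eq_of_mem_range_of_inner_eq {D : E2 →L[ℝ] E3} {v v' : E3} (hv : v ∈ D.range)
    (hv' : v' ∈ D.range) (h : ∀ w, ⟪v, D w⟫_ℝ = ⟪v', D w⟫_ℝ) : v = v' := by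
  obtain ⟨w, hw⟩ := Submodule.sub_mem _ hv hv'
  have h1 : ⟪v - v', D w⟫_ℝ = 0 := by rw [inner_sub_left, h, sub_self]
  rw [show D w = v - v' from hw, inner_self_eq_zero] at h1
  exact sub_eq_zero.mp h1

/-- A tangent vector is determined by its inner products with tangent vectors. The formula exhibits
the gradient as coordinate derivatives of `u` times `C²` fields, from which its first order
expansion follows. -/
theorem HasSurfaceGradientAt.eq_sum {M : Set E3} {U : Set E2} {r : E2 → E3}
    (hr : IsLocalParam M U r) {u : E3 → ℝ} {ζ : E2} (hζ : ζ ∈ U) {v : E3}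
    (hv : HasSurfaceGradientAt M u (r ζ) v) {l : E2 →L[ℝ] ℝ} (hl : HasFDerivAt (u ∘ r) l ζ) :
    v = ∑ i, l (EuclideanSpace.single i 1) • dualFrame r i ζ := by
  obtain ⟨-, h1, h2⟩ := hv U r hr ζ hζ rfl
  refine eq_of_mem_range_of_inner_eq h1
    (Submodule.sum_mem _ fun i _ => Submodule.smul_mem _ _ (dualFrame_mem_range r i ζ)) fun w => ?_
  rw [h2, inner_sum_smul_dualFrame (hr.immersion ζ hζ), hl.fderiv]

theorem exists_hasFDerivAt_of_sobolevBound {M : Set E3} {U : Set E2} {r : E2 → E3}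
    (hr : IsLocalParam M U r) {u : E3 → ℝ} (hu : ContinuousOn u M) {B : ℝ} (hB : 0 ≤ B)
    (hS : SobolevBound M u B) {ζ : E2} (hζ : ζ ∈ U) :
    ∃ l : E2 →L[ℝ] ℝ, HasFDerivAt (u ∘ r) l ζ := by
  obtain ⟨ε, hε, hεU⟩ := Metric.isOpen_iff.mp hr.isOpen ζ hζ
  obtain ⟨C, -, hC⟩ := exists_hasTaylorBound_of_sobolevBound hr (ζ₀ := ζ) (ρ := ε / 4)
    (by positivity) ((Metric.closedBall_subset_ball (by linarith)).trans hεU)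
  obtain ⟨l, q, h⟩ := hC u B hu hB hS
  exact ⟨l ζ, h.hasFDerivAt Metric.isOpen_ball (Metric.mem_ball_self (by positivity))⟩

/-- The gradient is built in one chart from the dual frame. Transition maps in both directions show
that it does not depend on the chart: one carries the derivatives over, the other shows that the
tangent spaces agree. -/
theorem exists_hasSurfaceGradientAt {M : Set E3} (hM : IsClosedSurface M) {u : E3 → ℝ}
    (hu : ContinuousOn u M) {B : ℝ} (hB : 0 ≤ B) (hS : SobolevBound M u B) {x : E3}
    (hx : x ∈ M) : ∃ v, HasSurfaceGradientAt M u x v := by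
  obtain ⟨U, r, hr, ζ, hζ, rfl⟩ := hM.exists_param x hx
  obtain ⟨l, hl⟩ := exists_hasFDerivAt_of_sobolevBound hr hu hB hS hζ
  refine ⟨∑ i, l (EuclideanSpace.single i 1) • dualFrame r i ζ, fun U' r' hr' ζ' hζ' h => ?_⟩
  obtain ⟨τ, hτ, hτu⟩ := hr'.exists_transition hr hζ' hζ h
  obtain ⟨τ', hτ', -⟩ := hr.exists_transition hr' hζ hζ' h.symm
  have hd := hτu u l hl
  refine ⟨hd.differentiableAt, ?_, fun w => ?_⟩
  · have h1 : ∑ i, l (EuclideanSpace.single i 1) • dualFrame r i ζ ∈ (fderiv ℝ r ζ).range :=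
      Submodule.sum_mem _ fun i _ => Submodule.smul_mem _ _ (dualFrame_mem_range r i ζ)
    obtain ⟨w, hw⟩ := h1
    refine ⟨τ' w, ?_⟩
    rw [← hw, hτ']
    rfl
  · rw [hd.fderiv, hτ]
    exact inner_sum_smul_dualFrame (hr.immersion ζ hζ) l (τ w)

/-! ### Uniform estimates in local parametrizations -/

theorem HasTaylorBound.mono {F : Type*} [NormedAddCommGroup F] [NormedSpace ℝ F]
    {V : Set E2} {f : E2 → F} {l : E2 → E2 →L[ℝ] F} {q : E2 → E2 →L[ℝ] E2 →L[ℝ] F} {A A' : ℝ}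
    (h : HasTaylorBound V f l q A) (hA : A ≤ A') : HasTaylorBound V f l q A' :=
  ⟨fun ζ hζ => (h.norm_le ζ hζ).trans hA, fun ζ hζ => (h.norm_deriv_le ζ hζ).trans hA,
    fun ζ hζ => (h.norm_deriv2_le ζ hζ).trans hA,
    fun ζ hζ ξ hξ => (h.remainder_deriv_le ζ hζ ξ hξ).trans (by gcongr),
    fun ζ hζ ξ hξ => (h.remainder_le ζ hζ ξ hξ).trans (by gcongr)⟩

/-- `G` has a first order expansion at the points of `V`, controlled by `A`. -/
def HasLinearBound {F : Type*} [NormedAddCommGroup F] [NormedSpace ℝ F] (V : Set E2) (G : E2 → F)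
    (A : ℝ) : Prop :=
  ∀ ζ ∈ V, ‖G ζ‖ ≤ A ∧ ∃ L : E2 →L[ℝ] F, ‖L‖ ≤ A ∧
    ∀ ξ ∈ V, ‖G ξ - G ζ - L (ξ - ζ)‖ ≤ A * ‖ξ - ζ‖ ^ 2

section LinearBound

variable {F : Type*} [NormedAddCommGroup F] [NormedSpace ℝ F] {V : Set E2}

theorem HasLinearBound.mono {G : E2 → F} {A A' : ℝ} (h : HasLinearBound V G A) (hA : A ≤ A') :
    HasLinearBound V G A' := fun ζ hζ => by
  obtain ⟨h0, L, hL, h1⟩ := h ζ hζ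
  exact ⟨h0.trans hA, L, hL.trans hA, fun ξ hξ => (h1 ξ hξ).trans (by gcongr)⟩

theorem HasLinearBound.add {G H : E2 → F} {A A' : ℝ} (hG : HasLinearBound V G A)
    (hH : HasLinearBound V H A') : HasLinearBound V (fun ζ => G ζ + H ζ) (A + A') := by
  intro ζ hζ
  obtain ⟨h0, L, hL, h1⟩ := hG ζ hζ
  obtain ⟨k0, N, hN, k1⟩ := hH ζ hζ
  refine ⟨(norm_add_le _ _).trans (add_le_add h0 k0), L + N,
    (norm_add_le _ _).trans (add_le_add hL hN), fun ξ hξ => ?_⟩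
  calc _ = ‖(G ξ - G ζ - L (ξ - ζ)) + (H ξ - H ζ - N (ξ - ζ))‖ := by
        congr 1; simp only [add_apply]; abel
    _ ≤ _ := (norm_add_le _ _).trans (add_le_add (h1 ξ hξ) (k1 ξ hξ))
    _ = _ := by ring

/-- The product rule with remainder. Increments of at most `2` turn the quadratic remainder of `g`
into a linear one, so `g` varies by at most `3 * A * ‖d‖`; the three error terms then add up to `1 +
3 + 1 = 5`. -/
theorem HasLinearBound.smul (hV : ∀ ζ ∈ V, ∀ ξ ∈ V, ‖ξ - ζ‖ ≤ 2) {g : E2 → ℝ} {G : E2 → F}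
    {A A' : ℝ} (hg : HasLinearBound V g A) (hG : HasLinearBound V G A') :
    HasLinearBound V (fun ζ => g ζ • G ζ) (5 * (A * A')) := by
  intro ζ hζ
  obtain ⟨h0, L, hL, h1⟩ := hg ζ hζ
  obtain ⟨k0, N, hN, k1⟩ := hG ζ hζ
  have hA : 0 ≤ A := (norm_nonneg _).trans h0
  have hA' : 0 ≤ A' := (norm_nonneg _).trans k0
  have hAA : 0 ≤ A * A' := mul_nonneg hA hA'
  refine ⟨?_, L.smulRight (G ζ) + g ζ • N, ?_, fun ξ hξ => ?_⟩
  · rw [norm_smul]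
    have : ‖g ζ‖ * ‖G ζ‖ ≤ A * A' := by gcongr
    linarith
  · refine (norm_add_le _ _).trans ?_
    rw [ContinuousLinearMap.norm_smulRight_apply, norm_smul]
    have h2 : ‖L‖ * ‖G ζ‖ ≤ A * A' := by gcongr
    have h3 : ‖g ζ‖ * ‖N‖ ≤ A * A' := by gcongr
    linarith
  · set d := ξ - ζ with hd
    have hd2 : ‖d‖ ≤ 2 := hV ζ hζ ξ hξ
    have hgd : ‖g ξ - g ζ‖ ≤ 3 * A * ‖d‖ := by
      have e : g ξ - g ζ = (g ξ - g ζ - L d) + L d := by ring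
      rw [e]
      refine (norm_add_le _ _).trans ?_
      have h4 : ‖L d‖ ≤ A * ‖d‖ := (L.le_opNorm d).trans (by gcongr)
      have h5 : A * ‖d‖ ^ 2 ≤ 2 * A * ‖d‖ := by
        have : A * ‖d‖ * ‖d‖ ≤ A * ‖d‖ * 2 := by gcongr
        nlinarith
      have := h1 ξ hξ
      linarith
    have e : g ξ • G ξ - g ζ • G ζ - (L.smulRight (G ζ) + g ζ • N) d
        = g ξ • (G ξ - G ζ - N d) + (g ξ - g ζ) • N d + (g ξ - g ζ - L d) • G ζ := by
      simp only [add_apply, ContinuousLinearMap.smulRight_apply,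
        smul_apply, smul_sub, sub_smul]
      abel
    rw [e]
    refine (norm_add₃_le).trans ?_
    rw [norm_smul, norm_smul, norm_smul]
    have g1 : ‖g ξ‖ * ‖G ξ - G ζ - N d‖ ≤ A * (A' * ‖d‖ ^ 2) := by
      gcongr
      · exact (hg ξ hξ).1
      · exact k1 ξ hξ
    have g2 : ‖g ξ - g ζ‖ * ‖N d‖ ≤ 3 * A * ‖d‖ * (A' * ‖d‖) := by
      gcongr
      exact (N.le_opNorm d).trans (by gcongr)
    have g3 : ‖g ξ - g ζ - L d‖ * ‖G ζ‖ ≤ A * ‖d‖ ^ 2 * A' := by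
      gcongr
      exact h1 ξ hξ
    calc _ ≤ A * (A' * ‖d‖ ^ 2) + 3 * A * ‖d‖ * (A' * ‖d‖) + A * ‖d‖ ^ 2 * A' :=
          add_le_add (add_le_add g1 g2) g3
      _ = _ := by ring

/-- The linear part of `ζ ↦ l ζ w` is the second derivative with `w` in its second slot. -/
theorem HasTaylorBound.hasLinearBound_apply {f : E2 → F} {l : E2 → E2 →L[ℝ] F}
    {q : E2 → E2 →L[ℝ] E2 →L[ℝ] F} {A : ℝ} (h : HasTaylorBound V f l q A) {w : E2}
    (hw : ‖w‖ ≤ 1) : HasLinearBound V (fun ζ => l ζ w) A := by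
  intro ζ hζ
  have hA : 0 ≤ A := (norm_nonneg _).trans (h.norm_le ζ hζ)
  have hle : ∀ {T : E2 →L[ℝ] F} {c : ℝ}, ‖T‖ ≤ c → ‖T w‖ ≤ c := fun {T c} hT =>
    ((T.le_opNorm w).trans (mul_le_of_le_one_right (norm_nonneg _) hw)).trans hT
  refine ⟨hle (h.norm_deriv_le ζ hζ), (q ζ).flip w, ?_, fun ξ hξ => ?_⟩
  · refine ContinuousLinearMap.opNorm_le_bound _ hA fun d => ?_
    exact hle (((q ζ).le_opNorm d).trans (by gcongr; exact h.norm_deriv2_le ζ hζ))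
  · exact hle (h.remainder_deriv_le ζ hζ ξ hξ)

theorem hasLinearBound_of_contDiff (hV : IsOpen V) (hVc : Convex ℝ V) {G : E2 → F} {A : ℝ}
    (hA : 0 ≤ A) (hG : ContDiffOn ℝ 2 G V) (h0 : ∀ ζ ∈ V, ‖G ζ‖ ≤ A)
    (h1 : ∀ ζ ∈ V, ‖fderiv ℝ G ζ‖ ≤ A) (h2 : ∀ ζ ∈ V, ‖fderiv ℝ (fderiv ℝ G) ζ‖ ≤ A) :
    HasLinearBound V G A := by
  have hG1 : ContDiffOn ℝ 1 (fderiv ℝ G) V := hG.fderiv_of_isOpen hV (by norm_num)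
  have g0 : ∀ ζ ∈ V, HasFDerivAt G (fderiv ℝ G ζ) ζ := fun ζ hζ =>
    ((hG.differentiableOn (by norm_num)).differentiableAt (hV.mem_nhds hζ)).hasFDerivAt
  have hL : ∀ x ∈ V, ∀ y ∈ V, ‖fderiv ℝ G y - fderiv ℝ G x‖ ≤ A * ‖y - x‖ := fun x hx y hy =>
    hVc.norm_image_sub_le_of_norm_fderiv_le (fun z hz =>
      (hG1.differentiableOn (by norm_num)).differentiableAt (hV.mem_nhds hz)) h2 hx hy
  exact fun ζ hζ => ⟨h0 ζ hζ, fderiv ℝ G ζ, h1 ζ hζ,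
    fun ξ hξ => norm_first_order_remainder_le hVc g0 hA hL hζ hξ⟩

end LinearBound

/-- Quantitative control, by the constant `C`, of the parametrization `r` on `V` and of functions
in `W^{3,∞}(M)` and their gradients there. -/
structure ChartBound (M : Set E3) (r : E2 → E3) (V : Set E2) (C : ℝ) : Prop where
  norm_le_deriv : ∀ ζ ∈ V, ∀ w, ‖w‖ ≤ C * ‖fderiv ℝ r ζ w‖
  norm_sub_le : ∀ ζ ∈ V, ∀ ξ ∈ V, ‖ξ - ζ‖ ≤ C * ‖r ξ - r ζ‖
  taylor : HasTaylorBound V r (fderiv ℝ r) (fderiv ℝ (fderiv ℝ r)) C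
  sobolev : ∀ (u : E3 → ℝ) (B : ℝ), ContinuousOn u M → 0 ≤ B → SobolevBound M u B →
    (∃ l q, HasTaylorBound V (u ∘ r) l q (C * B) ∧ ∀ ζ ∈ V, HasFDerivAt (u ∘ r) (l ζ) ζ) ∧
    ∀ gradu : E3 → E3, (∀ x ∈ M, HasSurfaceGradientAt M u x (gradu x)) →
      HasLinearBound V (gradu ∘ r) (C * B)

theorem ChartBound.mono {M : Set E3} {r : E2 → E3} {V : Set E2} {C C' : ℝ}
    (h : ChartBound M r V C) (hC : C ≤ C') : ChartBound M r V C' where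
  norm_le_deriv ζ hζ w := (h.norm_le_deriv ζ hζ w).trans (by gcongr)
  norm_sub_le ζ hζ ξ hξ := (h.norm_sub_le ζ hζ ξ hξ).trans (by gcongr)
  taylor := h.taylor.mono hC
  sobolev u B hu hB hS := by
    obtain ⟨⟨l, q, h1, h2⟩, h3⟩ := h.sobolev u B hu hB hS
    exact ⟨⟨l, q, h1.mono (by gcongr), h2⟩, fun G hG => (h3 G hG).mono (by gcongr)⟩

theorem exists_norm_le_mul_norm_apply {D : E2 →L[ℝ] E3} (hD : Function.Injective D) :
    ∃ c, 1 ≤ c ∧ ∀ w, ‖w‖ ≤ c * ‖D w‖ := by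
  obtain ⟨K, -, hK⟩ := D.toLinearMap.exists_antilipschitzWith (LinearMap.ker_eq_bot.mpr hD)
  refine ⟨max K 1, le_max_right _ _, fun w => ?_⟩
  have := hK.le_mul_dist w 0
  simp only [dist_zero_right, map_zero] at this
  exact this.trans (mul_le_mul_of_nonneg_right (le_max_left _ _) (norm_nonneg _))

theorem exists_chartBound {M : Set E3} {U : Set E2} {r : E2 → E3} (hr : IsLocalParam M U r)
    {ζ₀ : E2} (hζ₀ : ζ₀ ∈ U) :
    ∃ ρ > 0, Metric.ball ζ₀ ρ ⊆ U ∧ ∃ C, ChartBound M r (Metric.ball ζ₀ ρ) C := by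
  obtain ⟨ε, hε, hεU⟩ := Metric.isOpen_iff.mp hr.isOpen ζ₀ hζ₀
  set ρ₁ := min (ε / 4) 1 with hρ₁
  have hρ₁0 : 0 < ρ₁ := by positivity
  have hρ₁ε : ρ₁ ≤ ε / 4 := min_le_left _ _
  have hρ₁1 : ρ₁ ≤ 1 := min_le_right _ _
  set K := Metric.closedBall ζ₀ (2 * ρ₁) with hK
  have hKc : IsCompact K := isCompact_closedBall _ _
  have hKU : K ⊆ U := (Metric.closedBall_subset_ball (by linarith)).trans hεU
  have hr1 : ContDiffOn ℝ 2 (fderiv ℝ r) U := hr.contDiffOn.fderiv_of_isOpen hr.isOpen (by norm_num)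
  have hr2 : ContDiffOn ℝ 1 (fderiv ℝ (fderiv ℝ r)) U :=
    hr1.fderiv_of_isOpen hr.isOpen (by norm_num)
  have hr3 : ContDiffOn ℝ 0 (fderiv ℝ (fderiv ℝ (fderiv ℝ r))) U :=
    hr2.fderiv_of_isOpen hr.isOpen (by norm_num)
  have hN := contDiffOn_dualFrame hr
  have hN1 : ∀ i, ContDiffOn ℝ 1 (fderiv ℝ (dualFrame r i)) U := fun i =>
    (hN i).fderiv_of_isOpen hr.isOpen (by norm_num)
  have hN2 : ∀ i, ContDiffOn ℝ 0 (fderiv ℝ (fderiv ℝ (dualFrame r i))) U := fun i =>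
    (hN1 i).fderiv_of_isOpen hr.isOpen (by norm_num)
  obtain ⟨A0, hA0⟩ := hKc.exists_bound_of_continuousOn (hr.contDiffOn.continuousOn.mono hKU)
  obtain ⟨A1, hA1⟩ := hKc.exists_bound_of_continuousOn (hr1.continuousOn.mono hKU)
  obtain ⟨A2, hA2⟩ := hKc.exists_bound_of_continuousOn (hr2.continuousOn.mono hKU)
  obtain ⟨A3, hA3⟩ := hKc.exists_bound_of_continuousOn (hr3.continuousOn.mono hKU)
  have hNb : ∀ i, ∃ D, 0 ≤ D ∧ HasLinearBound (Metric.ball ζ₀ ρ₁) (dualFrame r i) D := by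
    intro i
    have hbK : Metric.ball ζ₀ ρ₁ ⊆ K :=
      (Metric.ball_subset_ball (by linarith)).trans Metric.ball_subset_closedBall
    obtain ⟨D0, hD0⟩ := hKc.exists_bound_of_continuousOn ((hN i).continuousOn.mono hKU)
    obtain ⟨D1, hD1⟩ := hKc.exists_bound_of_continuousOn ((hN1 i).continuousOn.mono hKU)
    obtain ⟨D2, hD2⟩ := hKc.exists_bound_of_continuousOn ((hN2 i).continuousOn.mono hKU)
    have h0 : 0 ≤ max D0 (max D1 D2) :=
      ((norm_nonneg _).trans (hD0 ζ₀ (hbK (Metric.mem_ball_self hρ₁0)))).trans (le_max_left _ _)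
    refine ⟨max D0 (max D1 D2), h0, hasLinearBound_of_contDiff Metric.isOpen_ball (convex_ball _ _)
      h0 ((hN i).mono (hbK.trans hKU)) (fun ζ hζ => (hD0 ζ (hbK hζ)).trans (le_max_left _ _))
      (fun ζ hζ => (hD1 ζ (hbK hζ)).trans ((le_max_left _ _).trans (le_max_right _ _)))
      (fun ζ hζ => (hD2 ζ (hbK hζ)).trans ((le_max_right _ _).trans (le_max_right _ _)))⟩
  choose D hD0 hD using hNb
  set A := max 1 (max (max A0 A1) (max A2 A3)) with hA
  have hA1' : 1 ≤ A := le_max_left _ _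
  have hle0 : A0 ≤ A := ((le_max_left _ _).trans (le_max_left _ _)).trans (le_max_right _ _)
  have hle1 : A1 ≤ A := ((le_max_right _ _).trans (le_max_left _ _)).trans (le_max_right _ _)
  have hle2 : A2 ≤ A := ((le_max_left _ _).trans (le_max_right _ _)).trans (le_max_right _ _)
  have hle3 : A3 ≤ A := ((le_max_right _ _).trans (le_max_right _ _)).trans (le_max_right _ _)
  clear_value A
  obtain ⟨c, hc1, hc⟩ := exists_norm_le_mul_norm_apply (hr.immersion ζ₀ hζ₀)
  have hcA : 0 < c * A := by positivity
  -- The differential varies by at most `A * ρ` from its value at the centre. With `c * A * ρ ≤ 1 /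
  -- 8`, its lower bound survives with `2 * c` in place of `c`, and `r` itself is bounded below with
  -- `4 * c`.
  set ρ := min ρ₁ (1 / (8 * (c * A))) with hρ
  have hρ0 : 0 < ρ := by positivity
  have hρle : ρ ≤ ρ₁ := min_le_left _ _
  have hρcA : c * A * ρ ≤ 1 / 8 := by
    have : ρ ≤ 1 / (8 * (c * A)) := min_le_right _ _
    rw [le_div_iff₀ (by positivity)] at this
    linarith
  clear_value ρ
  set V := Metric.ball ζ₀ ρ with hV
  have hV1 : V ⊆ Metric.ball ζ₀ ρ₁ := Metric.ball_subset_ball hρle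
  have hVK : V ⊆ K := hV1.trans
    ((Metric.ball_subset_ball (by linarith)).trans Metric.ball_subset_closedBall)
  have hVU : V ⊆ U := hVK.trans hKU
  have hVo : IsOpen V := Metric.isOpen_ball
  have hVc : Convex ℝ V := convex_ball _ _
  have hζ₀V : ζ₀ ∈ V := Metric.mem_ball_self hρ0
  have hdiam : ∀ ζ ∈ V, ∀ ξ ∈ V, ‖ξ - ζ‖ ≤ 2 * ρ := fun ζ hζ ξ hξ => by
    rw [← dist_eq_norm]
    have h1 := Metric.mem_ball.mp hζ
    have h2 := Metric.mem_ball.mp hξ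
    have := dist_triangle_right ξ ζ ζ₀
    linarith
  have hT : HasTaylorBound V r (fderiv ℝ r) (fderiv ℝ (fderiv ℝ r)) A :=
    hasTaylorBound_of_contDiff hVo hVc (by linarith) (hr.contDiffOn.mono hVU)
      (fun ζ hζ => (hA0 ζ (hVK hζ)).trans hle0) (fun ζ hζ => (hA1 ζ (hVK hζ)).trans hle1)
      (fun ζ hζ => (hA2 ζ (hVK hζ)).trans hle2) (fun ζ hζ => (hA3 ζ (hVK hζ)).trans hle3)
  have hLip : ∀ x ∈ V, ∀ y ∈ V, ‖fderiv ℝ r y - fderiv ℝ r x‖ ≤ A * ‖y - x‖ := fun x hx y hy =>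
    hVc.norm_image_sub_le_of_norm_fderiv_le (fun z hz =>
      (hr1.differentiableOn (by norm_num)).differentiableAt (hr.isOpen.mem_nhds (hVU hz)))
      hT.norm_deriv2_le hx hy
  have hlow : ∀ ζ ∈ V, ∀ w, ‖w‖ ≤ 2 * c * ‖fderiv ℝ r ζ w‖ := by
    intro ζ hζ w
    have h1 := hc w
    have h2 : ‖fderiv ℝ r ζ₀ w‖ ≤ ‖fderiv ℝ r ζ w‖ + A * ρ * ‖w‖ := by
      have e : fderiv ℝ r ζ₀ w = fderiv ℝ r ζ w - (fderiv ℝ r ζ - fderiv ℝ r ζ₀) w := by simp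
      rw [e]
      refine (norm_sub_le _ _).trans ?_
      gcongr
      refine (ContinuousLinearMap.le_opNorm _ _).trans ?_
      gcongr
      refine (hLip ζ₀ hζ₀V ζ hζ).trans ?_
      gcongr
      rw [← dist_eq_norm]
      exact (Metric.mem_ball.mp hζ).le
    have h3 : c * ‖fderiv ℝ r ζ₀ w‖ ≤ c * (‖fderiv ℝ r ζ w‖ + A * ρ * ‖w‖) := by gcongr
    have h4 : c * A * ρ * ‖w‖ ≤ 1 / 8 * ‖w‖ := by gcongr
    have h5 := norm_nonneg w
    nlinarith
  have hbi : ∀ ζ ∈ V, ∀ ξ ∈ V, ‖ξ - ζ‖ ≤ 4 * c * ‖r ξ - r ζ‖ := by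
    intro ζ hζ ξ hξ
    have h1 := hlow ζ hζ (ξ - ζ)
    have h2 := norm_first_order_remainder_le hVc (f := r) (f' := fderiv ℝ r) (fun x hx =>
      (hr.hasStrictFDerivAt (hVU hx)).hasFDerivAt) (by linarith) hLip hζ hξ
    have h3 : ‖fderiv ℝ r ζ (ξ - ζ)‖ ≤ ‖r ξ - r ζ‖ + A * ‖ξ - ζ‖ ^ 2 := by
      have e : fderiv ℝ r ζ (ξ - ζ) = (r ξ - r ζ) - (r ξ - r ζ - fderiv ℝ r ζ (ξ - ζ)) := by abel
      rw [e]
      exact (norm_sub_le _ _).trans (by gcongr)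
    have h4 : ‖ξ - ζ‖ ^ 2 ≤ 2 * ρ * ‖ξ - ζ‖ := by
      rw [pow_two]
      gcongr
      exact hdiam ζ hζ ξ hξ
    have h5 : 2 * c * ‖fderiv ℝ r ζ (ξ - ζ)‖
        ≤ 2 * c * (‖r ξ - r ζ‖ + A * (2 * ρ * ‖ξ - ζ‖)) := by
      gcongr
      exact h3.trans (by gcongr)
    have h6 : c * A * ρ * ‖ξ - ζ‖ ≤ 1 / 8 * ‖ξ - ζ‖ := by gcongr
    nlinarith
  obtain ⟨C', hC'0, hC'⟩ := exists_hasTaylorBound_of_sobolevBound hr (ζ₀ := ζ₀) (ρ := ρ) hρ0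
    ((Metric.closedBall_subset_closedBall (by linarith)).trans hKU)
  set E := C' + (5 * (C' * D 0) + 5 * (C' * D 1)) with hE
  have hE0 : 0 ≤ E := by
    have := hD0 0; have := hD0 1
    positivity
  have hEC : C' ≤ E := by
    have := mul_nonneg hC'0 (hD0 0); have := mul_nonneg hC'0 (hD0 1)
    linarith
  refine ⟨ρ, hρ0, hVU, max (4 * c) (max A E), ?_, ?_, ?_, ?_⟩
  · intro ζ hζ w
    refine (hlow ζ hζ w).trans ?_
    gcongr
    exact le_trans (by linarith) (le_max_left _ _)
  · intro ζ hζ ξ hξ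
    refine (hbi ζ hζ ξ hξ).trans ?_
    gcongr
    exact le_max_left _ _
  · exact hT.mono ((le_max_left _ _).trans (le_max_right _ _))
  · intro u B hu hB hS
    have hEm : E * B ≤ max (4 * c) (max A E) * B := by
      gcongr
      exact (le_max_right _ _).trans (le_max_right _ _)
    obtain ⟨l, q, hlq⟩ := hC' u B hu hB hS
    have hder : ∀ ζ ∈ V, HasFDerivAt (u ∘ r) (l ζ) ζ := fun ζ hζ => hlq.hasFDerivAt hVo hζ
    refine ⟨⟨l, q, hlq.mono (le_trans (by gcongr) hEm), hder⟩, fun gradu hgrad => ?_⟩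
    have hcomp : HasLinearBound V (fun ζ => l ζ (EuclideanSpace.single 0 1) • dualFrame r 0 ζ
        + l ζ (EuclideanSpace.single 1 1) • dualFrame r 1 ζ)
        (5 * (C' * B * D 0) + 5 * (C' * B * D 1)) := by
      have hd2 : ∀ ζ ∈ V, ∀ ξ ∈ V, ‖ξ - ζ‖ ≤ 2 := fun ζ hζ ξ hξ =>
        (hdiam ζ hζ ξ hξ).trans (by linarith)
      have hrestr : ∀ i, HasLinearBound V (dualFrame r i) (D i) := fun i ζ hζ => by
        obtain ⟨h0, L, hL, h1⟩ := hD i ζ (hV1 hζ)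
        exact ⟨h0, L, hL, fun ξ hξ => h1 ξ (hV1 hξ)⟩
      have hs : ∀ i, HasLinearBound V (fun ζ => l ζ (EuclideanSpace.single i 1)) (C' * B) :=
        fun i => hlq.hasLinearBound_apply (by simp)
      exact (HasLinearBound.smul hd2 (hs 0) (hrestr 0)).add
        (HasLinearBound.smul hd2 (hs 1) (hrestr 1))
    have heq : ∀ ζ ∈ V, (gradu ∘ r) ζ = l ζ (EuclideanSpace.single 0 1) • dualFrame r 0 ζ
        + l ζ (EuclideanSpace.single 1 1) • dualFrame r 1 ζ := fun ζ hζ => by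
      have := (hgrad (r ζ) (hr.mapsTo (hVU hζ))).eq_sum hr (hVU hζ) (hder ζ hζ)
      rw [Fin.sum_univ_two] at this
      exact this
    have hfin : HasLinearBound V (gradu ∘ r) (5 * (C' * B * D 0) + 5 * (C' * B * D 1)) := by
      intro ζ hζ
      obtain ⟨h0, L, hL, h1⟩ := hcomp ζ hζ
      refine ⟨by rw [heq ζ hζ]; exact h0, L, hL, fun ξ hξ => ?_⟩
      rw [heq ζ hζ, heq ξ hξ]
      exact h1 ξ hξ
    refine hfin.mono (le_trans ?_ hEm)
    have := mul_nonneg hC'0 hB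
    rw [hE]
    linarith

/-- On a closed surface there are local parametrizations of uniform size and with uniform bounds
around all points. -/
theorem exists_uniform_chartBound {M : Set E3} (hM : IsClosedSurface M) :
    ∃ δ > 0, ∃ C, 1 ≤ C ∧ ∀ x ∈ M, ∃ (U : Set E2) (r : E2 → E3) (V : Set E2),
      IsLocalParam M U r ∧ V ⊆ U ∧ ChartBound M r V C ∧ M ∩ Metric.ball x δ ⊆ r '' V := by
  -- The property passes to subsets and to finite unions (smaller radius, larger constant) and holds
  -- near each point; compactness makes it global.
  refine hM.isCompact.induction_on (p := fun s => ∃ δ > 0, ∃ C, 1 ≤ C ∧ ∀ x ∈ s,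
    ∃ (U : Set E2) (r : E2 → E3) (V : Set E2),
      IsLocalParam M U r ∧ V ⊆ U ∧ ChartBound M r V C ∧ M ∩ Metric.ball x δ ⊆ r '' V) ?_ ?_ ?_ ?_
  · exact ⟨1, one_pos, 1, le_rfl, fun x hx => hx.elim⟩
  · rintro s t hst ⟨δ, hδ, C, hC, h⟩
    exact ⟨δ, hδ, C, hC, fun x hx => h x (hst hx)⟩
  · rintro s t ⟨δ, hδ, C, hC, h⟩ ⟨δ', hδ', C', hC', h'⟩
    refine ⟨min δ δ', lt_min hδ hδ', max C C', hC.trans (le_max_left _ _), fun x hx => ?_⟩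
    rcases hx with hx | hx
    · obtain ⟨U, r, V, h1, h2, h3, h4⟩ := h x hx
      exact ⟨U, r, V, h1, h2, h3.mono (le_max_left _ _), (Set.inter_subset_inter_right M
        (Metric.ball_subset_ball (min_le_left _ _))).trans h4⟩
    · obtain ⟨U, r, V, h1, h2, h3, h4⟩ := h' x hx
      exact ⟨U, r, V, h1, h2, h3.mono (le_max_right _ _), (Set.inter_subset_inter_right M
        (Metric.ball_subset_ball (min_le_right _ _))).trans h4⟩
  · intro x hx
    obtain ⟨U, r, hr, ζ, hζ, rfl⟩ := hM.exists_param x hx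
    obtain ⟨ρ, hρ, hρU, C, hC⟩ := exists_chartBound hr hζ
    obtain ⟨W, hW, hWr⟩ := hr.isOpenMap (Metric.ball ζ ρ) hρU Metric.isOpen_ball
    have hmem : r ζ ∈ M ∩ W := hWr ▸ Set.mem_image_of_mem r (Metric.mem_ball_self hρ)
    obtain ⟨ε, hε, hεW⟩ := Metric.isOpen_iff.mp hW _ hmem.2
    -- Half the radius is kept so that the ball of radius `ε / 2` about any `y` in this
    -- neighbourhood stays in the ball of radius `ε` about `r ζ`.
    refine ⟨Metric.ball (r ζ) (ε / 2), mem_nhdsWithin_of_mem_nhds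
      (Metric.ball_mem_nhds _ (by positivity)), ε / 2, by positivity, max C 1, le_max_right _ _,
      fun y hy => ⟨U, r, Metric.ball ζ ρ, hr, hρU, hC.mono (le_max_left _ _), ?_⟩⟩
    rw [hWr]
    rintro z ⟨hzM, hz⟩
    refine ⟨hzM, hεW ?_⟩
    rw [Metric.mem_ball] at *
    have := dist_triangle z y (r ζ)
    linarith

/-! ### Meshes and interpolation -/

namespace TriMesh

variable (T : TriMesh)

theorem mem_nodes {x : E3} : x ∈ T.nodes ↔ ({x} : Finset E3) ∈ T.faces := by
  simp [nodes, Geometry.SimplicialComplex.vertices]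

theorem mem_nodes_of_mem_face {s : Finset E3} (hs : s ∈ T.faces) {v : E3} (hv : v ∈ s) :
    v ∈ T.nodes :=
  T.mem_nodes.mpr (T.toSimplicialComplex.down_closed hs (Finset.singleton_subset_iff.mpr hv)
    (Finset.singleton_nonempty v))

theorem diam_le_meshSize {s : Finset E3} (hs : s ∈ T.faces) (h3 : s.card = 3) :
    Metric.diam (convexHull ℝ (s : Set E3)) ≤ T.meshSize := by
  refine le_csSup ?_ ⟨s, ⟨hs, h3⟩, rfl⟩
  exact ((T.finite_faces.subset fun s hs => hs.1).image _).bddAbove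

theorem dist_le_meshSize {s : Finset E3} (hs : s ∈ T.faces) {x y : E3}
    (hx : x ∈ convexHull ℝ (s : Set E3)) (hy : y ∈ convexHull ℝ (s : Set E3)) :
    dist x y ≤ T.meshSize := by
  obtain ⟨t, ht, hst, h3⟩ := T.exists_triangle s hs
  have hsub := convexHull_mono (𝕜 := ℝ) (Finset.coe_subset.mpr hst)
  have hb : Bornology.IsBounded (convexHull ℝ (t : Set E3)) :=
    isBounded_convexHull.mpr t.finite_toSet.isBounded
  exact (Metric.dist_le_diam_of_mem hb (hsub hx) (hsub hy)).trans (T.diam_le_meshSize ht h3)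

theorem localSize_le_meshSize {x : E3} (hx : x ∈ T.nodes) : T.localSize x ≤ T.meshSize := by
  refine csSup_le ?_ ?_
  · exact ⟨_, x, ⟨{x}, T.mem_nodes.mp hx, by simp⟩, rfl⟩
  · rintro _ ⟨y, ⟨s, hs, hxs, hys⟩, rfl⟩
    exact T.dist_le_meshSize hs (subset_convexHull ℝ _ hxs) (subset_convexHull ℝ _ hys)

theorem localSize_pos {x : E3} (hx : x ∈ T.nodes) : 0 < T.localSize x := by
  obtain ⟨t, ht, hst, h3⟩ := T.exists_triangle _ (T.mem_nodes.mp hx)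
  obtain ⟨y, hy, hxy⟩ := Finset.exists_mem_ne (by omega : 1 < t.card) x
  refine (dist_pos.mpr hxy.symm).trans_le (le_csSup ⟨T.meshSize, ?_⟩
    ⟨y, ⟨t, ht, Finset.singleton_subset_iff.mp hst, hy⟩, rfl⟩)
  rintro _ ⟨z, ⟨s, hs, hxs, hzs⟩, rfl⟩
  exact T.dist_le_meshSize hs (subset_convexHull ℝ _ hxs) (subset_convexHull ℝ _ hzs)

variable {F : Type*} [NormedAddCommGroup F] [NormedSpace ℝ F]

/-- The value is a convex combination of nodal values on some face containing `x`. The estimates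
hold for every such representation, so uniqueness is needed only at nodes. -/
theorem interp_spec (V : E3 → F) {x : E3} (hx : x ∈ T.carrier) :
    ∃ s ∈ T.faces, ∃ w : E3 → ℝ, (∀ v ∈ s, 0 ≤ w v) ∧ ∑ v ∈ s, w v = 1 ∧
      ∑ v ∈ s, w v • v = x ∧ T.interp V x = ∑ v ∈ s, w v • V v := by
  refine Classical.epsilon_spec (p := fun y => ∃ s ∈ T.faces, ∃ w : E3 → ℝ,
    (∀ v ∈ s, 0 ≤ w v) ∧ ∑ v ∈ s, w v = 1 ∧ ∑ v ∈ s, w v • v = x ∧ y = ∑ v ∈ s, w v • V v) ?_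
  obtain ⟨s, hs, hxs⟩ := Geometry.SimplicialComplex.mem_space_iff.mp hx
  rw [Finset.mem_convexHull'] at hxs
  obtain ⟨w, h0, h1, h2⟩ := hxs
  exact ⟨_, s, hs, w, h0, h1, h2, rfl⟩

/-- Conformity forces a face whose hull contains the node `x` to have `x` as a vertex; affine
independence then puts all the weight on `x`. -/
theorem interp_node (V : E3 → F) {x : E3} (hx : x ∈ T.nodes) : T.interp V x = V x := by
  have hxf := T.mem_nodes.mp hx
  obtain ⟨s, hs, w, h0, h1, h2, h3⟩ := T.interp_spec V
    (T.toSimplicialComplex.subset_space hxf (by simp) : x ∈ T.carrier)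
  have hxs : x ∈ convexHull ℝ (s : Set E3) := Finset.mem_convexHull'.mpr ⟨w, h0, h1, h2⟩
  have hmem : x ∈ s := by
    have := T.inter_subset_convexHull hs hxf ⟨hxs, subset_convexHull ℝ _ (by simp)⟩
    by_contra hn
    have hempty : ((s : Set E3) ∩ ((({x} : Finset E3)) : Set E3)) = ∅ := by
      ext y; simp only [Finset.coe_singleton, Set.mem_inter_iff, Finset.mem_coe,
        Set.mem_singleton_iff, Set.mem_empty_iff_false, iff_false, not_and]
      rintro hy rfl
      exact hn hy
    rw [hempty, convexHull_empty] at this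
    exact this
  classical
  have hw : ∀ v ∈ s, w v = if v = x then 1 else 0 := by
    have hind := T.indep hs
    have hsum : ∑ v : s, (w v - if (v : E3) = x then 1 else 0) = 0 := by
      rw [Finset.sum_coe_sort s (fun v => w v - if v = x then 1 else 0), Finset.sum_sub_distrib, h1]
      simp [hmem]
    have hsum' : ∑ v : s, (w v - if (v : E3) = x then 1 else 0) • (v : E3) = 0 := by
      rw [Finset.sum_coe_sort s (fun v => (w v - if v = x then 1 else 0) • v)]
      simp [sub_smul, Finset.sum_sub_distrib, h2, hmem]
    have := (affineIndependent_iff (k := ℝ) (p := ((↑) : s → E3))).mp hind Finset.univ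
      (fun v => w v - if (v : E3) = x then 1 else 0) hsum hsum'
    intro v hv
    exact sub_eq_zero.mp (this ⟨v, hv⟩ (Finset.mem_univ _))
  rw [h3, Finset.sum_congr rfl (fun v hv => by rw [hw v hv])]
  simp [hmem]

theorem mem_nodes_of_mem_stencil {k : ℕ} {x z : E3} (hz : z ∈ T.stencil k x) : z ∈ T.nodes := by
  classical
  exact (Finset.mem_filter.mp hz).1

theorem dist_le_of_mem_stencil {k : ℕ} {x z : E3} (hz : z ∈ T.stencil k x) :
    dist z x ≤ k * T.localSize x := by
  classical
  exact (Finset.mem_filter.mp hz).2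

end TriMesh

/-! ### Finiteness of the area -/

/-- Locally the surface is a Lipschitz image of a disc, and it is compact. -/
theorem euclideanHausdorffMeasure_lt_top {M : Set E3} (hM : IsClosedSurface M) :
    (μHE[2] : Measure E3) M < ⊤ := by
  refine hM.isCompact.measure_lt_top_of_nhdsWithin fun x hx => ?_
  obtain ⟨U, r, hr, ζ, hζ, rfl⟩ := hM.exists_param x hx
  obtain ⟨K, s, hs, hLip⟩ :=
    ((hr.contDiffOn.contDiffAt (hr.isOpen.mem_nhds hζ)).of_le
      (by norm_num : (1 : ℕ∞ω) ≤ 3)).exists_lipschitzOnWith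
  obtain ⟨ε, hε, hεs⟩ := Metric.mem_nhds_iff.mp
    (Filter.inter_mem hs (hr.isOpen.mem_nhds hζ))
  obtain ⟨W, hW, hWr⟩ := hr.isOpenMap (Metric.ball ζ ε) (fun ξ hξ => (hεs hξ).2)
    Metric.isOpen_ball
  have hmem : r ζ ∈ M ∩ W := hWr ▸ Set.mem_image_of_mem r (Metric.mem_ball_self hε)
  refine ⟨M ∩ W, Filter.inter_mem self_mem_nhdsWithin
    (mem_nhdsWithin_of_mem_nhds (hW.mem_nhds hmem.2)), ?_⟩
  rw [← hWr]
  have h1 := (hLip.mono fun ξ hξ => (hεs hξ).1 :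
    LipschitzOnWith K r (Metric.ball ζ ε)).hausdorffMeasure_image_le (d := ((2 : ℕ) : ℝ))
      (by norm_num)
  have h2 : (μH[((2 : ℕ) : ℝ)] : Measure E2) (Metric.ball ζ ε) < ⊤ := measure_ball_lt_top
  rw [Measure.euclideanHausdorffMeasure_def, Measure.smul_apply, ENNReal.smul_def, smul_eq_mul]
  refine ENNReal.mul_lt_top ENNReal.coe_lt_top (h1.trans_lt (ENNReal.mul_lt_top ?_ h2))
  exact ENNReal.rpow_lt_top_of_nonneg (by norm_num) ENNReal.coe_ne_top

/-! ### Least squares fits -/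

theorem quad_add (a b : Fin 6 → ℝ) (y : E2) : quad (a + b) y = quad a y + quad b y := by
  simp only [quad, Pi.add_apply]; ring

theorem quad_sub (a b : Fin 6 → ℝ) (y : E2) : quad (a - b) y = quad a y - quad b y := by
  simp only [quad, Pi.sub_apply]; ring

theorem quad_smul (c : ℝ) (a : Fin 6 → ℝ) (y : E2) : quad (c • a) y = c * quad a y := by
  simp only [quad, Pi.smul_apply, smul_eq_mul]; ring

/-- After subtraction of the constant polynomial `a₀` the competitors form a linear space `W`, and a
minimizer is an orthogonal projection onto the finite-dimensional image of `W` under evaluation at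
the stencil. -/
theorem exists_isLeastSquares (pin : Bool) (φ : OrthonormalBasis (Fin 3) ℝ E3) (x : E3)
    (S : Finset E3) (f : E3 → ℝ) : ∃ a, IsLeastSquares pin φ x S f a := by
  let Φ : (Fin 6 → ℝ) →ₗ[ℝ] EuclideanSpace ℝ S :=
    { toFun := fun a => WithLp.toLp 2 fun z => quad a (planeCoord φ (z - x))
      map_add' := fun a b => by ext z; simp [quad_add]
      map_smul' := fun c a => by ext z; simp [quad_smul] }
  let W : Submodule ℝ (Fin 6 → ℝ) :=
    { carrier := {a | pin = true → a 0 = 0}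
      add_mem' := fun {a b} ha hb hp => by simp [ha hp, hb hp]
      zero_mem' := fun _ => rfl
      smul_mem' := fun c a ha hp => by simp [ha hp] }
  let a₀ : Fin 6 → ℝ := Pi.single 0 (f x)
  let t : EuclideanSpace ℝ S := WithLp.toLp 2 fun z => f z - quad a₀ (planeCoord φ (z - x))
  have hnorm : ∀ a, ∑ y ∈ S, (quad a (planeCoord φ (y - x)) - f y) ^ 2 = ‖t - Φ (a - a₀)‖ ^ 2 := by
    intro a
    rw [EuclideanSpace.norm_sq_eq, ← Finset.sum_coe_sort S]
    refine Finset.sum_congr rfl fun z _ => ?_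
    simp only [t, Φ, LinearMap.coe_mk, AddHom.coe_mk, PiLp.sub_apply, quad_sub, Real.norm_eq_abs,
      sq_abs]
    ring
  obtain ⟨v, hv, hmin⟩ := (W.map Φ).exists_norm_eq_iInf_of_complete_subspace
    (Submodule.complete_of_finiteDimensional _) t
  obtain ⟨w, hw, rfl⟩ := hv
  refine ⟨a₀ + w, fun hp => by simp [a₀, show w 0 = 0 from hw hp], fun b hb => ?_⟩
  rw [hnorm, hnorm, add_sub_cancel_left, hmin]
  have hbW : Φ (b - a₀) ∈ W.map Φ := ⟨b - a₀, fun hp => by simp [a₀, hb hp], rfl⟩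
  have hle : ⨅ w : W.map Φ, ‖t - w‖ ≤ ‖t - Φ (b - a₀)‖ :=
    ciInf_le ⟨0, by rintro _ ⟨w, rfl⟩; exact norm_nonneg _⟩ (⟨_, hbW⟩ : W.map Φ)
  have h0 : 0 ≤ ⨅ w : W.map Φ, ‖t - w‖ := Real.iInf_nonneg fun _ => norm_nonneg _
  exact pow_le_pow_left₀ h0 hle 2

theorem isLeastSquares_leastSquares (pin : Bool) (φ : OrthonormalBasis (Fin 3) ℝ E3) (x : E3)
    (S : Finset E3) (f : E3 → ℝ) : IsLeastSquares pin φ x S f (leastSquares pin φ x S f) :=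
  Classical.epsilon_spec (exists_isLeastSquares pin φ x S f)

/-- Under the rank condition, the linear coefficients of a least squares fit are close to those of
any competing polynomial that approximates the data. -/
theorem IsLeastSquares.abs_coeff_sub_le {pin : Bool} {φ : OrthonormalBasis (Fin 3) ℝ E3} {x : E3}
    {S : Finset E3} {f : E3 → ℝ} {a b : Fin 6 → ℝ} (ha : IsLeastSquares pin φ x S f a)
    (hb : pin = true → b 0 = f x) {κ h ε : ℝ} (hκ : 0 ≤ κ) (hh : 0 < h) (hε : 0 ≤ ε)
    (hfit : ∀ z ∈ S, |quad b (planeCoord φ (z - x)) - f z| ≤ ε)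
    (hrank : ∀ c : Fin 6 → ℝ, (pin = true → c 0 = 0) → ∀ y : E2, ‖y‖ ≤ h →
      |quad c y| ≤ κ * √((∑ z ∈ S, quad c (planeCoord φ (z - x)) ^ 2) / S.card)) :
    |a 1 - b 1| ≤ 2 * κ * ε / h ∧ |a 2 - b 2| ≤ 2 * κ * ε / h := by
  set c := a - b with hc
  have hsum : ∑ z ∈ S, quad c (planeCoord φ (z - x)) ^ 2 ≤ S.card * (2 * ε) ^ 2 := by
    have hb2 : ∑ z ∈ S, (quad b (planeCoord φ (z - x)) - f z) ^ 2 ≤ S.card * ε ^ 2 := by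
      rw [← nsmul_eq_mul, ← Finset.sum_const]
      exact Finset.sum_le_sum fun z hz => sq_le_sq.mpr (by rw [abs_of_nonneg hε]; exact hfit z hz)
    have ha2 := ha.2 b hb
    -- The difference of the polynomials is the difference of their residuals, so its square is at
    -- most twice the sum of the squared residuals; by minimality the residuals of `a` are no larger
    -- in total than those of `b`.
    have hle : ∑ z ∈ S, quad c (planeCoord φ (z - x)) ^ 2 ≤
        ∑ z ∈ S, (2 * (quad a (planeCoord φ (z - x)) - f z) ^ 2 +
          2 * (quad b (planeCoord φ (z - x)) - f z) ^ 2) := by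
      refine Finset.sum_le_sum fun z _ => ?_
      rw [hc, quad_sub]
      nlinarith [sq_nonneg ((quad a (planeCoord φ (z - x)) - f z) +
        (quad b (planeCoord φ (z - x)) - f z))]
    rw [Finset.sum_add_distrib, ← Finset.mul_sum, ← Finset.mul_sum] at hle
    linarith
  have hroot : √((∑ z ∈ S, quad c (planeCoord φ (z - x)) ^ 2) / S.card) ≤ 2 * ε := by
    refine Real.sqrt_le_iff.mpr ⟨by positivity, ?_⟩
    exact div_le_of_le_mul₀ (by positivity) (by positivity) (by linarith)
  have hbound : ∀ y : E2, ‖y‖ ≤ h → |quad c y| ≤ κ * (2 * ε) := fun y hy =>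
    (hrank c (fun hp => by simp [hc, ha.1 hp, hb hp]) y hy).trans (by gcongr)
  -- The difference of the values at `h` and `-h` on an axis cancels the even terms and isolates the
  -- linear coefficient.
  have key : ∀ i : Fin 2, ∀ m : ℝ,
      quad c (EuclideanSpace.single i h) - quad c (EuclideanSpace.single i (-h)) = 2 * h * m →
      |m| ≤ 2 * κ * ε / h := by
    intro i m hm
    have h1 := hbound (EuclideanSpace.single i h) (by simp [abs_of_pos hh])
    have h2 := hbound (EuclideanSpace.single i (-h)) (by simp [abs_of_pos hh])
    rw [le_div_iff₀ hh]
    have h3 : |2 * h * m| ≤ 2 * (κ * (2 * ε)) := by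
      rw [← hm]
      exact (abs_sub _ _).trans (by linarith)
    rw [abs_mul, abs_of_pos (by positivity : 0 < 2 * h)] at h3
    linarith
  constructor
  · exact key 0 (a 1 - b 1) (by simp [quad, hc]; ring)
  · exact key 1 (a 2 - b 2) (by simp [quad, hc]; ring)

/-! ### The recovered gradient at a node -/

/-- `v` is the vector tangent to the graph with slopes `s₁`, `s₂` whose inner products with the
coordinate vectors are `p₁`, `p₂`. -/
structure IsGraphGradient (v : Fin 3 → ℝ) (s₁ s₂ p₁ p₂ : ℝ) : Prop where
  tangent : v 2 = s₁ * v 0 + s₂ * v 1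
  inner₁ : v 0 + s₁ * v 2 = p₁
  inner₂ : v 1 + s₂ * v 2 = p₂

/-- The vector is a combination, with coefficients `α`, of the rows of `Jᵀ`, hence tangent to the
graph; its inner products with these rows are `α G`, and `α` solves `α G = (p₁, p₂)`. -/
theorem isGraphGradient_vecMul (s : Fin 6 → ℝ) (p₁ p₂ : ℝ) :
    IsGraphGradient (Matrix.vecMul ![p₁, p₂] ((jacT s * (jacT s).transpose)⁻¹ * jacT s))
      (s 1) (s 2) p₁ p₂ := by
  set G := jacT s * (jacT s).transpose with hG
  have hG' : G = !![1 + s 1 * s 1, s 1 * s 2; s 2 * s 1, 1 + s 2 * s 2] := by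
    ext i j
    rw [hG, Matrix.mul_apply, Fin.sum_univ_three]
    fin_cases i <;> fin_cases j <;> simp [jacT]
  have hdet : IsUnit G.det := by
    rw [isUnit_iff_ne_zero, hG', Matrix.det_fin_two_of]
    nlinarith [sq_nonneg (s 1), sq_nonneg (s 2)]
  set α := Matrix.vecMul ![p₁, p₂] G⁻¹ with hα
  have h1 : Matrix.vecMul α G = ![p₁, p₂] := by
    rw [hα, Matrix.vecMul_vecMul, Matrix.nonsing_inv_mul _ hdet, Matrix.vecMul_one]
  rw [← Matrix.vecMul_vecMul, ← hα]
  have e0 := congrFun h1 0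
  have e1 := congrFun h1 1
  rw [hG'] at e0 e1
  simp [Matrix.vecMul, dotProduct, Fin.sum_univ_two] at e0 e1
  refine ⟨?_, ?_, ?_⟩ <;> simp [jacT, Matrix.vecMul, dotProduct, Fin.sum_univ_two] <;> linarith

/-- The three conditions form a linear system with matrix the identity plus a skew matrix in `s₁`,
`s₂`, which never shortens vectors. The difference is therefore bounded by its residuals without any
bound on the slopes; only `w` has to be bounded. -/
theorem IsGraphGradient.abs_sub_le {v w : Fin 3 → ℝ} {s₁ s₂ p₁ p₂ t₁ t₂ q₁ q₂ P Q G : ℝ}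
    (hv : IsGraphGradient v s₁ s₂ p₁ p₂) (hw : IsGraphGradient w t₁ t₂ q₁ q₂)
    (hp₁ : |p₁ - q₁| ≤ P) (hp₂ : |p₂ - q₂| ≤ P) (hs₁ : |s₁ - t₁| ≤ Q) (hs₂ : |s₂ - t₂| ≤ Q)
    (hG : ∀ m, |w m| ≤ G) (m : Fin 3) : |v m - w m| ≤ 2 * P + 4 * (Q * G) := by
  have hQ : 0 ≤ Q := (abs_nonneg _).trans hs₁
  have hmul : ∀ {x y : ℝ}, |x| ≤ Q → |y| ≤ G → |x * y| ≤ Q * G := fun {x y} hx hy => by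
    rw [abs_mul]; gcongr
  set d0 := v 0 - w 0 with hd0
  set d1 := v 1 - w 1 with hd1
  set d2 := v 2 - w 2 with hd2
  set e0 := d0 + s₁ * d2 with he0
  set e1 := d1 + s₂ * d2 with he1
  set e2 := d2 - s₁ * d0 - s₂ * d1 with he2
  have hsq : d0 ^ 2 + d1 ^ 2 + d2 ^ 2 ≤ e0 ^ 2 + e1 ^ 2 + e2 ^ 2 := by
    rw [he0, he1, he2]
    nlinarith [sq_nonneg (s₁ * d2), sq_nonneg (s₂ * d2), sq_nonneg (s₁ * d0 + s₂ * d1)]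
  have E0 : e0 = (p₁ - q₁) - (s₁ - t₁) * w 2 := by
    rw [← hv.inner₁, ← hw.inner₁]; ring
  have E1 : e1 = (p₂ - q₂) - (s₂ - t₂) * w 2 := by
    rw [← hv.inner₂, ← hw.inner₂]; ring
  have E2 : e2 = (s₁ - t₁) * w 0 + (s₂ - t₂) * w 1 := by
    rw [he2, hd2, hv.tangent, hw.tangent]; ring
  have a0 : |e0| ≤ P + Q * G := by
    rw [E0]; exact (abs_sub _ _).trans (add_le_add hp₁ (hmul hs₁ (hG 2)))
  have a1 : |e1| ≤ P + Q * G := by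
    rw [E1]; exact (abs_sub _ _).trans (add_le_add hp₂ (hmul hs₂ (hG 2)))
  have a2 : |e2| ≤ Q * G + Q * G := by
    rw [E2]; exact (abs_add_le _ _).trans (add_le_add (hmul hs₁ (hG 0)) (hmul hs₂ (hG 1)))
  clear_value e0 e1 e2
  have hle : e0 ^ 2 + e1 ^ 2 + e2 ^ 2 ≤ (|e0| + |e1| + |e2|) ^ 2 := by
    have h01 := mul_nonneg (abs_nonneg e0) (abs_nonneg e1)
    have h02 := mul_nonneg (abs_nonneg e0) (abs_nonneg e2)
    have h12 := mul_nonneg (abs_nonneg e1) (abs_nonneg e2)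
    rw [← sq_abs e0, ← sq_abs e1, ← sq_abs e2]
    linarith
  have hd : (v m - w m) ^ 2 ≤ (|e0| + |e1| + |e2|) ^ 2 := by
    refine le_trans ?_ (hsq.trans hle)
    have := sq_nonneg d0
    have := sq_nonneg d1
    have := sq_nonneg d2
    fin_cases m
    · show d0 ^ 2 ≤ _
      linarith
    · show d1 ^ 2 ≤ _
      linarith
    · show d2 ^ 2 ≤ _
      linarith
  have := abs_le_of_sq_le_sq hd (by positivity)
  linarith

theorem norm_sum_smul_le (φ : OrthonormalBasis (Fin 3) ℝ E3) {c : Fin 3 → ℝ} {A : ℝ}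
    (hc : ∀ m, |c m| ≤ A) : ‖∑ m, c m • φ m‖ ≤ 3 * A := by
  refine (norm_sum_le _ _).trans ((Finset.sum_le_sum (g := fun _ => A) fun m _ => ?_).trans ?_)
  · rw [norm_smul, φ.norm_eq_one, mul_one]
    exact hc m
  · simp

/-! ### Taylor polynomials in plane coordinates -/

/-- The linear map underlying `planeCoord`. -/
noncomputable def planeCoordL (φ : OrthonormalBasis (Fin 3) ℝ E3) : E3 →L[ℝ] E2 :=
  LinearMap.toContinuousLinearMap
    { toFun := planeCoord φ
      map_add' := fun v w => by
        ext i; fin_cases i <;> simp [planeCoord, inner_add_right]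
      map_smul' := fun c v => by
        ext i; fin_cases i <;> simp [planeCoord, inner_smul_right] }

theorem norm_planeCoord_le (φ : OrthonormalBasis (Fin 3) ℝ E3) (w : E3) :
    ‖planeCoord φ w‖ ≤ ‖w‖ := by
  have h := φ.sum_sq_norm_inner_right w
  rw [Fin.sum_univ_three] at h
  refine le_of_sq_le_sq ?_ (norm_nonneg _)
  rw [EuclideanSpace.norm_sq_eq, Fin.sum_univ_two, ← h]
  simp [planeCoord]
  positivity

theorem exists_quad_eq (c : ℝ) (l : E2 →L[ℝ] ℝ) (β : E2 →L[ℝ] E2 →L[ℝ] ℝ) (L : E2 →L[ℝ] E2) :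
    ∃ b : Fin 6 → ℝ, b 0 = c ∧ b 1 = l (EuclideanSpace.single 0 1) ∧
      b 2 = l (EuclideanSpace.single 1 1) ∧ ∀ y, quad b y = c + l y + β (L y) (L y) := by
  set e0 : E2 := EuclideanSpace.single 0 1
  set e1 : E2 := EuclideanSpace.single 1 1
  refine ⟨![c, l e0, l e1, β (L e0) (L e0), β (L e0) (L e1) + β (L e1) (L e0), β (L e1) (L e1)],
    rfl, rfl, rfl, fun y => ?_⟩
  have hy : y = y 0 • e0 + y 1 • e1 := by
    conv_lhs => rw [eq_sum_smul_single y, Fin.sum_univ_two]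
  have hl : l y = y 0 * l e0 + y 1 * l e1 := by
    conv_lhs => rw [hy]
    simp
  have hL : L y = y 0 • L e0 + y 1 • L e1 := by
    conv_lhs => rw [hy]
    simp
  rw [hl, hL]
  simp only [quad, map_add, map_smul, add_apply, smul_apply, smul_eq_mul]
  simp only [Matrix.cons_val]
  ring

theorem abs_bilin_self_sub_le {F : Type*} [NormedAddCommGroup F] [NormedSpace ℝ F]
    (q : E2 →L[ℝ] E2 →L[ℝ] F) {A : ℝ} (hq : ‖q‖ ≤ A) (d e : E2) :
    ‖q e e - q d d‖ ≤ A * ‖e - d‖ * (‖e‖ + ‖d‖) := by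
  have h : q e e - q d d = q (e - d) e + q d (e - d) := by
    simp only [map_sub, sub_apply]; abel
  have h1 : ∀ a b, ‖q a b‖ ≤ A * ‖a‖ * ‖b‖ := fun a b =>
    (q.le_opNorm₂ a b).trans (by gcongr)
  rw [h]
  refine (norm_add_le _ _).trans ((add_le_add (h1 _ _) (h1 _ _)).trans (le_of_eq ?_))
  ring

/-- A function with a Taylor bound in a parametrization is, to third order, a quadratic polynomial
in plane coordinates. -/
theorem HasTaylorBound.exists_quad {V : Set E2} {r : E2 → E3} {C : ℝ}
    (hr : HasTaylorBound V r (fderiv ℝ r) (fderiv ℝ (fderiv ℝ r)) C)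
    {f : E2 → ℝ} {l : E2 → E2 →L[ℝ] ℝ} {q : E2 → E2 →L[ℝ] E2 →L[ℝ] ℝ} {A : ℝ}
    (hf : HasTaylorBound V f l q A) (φ : OrthonormalBasis (Fin 3) ℝ E3) {ζ : E2} (hζ : ζ ∈ V)
    {L : E2 →L[ℝ] E2} {k : ℝ} (hL : ‖L‖ ≤ k)
    (hinv : ∀ w, L (planeCoord φ (fderiv ℝ r ζ w)) = w) :
    ∃ b : Fin 6 → ℝ, b 0 = f ζ ∧ b 1 = l ζ (L (EuclideanSpace.single 0 1)) ∧
      b 2 = l ζ (L (EuclideanSpace.single 1 1)) ∧ ∀ ξ ∈ V, ‖ξ - ζ‖ ≤ 1 →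
        |quad b (planeCoord φ (r ξ - r ζ)) - f ξ| ≤ 4 * (1 + k * C) ^ 3 * A * ‖ξ - ζ‖ ^ 3 := by
  have hC : 0 ≤ C := (norm_nonneg _).trans (hr.norm_le ζ hζ)
  have hA : 0 ≤ A := (norm_nonneg _).trans (hf.norm_le ζ hζ)
  have hk : 0 ≤ k := (norm_nonneg _).trans hL
  set R := fderiv ℝ (fderiv ℝ r) ζ with hR
  set S : E3 →L[ℝ] E2 := L.comp (planeCoordL φ) with hS
  have hSn : ∀ w, ‖S w‖ ≤ k * ‖w‖ := fun w =>
    (L.le_opNorm _).trans (mul_le_mul hL (norm_planeCoord_le φ w) (norm_nonneg _) hk)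
  -- Half the Hessian of `f` in plane coordinates, pulled back by `L`: the second term corrects for
  -- the curvature of the change from chart to plane coordinates.
  set β : E2 →L[ℝ] E2 →L[ℝ] ℝ := (1 / 2 : ℝ) •
    (q ζ - (ContinuousLinearMap.compL ℝ E2 E3 ℝ ((l ζ).comp S)).comp R) with hβ
  obtain ⟨b, hb0, hb1, hb2, hb⟩ := exists_quad_eq (f ζ) ((l ζ).comp L) β L
  refine ⟨b, hb0, hb1, hb2, fun ξ hξ hξ1 => ?_⟩
  set d := ξ - ζ with hd
  set e := L (planeCoord φ (r ξ - r ζ)) with he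
  set m := k * C with hm
  have hm0 : 0 ≤ m := mul_nonneg hk hC
  set ρ := r ξ - r ζ - fderiv ℝ r ζ d - (1 / 2 : ℝ) • R d d with hρ
  have hρn : ‖ρ‖ ≤ C * ‖d‖ ^ 3 := hr.remainder_le ζ hζ ξ hξ
  have hSd : S (fderiv ℝ r ζ d) = d := hinv d
  have hed : e = d + (1 / 2 : ℝ) • S (R d d) + S ρ := by
    have : e = S (r ξ - r ζ) := rfl
    rw [this, hρ, map_sub S (r ξ - r ζ - fderiv ℝ r ζ d), map_sub S (r ξ - r ζ), map_smul, hSd]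
    abel
  have hRd : ‖R d d‖ ≤ C * ‖d‖ ^ 2 := by
    refine (R.le_opNorm₂ d d).trans ?_
    rw [pow_two, ← mul_assoc]
    gcongr
    exact hr.norm_deriv2_le ζ hζ
  have hd3 : ‖d‖ ^ 3 ≤ ‖d‖ ^ 2 := pow_le_pow_of_le_one (norm_nonneg _) hξ1 (by norm_num)
  have hSρ : ‖S ρ‖ ≤ m * ‖d‖ ^ 3 := by
    refine (hSn ρ).trans ?_
    rw [hm, mul_assoc]
    gcongr
  have hhalf : ‖(1 / 2 : ℝ)‖ = 1 / 2 := by norm_num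
  have hed1 : ‖e - d‖ ≤ 2 * m * ‖d‖ ^ 2 := by
    have : e - d = (1 / 2 : ℝ) • S (R d d) + S ρ := by rw [hed]; abel
    rw [this]
    refine (norm_add_le _ _).trans ?_
    rw [norm_smul, hhalf]
    have h1 : ‖S (R d d)‖ ≤ m * ‖d‖ ^ 2 := by
      refine (hSn _).trans ?_
      rw [hm, mul_assoc]
      gcongr
    have h2 : m * ‖d‖ ^ 3 ≤ m * ‖d‖ ^ 2 := by gcongr
    have h3 : 0 ≤ m * ‖d‖ ^ 2 := by positivity
    linarith
  have hen : ‖e‖ + ‖d‖ ≤ (2 + 2 * m) * ‖d‖ := by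
    have h1 : ‖e‖ ≤ ‖e - d‖ + ‖d‖ := by
      calc ‖e‖ = ‖(e - d) + d‖ := by congr 1; abel
        _ ≤ _ := norm_add_le _ _
    have h2 : 2 * m * ‖d‖ ^ 2 ≤ 2 * m * ‖d‖ := by
      gcongr
      rw [pow_two]
      exact mul_le_of_le_one_left (norm_nonneg _) hξ1
    linarith
  have hbil : ∀ {F : Type} [NormedAddCommGroup F] [NormedSpace ℝ F] (p : E2 →L[ℝ] E2 →L[ℝ] F)
      (D : ℝ), ‖p‖ ≤ D → ‖p e e - p d d‖ ≤ D * (4 * m * (1 + m)) * ‖d‖ ^ 3 := by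
    intro F _ _ p D hp
    have hD : 0 ≤ D := (norm_nonneg _).trans hp
    refine (abs_bilin_self_sub_le p hp d e).trans ?_
    calc D * ‖e - d‖ * (‖e‖ + ‖d‖) ≤ D * (2 * m * ‖d‖ ^ 2) * ((2 + 2 * m) * ‖d‖) := by gcongr
      _ = _ := by ring
  -- Second order terms cancel by the choice of `β`. What remains is the Taylor remainders and the
  -- exchange of `d` for `e` in quadratic terms, which is of third order because `e - d` is of
  -- second.
  have hquad : quad b (planeCoord φ (r ξ - r ζ)) - f ξ
      = -(f ξ - f ζ - l ζ d - (1 / 2 : ℝ) • q ζ d d) + (1 / 2) * (q ζ e e - q ζ d d)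
        + l ζ (S ρ - (1 / 2 : ℝ) • S (R e e - R d d)) := by
    rw [hb]
    have h1 : ((l ζ).comp L) (planeCoord φ (r ξ - r ζ)) = l ζ e := rfl
    have h2 : β e e = 1 / 2 * (q ζ e e - l ζ (S (R e e))) := rfl
    have h3 : l ζ e = l ζ d + 1 / 2 * l ζ (S (R d d)) + l ζ (S ρ) := by
      conv_lhs => rw [hed]
      simp
    rw [h1, h2, h3]
    simp only [map_sub, map_smul, smul_eq_mul]
    ring
  have t1 : |f ξ - f ζ - l ζ d - (1 / 2 : ℝ) • q ζ d d| ≤ A * ‖d‖ ^ 3 :=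
    hf.remainder_le ζ hζ ξ hξ
  have t2 : |q ζ e e - q ζ d d| ≤ A * (4 * m * (1 + m)) * ‖d‖ ^ 3 :=
    hbil (q ζ) A (hf.norm_deriv2_le ζ hζ)
  have t3 : |l ζ (S ρ - (1 / 2 : ℝ) • S (R e e - R d d))|
      ≤ A * (m * ‖d‖ ^ 3 + 1 / 2 * (m * (4 * m * (1 + m)) * ‖d‖ ^ 3)) := by
    refine ((l ζ).le_opNorm _).trans ?_
    refine mul_le_mul (hf.norm_deriv_le ζ hζ) ?_ (norm_nonneg _) hA
    refine (norm_sub_le _ _).trans (add_le_add hSρ ?_)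
    rw [norm_smul, hhalf]
    gcongr
    refine (hSn _).trans ?_
    calc k * ‖R e e - R d d‖ ≤ k * (C * (4 * m * (1 + m)) * ‖d‖ ^ 3) := by
          gcongr
          exact hbil R C (hr.norm_deriv2_le ζ hζ)
      _ = _ := by rw [hm]; ring
  rw [hquad]
  have hAd : 0 ≤ A * ‖d‖ ^ 3 := by positivity
  have hfin : A * ‖d‖ ^ 3 + 1 / 2 * (A * (4 * m * (1 + m)) * ‖d‖ ^ 3)
      + A * (m * ‖d‖ ^ 3 + 1 / 2 * (m * (4 * m * (1 + m)) * ‖d‖ ^ 3))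
      ≤ 4 * (1 + m) ^ 3 * A * ‖d‖ ^ 3 := by
    have hpoly : 1 + 1 / 2 * (4 * m * (1 + m)) + (m + 1 / 2 * (m * (4 * m * (1 + m))))
        ≤ 4 * (1 + m) ^ 3 := by
      have := pow_nonneg hm0 2
      have := pow_nonneg hm0 3
      nlinarith
    calc _ = (1 + 1 / 2 * (4 * m * (1 + m)) + (m + 1 / 2 * (m * (4 * m * (1 + m)))))
          * (A * ‖d‖ ^ 3) := by ring
      _ ≤ 4 * (1 + m) ^ 3 * (A * ‖d‖ ^ 3) := by gcongr
      _ = _ := by ring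
  refine le_trans ?_ hfin
  refine (abs_add_le _ _).trans (add_le_add ((abs_add_le _ _).trans (add_le_add ?_ ?_)) t3)
  · rw [abs_neg]; exact t1
  · rw [abs_mul, abs_of_pos (by norm_num : (0 : ℝ) < 1 / 2)]
    gcongr

/-- Serves to expand the height of the surface over the parameter plane, a linear functional of norm
one composed with `r`. -/
theorem HasTaylorBound.clm_comp {F G : Type*} [NormedAddCommGroup F] [NormedSpace ℝ F]
    [NormedAddCommGroup G] [NormedSpace ℝ G] {V : Set E2} {f : E2 → F} {l : E2 → E2 →L[ℝ] F}
    {q : E2 → E2 →L[ℝ] E2 →L[ℝ] F} {A : ℝ} (h : HasTaylorBound V f l q A) {S : F →L[ℝ] G}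
    (hS : ‖S‖ ≤ 1) : HasTaylorBound V (fun ζ => S (f ζ)) (fun ζ => S.comp (l ζ))
      (fun ζ => (ContinuousLinearMap.compL ℝ E2 F G S).comp (q ζ)) A := by
  have hle : ∀ v, ‖S v‖ ≤ ‖v‖ := fun v =>
    (S.le_opNorm v).trans (mul_le_of_le_one_left (norm_nonneg _) hS)
  have hcomp : ∀ T : E2 →L[ℝ] F, ‖S.comp T‖ ≤ ‖T‖ := fun T =>
    (S.opNorm_comp_le T).trans (mul_le_of_le_one_left (norm_nonneg _) hS)
  refine ⟨fun ζ hζ => (hle _).trans (h.norm_le ζ hζ),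
    fun ζ hζ => (hcomp _).trans (h.norm_deriv_le ζ hζ), fun ζ hζ => ?_, fun ζ hζ ξ hξ => ?_,
    fun ζ hζ ξ hξ => ?_⟩
  · refine le_trans ?_ (h.norm_deriv2_le ζ hζ)
    refine ContinuousLinearMap.opNorm_le_bound _ (norm_nonneg _) fun w => ?_
    exact (hcomp (q ζ w)).trans ((q ζ).le_opNorm w)
  · refine le_trans ?_ (h.remainder_deriv_le ζ hζ ξ hξ)
    refine le_trans (le_of_eq ?_) (hcomp _)
    congr 1
    ext w
    simp
  · refine le_trans ?_ (h.remainder_le ζ hζ ξ hξ)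
    refine le_trans (le_of_eq ?_) (hle _)
    congr 1
    simp

/-! ### Error of the recovered gradient at the nodes -/

/-- The projected differential is bounded below, hence an injective endomorphism of the plane, hence
invertible. `D ∘ L` is the differential of the graph parametrization. -/
theorem exists_graph_inverse {D : E2 →L[ℝ] E3} {φ : OrthonormalBasis (Fin 3) ℝ E3} {C κ : ℝ}
    (hC : 0 ≤ C) (h1 : ∀ w, ‖w‖ ≤ C * ‖D w‖) (h2 : ∀ w, ‖D w‖ ≤ κ * ‖planeCoord φ (D w)‖) :
    ∃ L : E2 →L[ℝ] E2, ‖L‖ ≤ C * κ ∧ (∀ w, L (planeCoord φ (D w)) = w) ∧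
      ∀ y, planeCoord φ (D (L y)) = y := by
  have hbound : ∀ w, ‖w‖ ≤ C * κ * ‖planeCoord φ (D w)‖ := fun w => by
    calc ‖w‖ ≤ C * ‖D w‖ := h1 w
      _ ≤ C * (κ * ‖planeCoord φ (D w)‖) := by gcongr; exact h2 w
      _ = _ := by ring
  set A : E2 →ₗ[ℝ] E2 := ((planeCoordL φ).comp D).toLinearMap with hA
  have hAapp : ∀ w, A w = planeCoord φ (D w) := fun w => rfl
  have hinj : Function.Injective A := by
    rw [← LinearMap.ker_eq_bot, LinearMap.ker_eq_bot']
    intro w hw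
    have := hbound w
    rw [← hAapp, hw, norm_zero, mul_zero] at this
    exact norm_le_zero_iff.mp this
  set e := LinearEquiv.ofInjectiveEndo A hinj
  have he : ∀ w, e w = planeCoord φ (D w) := fun w => rfl
  have hright : ∀ y, planeCoord φ (D (e.symm y)) = y := fun y => by
    rw [← he, e.apply_symm_apply]
  have hCκ : 0 ≤ C * κ := by
    have h3 := hbound (EuclideanSpace.single 0 1)
    have h4 : (0 : ℝ) < ‖(EuclideanSpace.single 0 1 : E2)‖ := by simp
    by_contra hneg
    have := mul_nonpos_of_nonpos_of_nonneg (not_le.mp hneg).le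
      (norm_nonneg (planeCoord φ (D (EuclideanSpace.single 0 1))))
    linarith
  refine ⟨LinearMap.toContinuousLinearMap e.symm.toLinearMap, ?_, fun w => ?_, hright⟩
  · refine ContinuousLinearMap.opNorm_le_bound _ hCκ fun y => ?_
    have := hbound (e.symm y)
    rw [hright] at this
    exact this
  · rw [← he]
    exact e.symm_apply_apply w

/-- In the frame `φ`, the images of the coordinate vectors under `D ∘ L` are `(1, 0, s₁)` and `(0,
1, s₂)`, with `s₁`, `s₂` the exact slopes. The true gradient thus satisfies the same kind of system
as the recovered one, with exact data. -/
theorem isGraphGradient_of_mem_range {D : E2 →L[ℝ] E3} {φ : OrthonormalBasis (Fin 3) ℝ E3}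
    {L : E2 →L[ℝ] E2} (hleft : ∀ w, L (planeCoord φ (D w)) = w)
    (hright : ∀ y, planeCoord φ (D (L y)) = y) {g : E3} (hg : g ∈ D.range) {l : E2 →L[ℝ] ℝ}
    (hl : ∀ w, ⟪g, D w⟫_ℝ = l w) :
    IsGraphGradient (fun m => ⟪φ m, g⟫_ℝ) ⟪φ 2, D (L (EuclideanSpace.single 0 1))⟫_ℝ
      ⟪φ 2, D (L (EuclideanSpace.single 1 1))⟫_ℝ (l (L (EuclideanSpace.single 0 1)))
      (l (L (EuclideanSpace.single 1 1))) := by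
  have hc : ∀ y : E2, ⟪φ 0, D (L y)⟫_ℝ = y 0 ∧ ⟪φ 1, D (L y)⟫_ℝ = y 1 := fun y => by
    have h := hright y
    exact ⟨congrArg (fun z : E2 => z 0) h, congrArg (fun z : E2 => z 1) h⟩
  have hexp : ∀ v : E3, ⟪g, v⟫_ℝ = ⟪φ 0, g⟫_ℝ * ⟪φ 0, v⟫_ℝ + ⟪φ 1, g⟫_ℝ * ⟪φ 1, v⟫_ℝ
      + ⟪φ 2, g⟫_ℝ * ⟪φ 2, v⟫_ℝ := fun v => by
    rw [← φ.sum_inner_mul_inner g v, Fin.sum_univ_three]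
    simp only [real_inner_comm g]
  obtain ⟨w, rfl⟩ := hg
  have hw : D w = D (L (planeCoord φ (D w))) := by rw [hleft]
  refine ⟨?_, ?_, ?_⟩
  · have h1 : planeCoord φ (D w) = ⟪φ 0, D w⟫_ℝ • EuclideanSpace.single 0 1
        + ⟪φ 1, D w⟫_ℝ • EuclideanSpace.single 1 1 := by
      ext i; fin_cases i <;> simp [planeCoord]
    have h2 : D w = ⟪φ 0, D w⟫_ℝ • D (L (EuclideanSpace.single 0 1))
        + ⟪φ 1, D w⟫_ℝ • D (L (EuclideanSpace.single 1 1)) := by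
      conv_lhs => rw [hw, h1]
      simp only [map_add, map_smul]
    show ⟪φ 2, D w⟫_ℝ = ⟪φ 2, D (L (EuclideanSpace.single 0 1))⟫_ℝ * ⟪φ 0, D w⟫_ℝ
      + ⟪φ 2, D (L (EuclideanSpace.single 1 1))⟫_ℝ * ⟪φ 1, D w⟫_ℝ
    conv_lhs => rw [h2, inner_add_right, real_inner_smul_right, real_inner_smul_right]
    ring
  · have h := hl (L (EuclideanSpace.single 0 1))
    have h3 := hexp (D (L (EuclideanSpace.single 0 1)))
    rw [(hc _).1, (hc _).2] at h3
    rw [← h]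
    refine Eq.trans ?_ h3.symm
    simp
    ring
  · have h := hl (L (EuclideanSpace.single 1 1))
    have h3 := hexp (D (L (EuclideanSpace.single 1 1)))
    rw [(hc _).1, (hc _).2] at h3
    rw [← h]
    refine Eq.trans ?_ h3.symm
    simp
    ring

/-- The uniform rank condition at a single node. -/
def RankCondition (pin : Bool) (φ : OrthonormalBasis (Fin 3) ℝ E3) (x : E3) (S : Finset E3)
    (κ h : ℝ) : Prop :=
  ∀ c : Fin 6 → ℝ, (pin = true → c 0 = 0) → ∀ y : E2, ‖y‖ ≤ h →
    |quad c y| ≤ κ * √((∑ z ∈ S, quad c (planeCoord φ (z - x)) ^ 2) / S.card)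

/-- For stencils inside one chart: the fits of `u` and of the height are compared with the Taylor
polynomials, and the stability of the graph gradient transfers the errors of the coefficients to the
vector. -/
theorem norm_sub_nodalGradient_le_of_small {M : Set E3} {U V : Set E2} {r : E2 → E3} {C : ℝ}
    (hr : IsLocalParam M U r) (hVU : V ⊆ U) (hcb : ChartBound M r V C) (hC : 1 ≤ C)
    {u : E3 → ℝ} (hu : ContinuousOn u M) {B : ℝ} (hB : 0 ≤ B) (hS : SobolevBound M u B)
    {gradu : E3 → E3} (hgrad : ∀ x ∈ M, HasSurfaceGradientAt M u x (gradu x))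
    {pin : Bool} {φ : OrthonormalBasis (Fin 3) ℝ E3} {S : Finset E3} {κ h : ℝ} (hκ : 0 ≤ κ)
    (hh : 0 < h) {ζ : E2} (hζ : ζ ∈ V)
    (hgraph : ∀ w, ‖fderiv ℝ r ζ w‖ ≤ κ * ‖planeCoord φ (fderiv ℝ r ζ w)‖)
    (hrank : RankCondition pin φ (r ζ) S κ h) (hSV : ∀ z ∈ S, z ∈ r '' V)
    (hdist : ∀ z ∈ S, ‖z - r ζ‖ ≤ κ * h) (hsmall : C * (κ * h) ≤ 1) {v : E3 → ℝ}
    (hvx : v (r ζ) = u (r ζ)) (hvS : ∀ z ∈ S, v z = u z) :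
    ‖gradu (r ζ) - nodalGradient pin φ (r ζ) S v‖ ≤
      (12 * κ + 24 * κ * C) * (4 * (1 + C * κ * C) ^ 3 * C * (C * κ) ^ 3) * B * h ^ 2 := by
  set c := 4 * (1 + C * κ * C) ^ 3 * C * (C * κ) ^ 3 with hc
  have hC0 : 0 ≤ C := by linarith
  have hc0 : 0 ≤ c := by positivity
  obtain ⟨⟨l, q, hlq, hder⟩, hlin⟩ := hcb.sobolev u B hu hB hS
  obtain ⟨L, hL, hleft, hright⟩ := exists_graph_inverse hC0 (hcb.norm_le_deriv ζ hζ) hgraph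
  obtain ⟨b, hb0, hb1, hb2, hb⟩ := hcb.taylor.exists_quad hlq φ hζ hL hleft
  have hT : ‖(innerSL ℝ (φ 2) : E3 →L[ℝ] ℝ)‖ ≤ 1 := by
    rw [innerSL_apply_norm, φ.norm_eq_one]
  obtain ⟨b', hb'0, hb'1, hb'2, hb'⟩ :=
    hcb.taylor.exists_quad (hcb.taylor.clm_comp hT) φ hζ hL hleft
  have hdist3 : ∀ z ∈ S, ∃ ξ ∈ V, r ξ = z ∧ ‖ξ - ζ‖ ≤ 1 ∧ ‖ξ - ζ‖ ^ 3 ≤ (C * κ) ^ 3 * h ^ 3 := by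
    intro z hz
    obtain ⟨ξ, hξ, rfl⟩ := hSV z hz
    have h1 : ‖ξ - ζ‖ ≤ C * (κ * h) :=
      (hcb.norm_sub_le ζ hζ ξ hξ).trans (by gcongr; exact hdist _ hz)
    refine ⟨ξ, hξ, rfl, h1.trans hsmall, ?_⟩
    calc ‖ξ - ζ‖ ^ 3 ≤ (C * (κ * h)) ^ 3 := by gcongr
      _ = _ := by ring
  have hfit : ∀ z ∈ S, |quad b (planeCoord φ (z - r ζ)) - v z| ≤ c * B * h ^ 3 := by
    intro z hz
    obtain ⟨ξ, hξ, rfl, h1, h3⟩ := hdist3 z hz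
    rw [hvS _ hz]
    refine (hb ξ hξ h1).trans ?_
    calc _ ≤ 4 * (1 + C * κ * C) ^ 3 * (C * B) * ((C * κ) ^ 3 * h ^ 3) := by gcongr
      _ = _ := by rw [hc]; ring
  have hfit' : ∀ z ∈ S, |quad b' (planeCoord φ (z - r ζ)) - ⟪z, φ 2⟫_ℝ| ≤ c * h ^ 3 := by
    intro z hz
    obtain ⟨ξ, hξ, rfl, h1, h3⟩ := hdist3 z hz
    have h4 := hb' ξ hξ h1
    rw [innerSL_apply_apply, real_inner_comm] at h4
    refine h4.trans ?_
    calc _ ≤ 4 * (1 + C * κ * C) ^ 3 * C * ((C * κ) ^ 3 * h ^ 3) := by gcongr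
      _ = _ := by rw [hc]; ring
  set s := leastSquares pin φ (r ζ) S fun y => ⟪y, φ 2⟫_ℝ with hs
  set p := leastSquares pin φ (r ζ) S v with hp
  -- The Taylor polynomials have the exact value at the origin, so they compete in the
  -- value-preserving variant as well.
  obtain ⟨hp1, hp2⟩ := (isLeastSquares_leastSquares pin φ (r ζ) S v).abs_coeff_sub_le
    (b := b) (fun _ => by rw [hb0, hvx]; rfl) hκ hh (by positivity) hfit hrank
  obtain ⟨hs1, hs2⟩ := (isLeastSquares_leastSquares pin φ (r ζ) S
    fun y => ⟪y, φ 2⟫_ℝ).abs_coeff_sub_le (b := b')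
    (fun _ => by rw [hb'0, innerSL_apply_apply, real_inner_comm]) hκ hh (by positivity) hfit' hrank
  rw [← hp, hb1] at hp1
  rw [← hp, hb2] at hp2
  rw [← hs, hb'1] at hs1
  rw [← hs, hb'2] at hs2
  -- Passing from values to slopes costs one power of `h`.
  have hP : 2 * κ * (c * B * h ^ 3) / h = 2 * κ * c * B * h ^ 2 := by field_simp
  have hQ : 2 * κ * (c * h ^ 3) / h = 2 * κ * c * h ^ 2 := by field_simp
  rw [hP] at hp1 hp2
  rw [hQ] at hs1 hs2
  have hxM : r ζ ∈ M := hr.mapsTo (hVU hζ)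
  obtain ⟨-, hrange, hinner⟩ := hgrad (r ζ) hxM U r hr ζ (hVU hζ) rfl
  rw [(hder ζ hζ).fderiv] at hinner
  have hw := isGraphGradient_of_mem_range (φ := φ) hleft hright hrange hinner
  have hv := isGraphGradient_vecMul s (p 1) (p 2)
  have hG : ∀ m, |⟪φ m, gradu (r ζ)⟫_ℝ| ≤ C * B := fun m => by
    refine (abs_real_inner_le_norm _ _).trans ?_
    rw [φ.norm_eq_one, one_mul]
    exact (hlin gradu hgrad ζ hζ).1
  have hcomp := hv.abs_sub_le hw hp1 hp2 hs1 hs2 hG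
  have hdiff : gradu (r ζ) - nodalGradient pin φ (r ζ) S v
      = ∑ m, (⟪φ m, gradu (r ζ)⟫_ℝ -
        Matrix.vecMul ![p 1, p 2] ((jacT s * (jacT s).transpose)⁻¹ * jacT s) m) • φ m := by
    simp only [sub_smul, Finset.sum_sub_distrib]
    rw [φ.sum_repr']
    rfl
  rw [hdiff]
  refine (norm_sum_smul_le φ (A := 2 * (2 * κ * c * B * h ^ 2)
    + 4 * (2 * κ * c * h ^ 2 * (C * B))) fun m => ?_).trans (le_of_eq (by ring))
  rw [abs_sub_comm]
  exact hcomp m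

/-- A crude bound for coarse meshes. The fit is compared with a constant polynomial, and the vector
with `0`, which is a graph gradient for every pair of slopes, so the fitted slopes play no role. -/
theorem norm_nodalGradient_le {pin : Bool} {φ : OrthonormalBasis (Fin 3) ℝ E3} {x : E3}
    {S : Finset E3} {κ h A : ℝ} (hκ : 0 ≤ κ) (hh : 0 < h) (hA : 0 ≤ A)
    (hrank : RankCondition pin φ x S κ h) {v : E3 → ℝ} (hvx : |v x| ≤ A)
    (hvS : ∀ z ∈ S, |v z| ≤ A) : ‖nodalGradient pin φ x S v‖ ≤ 24 * κ * A / h := by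
  set s := leastSquares pin φ x S fun y => ⟪y, φ 2⟫_ℝ with hs
  set p := leastSquares pin φ x S v with hp
  obtain ⟨hp1, hp2⟩ := (isLeastSquares_leastSquares pin φ x S v).abs_coeff_sub_le
    (b := Pi.single 0 (v x)) (ε := 2 * A) (fun _ => by simp) hκ hh (by positivity)
    (fun z hz => by
      have : quad (Pi.single 0 (v x)) (planeCoord φ (z - x)) = v x := by simp [quad]
      rw [this]
      refine (abs_sub _ _).trans ?_
      have := hvS z hz
      linarith) hrank
  have hw : IsGraphGradient (0 : Fin 3 → ℝ) (s 1) (s 2) 0 0 := ⟨by simp, by simp, by simp⟩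
  have hcomp := (isGraphGradient_vecMul s (p 1) (p 2)).abs_sub_le hw
    (P := 2 * κ * (2 * A) / h) (Q := 0) (G := 0) (by simpa using hp1) (by simpa using hp2)
    (by simp) (by simp) (by simp)
  refine (norm_sum_smul_le φ (A := 2 * (2 * κ * (2 * A) / h)) fun m => ?_).trans
    (le_of_eq (by ring))
  simpa using hcomp m

/-- At every node the recovered gradient approximates the gradient to second order in the local
mesh size. -/
theorem exists_nodal_error_bound {M : Set E3} (hM : IsClosedSurface M) {κ : ℝ} (hκ : 1 ≤ κ) :
    ∃ D, 0 ≤ D ∧ ∀ (T : TriMesh) (pin : Bool) (φ : E3 → OrthonormalBasis (Fin 3) ℝ E3)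
      (k : E3 → ℕ), (∀ x ∈ T.nodes, x ∈ M) → IsAdmissible M T pin φ k κ →
      ∀ (u : E3 → ℝ) (B : ℝ), ContinuousOn u M → 0 ≤ B → SobolevBound M u B →
      ∀ gradu : E3 → E3, (∀ x ∈ M, HasSurfaceGradientAt M u x (gradu x)) → ∀ x ∈ T.nodes,
        ‖gradu x - nodalGradient pin (φ x) x (T.stencil (k x) x) (T.interp u)‖ ≤
          D * B * T.localSize x ^ 2 := by
  obtain ⟨δ, hδ, C, hC, hchart⟩ := exists_uniform_chartBound hM
  have hC0 : 0 < C := by linarith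
  have hκ0 : 0 < κ := by linarith
  set δ₁ := min δ (1 / C) with hδ₁
  have hδ₁0 : 0 < δ₁ := by positivity
  set D₁ := (12 * κ + 24 * κ * C) * (4 * (1 + C * κ * C) ^ 3 * C * (C * κ) ^ 3) with hD₁
  have hD₁0 : 0 ≤ D₁ := by positivity
  set D₂ := C * κ ^ 2 / δ₁ ^ 2 + 24 * κ * C * κ ^ 3 / δ₁ ^ 3 with hD₂
  have hD₂0 : 0 ≤ D₂ := by positivity
  refine ⟨D₁ + D₂, by positivity, fun T pin φ k hnodes hadm u B hu hB hS gradu hgrad x hx => ?_⟩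
  set h := T.localSize x with hh
  have hh0 : 0 < h := T.localSize_pos hx
  have hxM := hnodes x hx
  have hrank : RankCondition pin (φ x) x (T.stencil (k x) x) κ h := hadm.rank x hx
  have hdist : ∀ z ∈ T.stencil (k x) x, ‖z - x‖ ≤ κ * h := fun z hz => by
    rw [← dist_eq_norm]
    refine (T.dist_le_of_mem_stencil hz).trans ?_
    gcongr
    exact hadm.index_le x hx
  have hvx : T.interp u x = u x := T.interp_node u hx
  have hvS : ∀ z ∈ T.stencil (k x) x, T.interp u z = u z := fun z hz =>
    T.interp_node u (T.mem_nodes_of_mem_stencil hz)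
  rcases lt_or_ge (κ * h) δ₁ with hlt | hge
  -- Fine mesh: the whole stencil lies in one chart, at parameter distance at most one from the
  -- node.
  · obtain ⟨U, r, V, hr, hVU, hcb, hsub⟩ := hchart x hxM
    obtain ⟨ζ, hζ, rfl⟩ := hsub ⟨hxM, Metric.mem_ball_self hδ⟩
    have hmain := norm_sub_nodalGradient_le_of_small hr hVU hcb hC hu hB hS hgrad hκ0.le hh0 hζ
      (hadm.graph _ hx U r hr ζ (hVU hζ) rfl) hrank (fun z hz => hsub
        ⟨hnodes z (T.mem_nodes_of_mem_stencil hz), by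
          rw [Metric.mem_ball, dist_eq_norm]
          exact (hdist z hz).trans_lt (hlt.trans_le (min_le_left _ _))⟩) hdist (by
        have : κ * h ≤ 1 / C := hlt.le.trans (min_le_right _ _)
        rw [le_div_iff₀ hC0] at this
        linarith) hvx hvS
    refine hmain.trans ?_
    gcongr
    linarith
  · have hub : ∀ z ∈ M, |u z| ≤ C * B ∧ ‖gradu z‖ ≤ C * B := fun z hz => by
      obtain ⟨U, r, V, hr, hVU, hcb, hsub⟩ := hchart z hz
      obtain ⟨ζ, hζ, rfl⟩ := hsub ⟨hz, Metric.mem_ball_self hδ⟩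
      obtain ⟨⟨l, q, hlq, -⟩, hlin⟩ := hcb.sobolev u B hu hB hS
      exact ⟨hlq.norm_le ζ hζ, (hlin gradu hgrad ζ hζ).1⟩
    have hn := norm_nodalGradient_le (A := C * B) hκ0.le hh0 (by positivity) hrank
      (v := T.interp u) (by rw [hvx]; exact (hub x hxM).1) (fun z hz => by
        rw [hvS z hz]; exact (hub z (hnodes z (T.mem_nodes_of_mem_stencil hz))).1)
    -- Coarse mesh: powers of this ratio supply the missing factors `h ^ 2`, and `h ^ 3` where the
    -- crude bound carries `1 / h`.
    have hq : 1 ≤ κ * h / δ₁ := by rwa [le_div_iff₀ hδ₁0, one_mul]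
    have h1 : C * B ≤ C * κ ^ 2 / δ₁ ^ 2 * B * h ^ 2 := by
      calc C * B = C * B * 1 ^ 2 := by ring
        _ ≤ C * B * (κ * h / δ₁) ^ 2 := by gcongr
        _ = _ := by field_simp
    have h2 : 24 * κ * (C * B) / h ≤ 24 * κ * C * κ ^ 3 / δ₁ ^ 3 * B * h ^ 2 := by
      calc 24 * κ * (C * B) / h = 24 * κ * (C * B) / h * 1 ^ 3 := by ring
        _ ≤ 24 * κ * (C * B) / h * (κ * h / δ₁) ^ 3 := by gcongr
        _ = _ := by field_simp
    refine (norm_sub_le _ _).trans ((add_le_add (hub x hxM).2 hn).trans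
      ((add_le_add h1 h2).trans ?_))
    have h3 : C * κ ^ 2 / δ₁ ^ 2 * B * h ^ 2 + 24 * κ * C * κ ^ 3 / δ₁ ^ 3 * B * h ^ 2
        = D₂ * B * h ^ 2 := by rw [hD₂]; ring
    rw [h3]
    gcongr
    linarith

/-! ### Error of linear interpolation and conclusion -/

theorem norm_convex_sum_le {ι F : Type*} [NormedAddCommGroup F] [NormedSpace ℝ F] {s : Finset ι}
    {w : ι → ℝ} (h0 : ∀ v ∈ s, 0 ≤ w v) (h1 : ∑ v ∈ s, w v = 1) {a : ι → F} {A : ℝ}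
    (ha : ∀ v ∈ s, ‖a v‖ ≤ A) : ‖∑ v ∈ s, w v • a v‖ ≤ A := by
  refine (norm_sum_le _ _).trans ?_
  calc _ ≤ ∑ v ∈ s, w v * A := Finset.sum_le_sum fun v hv => by
        rw [norm_smul, Real.norm_of_nonneg (h0 v hv)]
        exact mul_le_mul_of_nonneg_left (ha v hv) (h0 v hv)
    _ = A := by rw [← Finset.sum_mul, h1, one_mul]

theorem convex_sum_sub {ι F : Type*} [NormedAddCommGroup F] [NormedSpace ℝ F] {s : Finset ι}
    {w : ι → ℝ} (h1 : ∑ v ∈ s, w v = 1) (a : ι → F) (b : F) :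
    ∑ v ∈ s, w v • (a v - b) = ∑ v ∈ s, w v • a v - b := by
  simp only [smul_sub, Finset.sum_sub_distrib, ← Finset.sum_smul, h1, one_smul]

/-- The gradient at a point of the surface is approximated to second order by convex combinations
of gradients at neighbouring points. -/
theorem exists_interpolation_error_bound {M : Set E3} (hM : IsClosedSurface M) {κ : ℝ}
    (hκ : 1 ≤ κ) :
    ∃ D, 0 ≤ D ∧ ∀ (u : E3 → ℝ) (B : ℝ), ContinuousOn u M → 0 ≤ B → SobolevBound M u B →
      ∀ gradu : E3 → E3, (∀ x ∈ M, HasSurfaceGradientAt M u x (gradu x)) →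
      ∀ (s : Finset E3) (w : E3 → ℝ) (h : ℝ) (y : E3), (∀ v ∈ s, v ∈ M) → (∀ v ∈ s, 0 ≤ w v) →
        ∑ v ∈ s, w v = 1 → y ∈ M → 0 ≤ h → ‖y - ∑ v ∈ s, w v • v‖ ≤ κ * h ^ 2 →
        (∀ v ∈ s, ‖v - ∑ v ∈ s, w v • v‖ ≤ h) →
        ‖gradu y - ∑ v ∈ s, w v • gradu v‖ ≤ D * B * h ^ 2 := by
  obtain ⟨δ, hδ, C, hC, hchart⟩ := exists_uniform_chartBound hM
  have hC0 : 0 < C := by linarith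
  have hκ0 : 0 < κ := by linarith
  -- Below `h₀`, the bound `κ * h ^ 2` is at most `κ * h`, all points of `s` lie in the chart around
  -- `y`, and parameter distances are at most one.
  set h₀ := min 1 (min (δ / (2 * (1 + κ))) (1 / (C * (1 + κ)))) with hh₀
  have hh₀0 : 0 < h₀ := by positivity
  set D₁ := C * (C * (κ + 2 * C * (C * (1 + κ)) ^ 2)) + C * (C * (1 + κ)) ^ 2 with hD₁
  have hD₁0 : 0 ≤ D₁ := by positivity
  refine ⟨D₁ + 2 * C / h₀ ^ 2, by positivity,
    fun u B hu hB hS gradu hgrad s w h y hsM hw0 hw1 hy hh hyx hvx => ?_⟩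
  rcases lt_or_ge h h₀ with hlt | hge
  · obtain ⟨U, r, V, hr, hVU, hcb, hsub⟩ := hchart y hy
    obtain ⟨ζ, hζ, rfl⟩ := hsub ⟨hy, Metric.mem_ball_self hδ⟩
    have hh1 : h ≤ 1 := hlt.le.trans (min_le_left _ _)
    have hhδ : (1 + κ) * h < δ := by
      have : h < δ / (2 * (1 + κ)) := hlt.trans_le ((min_le_right _ _).trans (min_le_left _ _))
      rw [lt_div_iff₀ (by positivity)] at this
      linarith
    have hhC : C * (1 + κ) * h ≤ 1 := by
      have : h ≤ 1 / (C * (1 + κ)) :=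
        hlt.le.trans ((min_le_right _ _).trans (min_le_right _ _))
      rw [le_div_iff₀ (by positivity)] at this
      linarith
    have hvy : ∀ v ∈ s, ‖v - r ζ‖ ≤ (1 + κ) * h := fun v hv => by
      have h1 := hvx v hv
      have h2 : κ * h ^ 2 ≤ κ * h := by
        gcongr
        rw [pow_two]
        exact mul_le_of_le_one_left hh hh1
      calc ‖v - r ζ‖ = ‖(v - ∑ v ∈ s, w v • v) - (r ζ - ∑ v ∈ s, w v • v)‖ := by congr 1; abel
        _ ≤ _ := norm_sub_le _ _
        _ ≤ (1 + κ) * h := by linarith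
    have hξ : ∀ v, ∃ ξ, v ∈ s → ξ ∈ V ∧ r ξ = v := fun v => by
      by_cases hv : v ∈ s
      · obtain ⟨ξ, h1, h2⟩ := hsub ⟨hsM v hv, by
          rw [Metric.mem_ball, dist_eq_norm]
          exact (hvy v hv).trans_lt hhδ⟩
        exact ⟨ξ, fun _ => ⟨h1, h2⟩⟩
      · exact ⟨0, fun h => absurd h hv⟩
    choose ξ hξ using hξ
    have hd : ∀ v ∈ s, ‖ξ v - ζ‖ ≤ C * (1 + κ) * h := fun v hv => by
      refine (hcb.norm_sub_le ζ hζ (ξ v) (hξ v hv).1).trans ?_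
      rw [(hξ v hv).2, mul_assoc]
      gcongr
      exact hvy v hv
    have hd2 : ∀ v ∈ s, ‖ξ v - ζ‖ ^ 2 ≤ (C * (1 + κ)) ^ 2 * h ^ 2 := fun v hv => by
      rw [← mul_pow]
      gcongr
      exact hd v hv
    obtain ⟨-, L, hL, hLin⟩ := (hcb.sobolev u B hu hB hS).2 gradu hgrad ζ hζ
    -- The single displacements are only `O(h)`, but their weighted mean is `O(h ^ 2)`: the
    -- differential sends it to the distance from the convex combination to `y`, up to averaged
    -- quadratic remainders. The linear part of the gradient's expansion sees only this mean.
    set e := ∑ v ∈ s, w v • (ξ v - ζ) with he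
    have hDe : fderiv ℝ r ζ e = (∑ v ∈ s, w v • v - r ζ)
        - ∑ v ∈ s, w v • (v - r ζ - fderiv ℝ r ζ (ξ v - ζ)) := by
      rw [← convex_sum_sub hw1 (fun v => v) (r ζ), ← Finset.sum_sub_distrib, he, map_sum]
      refine Finset.sum_congr rfl fun v _ => ?_
      rw [map_smul, ← smul_sub]
      congr 1
      abel
    have hrem : ‖∑ v ∈ s, w v • (v - r ζ - fderiv ℝ r ζ (ξ v - ζ))‖
        ≤ 2 * C * ((C * (1 + κ)) ^ 2 * h ^ 2) := norm_convex_sum_le hw0 hw1 fun v hv => by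
      have := hcb.taylor.norm_sub_sub_le hζ (hξ v hv).1 ((hd v hv).trans hhC)
      rw [(hξ v hv).2] at this
      refine this.trans ?_
      gcongr
      exact hd2 v hv
    have hen : ‖e‖ ≤ C * (κ + 2 * C * (C * (1 + κ)) ^ 2) * h ^ 2 := by
      refine (hcb.norm_le_deriv ζ hζ e).trans ?_
      rw [mul_assoc]
      gcongr
      rw [hDe]
      refine (norm_sub_le _ _).trans ?_
      rw [norm_sub_rev]
      refine (add_le_add hyx hrem).trans (le_of_eq (by ring))
    have hsplit : ∑ v ∈ s, w v • gradu v - gradu (r ζ)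
        = L e + ∑ v ∈ s, w v • (gradu v - gradu (r ζ) - L (ξ v - ζ)) := by
      rw [← convex_sum_sub hw1, he, map_sum, ← Finset.sum_add_distrib]
      refine Finset.sum_congr rfl fun v _ => ?_
      rw [map_smul, ← smul_add]
      congr 1
      abel
    have hrem2 : ‖∑ v ∈ s, w v • (gradu v - gradu (r ζ) - L (ξ v - ζ))‖
        ≤ C * B * ((C * (1 + κ)) ^ 2 * h ^ 2) := norm_convex_sum_le hw0 hw1 fun v hv => by
      have := hLin (ξ v) (hξ v hv).1
      simp only [Function.comp_apply, (hξ v hv).2] at this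
      refine this.trans ?_
      gcongr
      exact hd2 v hv
    have hLe : ‖L e‖ ≤ C * B * (C * (κ + 2 * C * (C * (1 + κ)) ^ 2) * h ^ 2) :=
      (L.le_opNorm e).trans (by gcongr)
    rw [norm_sub_rev, hsplit]
    refine (norm_add_le _ _).trans ((add_le_add hLe hrem2).trans ?_)
    calc _ = D₁ * B * h ^ 2 := by rw [hD₁]; ring
      _ ≤ _ := by
        gcongr
        have : 0 ≤ 2 * C / h₀ ^ 2 := by positivity
        linarith
  · have hgb : ∀ z ∈ M, ‖gradu z‖ ≤ C * B := fun z hz => by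
      obtain ⟨U, r, V, hr, hVU, hcb, hsub⟩ := hchart z hz
      obtain ⟨ζ, hζ, rfl⟩ := hsub ⟨hz, Metric.mem_ball_self hδ⟩
      exact ((hcb.sobolev u B hu hB hS).2 gradu hgrad ζ hζ).1
    have h1 : ‖∑ v ∈ s, w v • gradu v‖ ≤ C * B :=
      norm_convex_sum_le hw0 hw1 fun v hv => hgb v (hsM v hv)
    have hq : 1 ≤ h / h₀ := by rwa [le_div_iff₀ hh₀0, one_mul]
    refine (norm_sub_le _ _).trans ((add_le_add (hgb y hy) h1).trans ?_)
    calc C * B + C * B = 2 * C * B * 1 ^ 2 := by ring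
      _ ≤ 2 * C * B * (h / h₀) ^ 2 := by gcongr
      _ = 2 * C / h₀ ^ 2 * B * h ^ 2 := by field_simp
      _ ≤ _ := by
        gcongr
        linarith

/-! ### Combination of nodal and interpolation errors, and passage to the `L²` norm. -/

theorem IsAdmissible.mono {M : Set E3} {T : TriMesh} {pin : Bool}
    {φ : E3 → OrthonormalBasis (Fin 3) ℝ E3} {k : E3 → ℕ} {κ κ' : ℝ}
    (h : IsAdmissible M T pin φ k κ) (hκ : κ ≤ κ') : IsAdmissible M T pin φ k κ' where
  index_le x hx := (h.index_le x hx).trans hκ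
  graph x hx U r hr ζ hζ hζx w := (h.graph x hx U r hr ζ hζ hζx w).trans (by gcongr)
  rank x hx a ha y hy := (h.rank x hx a ha y hy).trans (by gcongr)

theorem TriMesh.meshSize_nonneg (T : TriMesh) : 0 ≤ T.meshSize :=
  Real.sSup_nonneg (by rintro _ ⟨s, -, rfl⟩; exact Metric.diam_nonneg)

/-- Pointwise form of the error estimate. -/
theorem exists_pointwise_error_bound {M : Set E3} (hM : IsClosedSurface M) (κ : ℝ) :
    ∃ D, 0 < D ∧ ∀ (T : TriMesh) (P : E3 → E3) (pin : Bool)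
      (φ : E3 → OrthonormalBasis (Fin 3) ℝ E3) (k : E3 → ℕ),
      IsApproximation M T P κ → IsAdmissible M T pin φ k κ →
      ∀ (u : E3 → ℝ) (B : ℝ), ContinuousOn u M → 0 ≤ B → SobolevBound M u B →
      ∀ gradu : E3 → E3, (∀ x ∈ M, HasSurfaceGradientAt M u x (gradu x)) → ∀ y ∈ M,
        ‖gradu y - pullBack T P (recovery T pin φ k (T.interp u)) y‖ ≤
          D * T.meshSize ^ 2 * B := by
  -- `κ` is an arbitrary real number; regularity with constant `κ` persists for larger constants, so
  -- `1 ≤ κ` may be assumed in the auxiliary bounds.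
  set κ' := max κ 1
  have hκ1 : 1 ≤ κ' := le_max_right _ _
  have hκκ' : κ ≤ κ' := le_max_left _ _
  obtain ⟨D₁, hD₁, h₁⟩ := exists_nodal_error_bound hM hκ1
  obtain ⟨D₂, hD₂, h₂⟩ := exists_interpolation_error_bound hM hκ1
  refine ⟨D₁ + D₂ + 1, by positivity,
    fun T P pin φ k happ hadm u B hu hB hS gradu hgrad y hy => ?_⟩
  have hy' : y ∈ P '' T.carrier := happ.bijOn.surjOn hy
  set x := Function.invFunOn P T.carrier y with hx
  have hxc : x ∈ T.carrier := Function.invFunOn_mem hy'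
  have hPx : P x = y := Function.invFunOn_eq hy'
  set G : E3 → E3 := fun x => nodalGradient pin (φ x) x (T.stencil (k x) x) (T.interp u) with hG
  obtain ⟨s, hs, w, hw0, hw1, hwx, hint⟩ := T.interp_spec G hxc
  have hrec : pullBack T P (recovery T pin φ k (T.interp u)) y = ∑ v ∈ s, w v • G v := hint
  have hxs : x ∈ convexHull ℝ (s : Set E3) := Finset.mem_convexHull'.mpr ⟨w, hw0, hw1, hwx⟩
  have hnode : ∀ v ∈ s, v ∈ T.nodes := fun v hv => T.mem_nodes_of_mem_face hs hv
  have hh := T.meshSize_nonneg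
  have e₁ : ‖∑ v ∈ s, w v • (gradu v - G v)‖ ≤ D₁ * B * T.meshSize ^ 2 :=
    norm_convex_sum_le hw0 hw1 fun v hv => by
      refine (h₁ T pin φ k happ.nodes_mem (hadm.mono hκκ') u B hu hB hS gradu hgrad v
        (hnode v hv)).trans ?_
      have := (T.localSize_pos (hnode v hv)).le
      gcongr
      exact T.localSize_le_meshSize (hnode v hv)
  have e₂ : ‖gradu y - ∑ v ∈ s, w v • gradu v‖ ≤ D₂ * B * T.meshSize ^ 2 := by
    refine h₂ u B hu hB hS gradu hgrad s w T.meshSize y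
      (fun v hv => happ.nodes_mem v (hnode v hv)) hw0 hw1 hy hh ?_ fun v hv => ?_
    · rw [hwx]
      have := happ.near x hxc
      rw [hPx] at this
      exact this.trans (by gcongr)
    · rw [hwx, ← dist_eq_norm]
      exact T.dist_le_meshSize hs (subset_convexHull ℝ _ hv) hxs
  have hsplit : gradu y - ∑ v ∈ s, w v • G v
      = (gradu y - ∑ v ∈ s, w v • gradu v) + ∑ v ∈ s, w v • (gradu v - G v) := by
    simp only [smul_sub, Finset.sum_sub_distrib]
    abel
  rw [hrec, hsplit]
  refine (norm_add_le _ _).trans ((add_le_add e₂ e₁).trans ?_)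
  have : 0 ≤ B * T.meshSize ^ 2 := by positivity
  linarith

theorem SobolevBound.mono {M : Set E3} {u : E3 → ℝ} {B B' : ℝ} (h : SobolevBound M u B)
    (hle : B ≤ B') : SobolevBound M u B' := fun U r hr => by
  obtain ⟨a, b, c, ha, hb, hc, hae⟩ := h U r hr
  refine ⟨a, b, c, ha, hb, hc, hae.mono fun ζ hζ => ?_⟩
  exact ⟨hζ.1.trans hle, hζ.2.1.trans hle, hζ.2.2.1.trans hle, hζ.2.2.2.trans hle⟩

/-- The norm is an infimum of admissible bounds. An estimate valid for each of them passes to the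
infimum, which need not be shown to be attained. -/
theorem le_mul_sobolevNorm {M : Set E3} {u : E3 → ℝ} (hu : MemSobolev M u) {c e : ℝ} (hc : 0 ≤ c)
    (h : ∀ B, 0 ≤ B → SobolevBound M u B → e ≤ c * B) : e ≤ c * sobolevNorm M u := by
  obtain ⟨-, B₀, hB₀⟩ := hu
  have hne : {B | 0 ≤ B ∧ SobolevBound M u B}.Nonempty :=
    ⟨max B₀ 0, le_max_right _ _, hB₀.mono (le_max_left _ _)⟩
  have hbdd : BddBelow {B | 0 ≤ B ∧ SobolevBound M u B} := ⟨0, fun B hB => hB.1⟩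
  rcases hc.eq_or_lt with rfl | hc'
  · obtain ⟨B, hB0, hB⟩ := hne
    simpa using h B hB0 hB
  · rw [mul_comm, ← div_le_iff₀ hc']
    refine le_csInf hne fun B hB => ?_
    rw [div_le_iff₀ hc', mul_comm]
    exact h B hB.1 hB.2

end PPPR

open PPPR in
theorem lemma5p2 (M : Set E3) (hM : IsClosedSurface M) (κ : ℝ) :
    ∃ D : ℝ, 0 < D ∧
      ∀ (T : TriMesh) (P : E3 → E3) (pin : Bool) (φ : E3 → OrthonormalBasis (Fin 3) ℝ E3)
        (k : E3 → ℕ),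
        IsApproximation M T P κ → IsAdmissible M T pin φ k κ →
          ∀ u : E3 → ℝ, MemSobolev M u →
            ∃ gradu : E3 → E3,
              (∀ x ∈ M, HasSurfaceGradientAt M u x (gradu x)) ∧
              eLpNorm (fun y => gradu y - pullBack T P (recovery T pin φ k (T.interp u)) y) 2
                  ((μHE[2] : Measure E3).restrict M) ≤
                ENNReal.ofReal (T.meshSize ^ 2 * √((μHE[2] : Measure E3).real M) * D *
                  sobolevNorm M u) := by
  obtain ⟨D, hD, hmain⟩ := exists_pointwise_error_bound hM κ
  refine ⟨D, hD, fun T P pin φ k happ hadm u hu => ?_⟩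
  have hgrad : ∀ x, ∃ v, x ∈ M → HasSurfaceGradientAt M u x v := fun x => by
    by_cases hx : x ∈ M
    · obtain ⟨B, hB⟩ := hu.2
      obtain ⟨v, hv⟩ := exists_hasSurfaceGradientAt hM hu.1 (le_max_right B 0)
        (hB.mono (le_max_left _ _)) hx
      exact ⟨v, fun _ => hv⟩
    · exact ⟨0, fun h => absurd h hx⟩
  choose gradu hgradu using hgrad
  refine ⟨gradu, hgradu, ?_⟩
  have hpt : ∀ y ∈ M, ‖gradu y - pullBack T P (recovery T pin φ k (T.interp u)) y‖ ≤
      D * T.meshSize ^ 2 * sobolevNorm M u := fun y hy =>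
    le_mul_sobolevNorm hu (by positivity) fun B hB hS =>
      hmain T P pin φ k happ hadm u B hu.1 hB hS gradu hgradu y hy
  -- Finiteness is essential for the form of the bound: the real-valued measure of a set of infinite
  -- measure is `0`.
  have hfin := euclideanHausdorffMeasure_lt_top hM
  have hae : ∀ᵐ y ∂((μHE[2] : Measure E3).restrict M),
      ‖gradu y - pullBack T P (recovery T pin φ k (T.interp u)) y‖ ≤
        D * T.meshSize ^ 2 * sobolevNorm M u :=
    (ae_restrict_iff' hM.isCompact.measurableSet).mpr (ae_of_all _ hpt)
  -- The uniform bound controls the `L²` norm with factor the square root of the area, without any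
  -- measurability of the recovered gradient.
  refine (eLpNorm_le_of_ae_bound hae).trans (le_of_eq ?_)
  rw [Measure.restrict_apply_univ]
  have h1 : (μHE[2] : Measure E3) M ^ (2 : ENNReal).toReal⁻¹
      = ENNReal.ofReal (√((μHE[2] : Measure E3).real M)) := by
    rw [Real.sqrt_eq_rpow, ← ENNReal.ofReal_rpow_of_nonneg measureReal_nonneg (by norm_num),
      ofReal_measureReal hfin.ne]
    norm_num
  rw [h1, ← ENNReal.ofReal_mul (Real.sqrt_nonneg _)]
  congr 1
  ring
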